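/- **Setting.** Let $N\ge 3$, let $\Omega\subset\mathbb R^N$ be a smooth bounded domain, let $(\varphi_k)_{k\ge1}$ be a complete $L^2(\Omega)$-orthonormal system of eigenfunctions of $-\Delta$ in $H^1_0(\Omega)$ with positive eigenvalues $\lambda_1\le\lambda_2\le\dots$, and let $p,q>1$ and $r$ satisfy $$N\Big(\tfrac12-\tfrac1{q+1}\Big)<r<2-N\Big(\tfrac12-\tfrac1{p+1}\Big)$$ (hence $0<r<2$). For $s\ge0$ let $\Theta^s(\Omega)=\{u=\sum_k\xi_k\varphi_k\in L^2(\Omega):\ \|u\|_{\Theta^s}^2=\sum_k\lambda_k^s\xi_k^2<\infty\}$, and let $E^r=\Theta^r(\Omega)\times\Theta^{2-r}(\Omega)$ with the product Hilbert norm. For $h,k\in L^2(\Omega)$ and $\mathbf u=(u,v)\in E^r$ with $u=\sum_k\xi_k\varphi_k$, $v=\sum_k\eta_k\varphi_k$, put $$\mathcal A(\mathbf u)=\sum_k\lambda_k\xi_k\eta_k,\qquad P(\mathbf u)=\tfrac1{q+1}\int_\Omega|u|^{q+1}dx+\tfrac1{p+1}\int_\Omega|v|^{p+1}dx,\qquad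 \ell(\mathbf u)=\int_\Omega ku\,dx+\int_\Omega hv\,dx,$$ $$I(\mathbf u)=\mathcal A(\mathbf u)-P(\mathbf u)-\ell(\mathbf u).$$ Let $\chi\in C^\infty(\mathbb R)$ satisfy $\chi(t)=1$ for $t\le1$, $\chi(t)=0$ for $t\ge2$ and $-2<\chi'(t)<0$ for $1<t<2$. Call a real number $A$ *admissible* for $(h,k)$ if $$P(\mathbf u)\le A\sqrt{I(\mathbf u)^2+1}\quad\text{for all }\mathbf u\in E^r\text{ with }I'(\mathbf u)\mathbf u=0,$$ and for such $A$ define the modified functional $$J(\mathbf u)=\mathcal A(\mathbf u)-P(\mathbf u)-\chi\!\left(\frac{P(\mathbf u)}{2A\sqrt{I(\mathbf u)^2+1}}\right)\ell(\mathbf u).$$ Let $X_n=\langle \mathbf e_1^-,\dots,\mathbf e_n^-\rangle\oplus E^+$, where $\mathbf e_k^-=\frac1{\sqrt2}(\lambda_k^{-r/2}\varphi_k,-\lambda_k^{r/2-1}\varphi_k)$ and $E^+=\{(u,(-\Delta)^{r-1}u):u\in\Theta^r(\Omega)\}$, that is, $E^+$ consists of the $(u,v)\in E^r$ with $\eta_k=\lambda_k^{r-1}\xi_k$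 for all $k$. A $C^1$ functional $F$ on $E^r$ satisfies $(PS)_c$ if every sequence $(\mathbf u_n)$ in $E^r$ with $F(\mathbf u_n)\to c$ and $F'(\mathbf u_n)\to0$ has a convergent subsequence, and it satisfies $(PS)_c^*$ if every sequence with $\mathbf u_n\in X_n$ for all $n$, $F(\mathbf u_n)\to c$ and $(F|_{X_n})'(\mathbf u_n)\to0$ has a subsequence converging in $E^r$. **Proposition 4.2.** The integrals in $P$ are finite on $E^r$ and $I\in C^1(E^r,\mathbb R)$ for all $h,k\in L^2(\Omega)$. For given values $a,b$ of the norms $\|h\|_2$, $\|k\|_2$ there is an $A>0$ that is admissible for all $(h,k)$ with $\|h\|_2=a$, $\|k\|_2=b$. Moreover, for every $A$ there are constants $\beta>0$, $M_0>0$ and $M_1\ge M_0$, which depend on $h,k$ only through $\|h\|_2=a$ and $\|k\|_2=b$, such that for all such $h,k$ for which $A$ is admissible, $J\in C^1(E^r,\mathbb R)$ and: 1. for all $\mathbf u\in E^r$, $\ |J(\mathbf u)-J(-\mathbf u)|\le\beta\left(|J(\mathbf u)|^{\frac1{q+1}}+|J(\mathbf u)|^{\frac1{p+1}}+1\right)$;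 2. if $J(\mathbf u)\ge M_0$ and $J'(\mathbf u)=0$, then $J(\mathbf u)=I(\mathbf u)$ and $I'(\mathbf u)=0$; 3. for every $c>M_1$, $J$ satisfies $(PS)_c$ and $(PS)_c^*$. -/

import Mathlib

open MeasureTheory Filter Topology Set
open scoped ContDiff

namespace HamiltonianSystem

noncomputable section

/-- `ℝ^N` with its Euclidean norm. -/
abbrev Eucl (N : ℕ) : Type := EuclideanSpace ℝ (Fin N)

/-- Bounded domain (nonempty, open, connected) whose boundary is locally the zero set of a smooth
function with nonvanishing differential, the domain lying on its negative side. -/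
structure IsSmoothBoundedDomain {N : ℕ} (Ω : Set (Eucl N)) : Prop where
  isOpen : IsOpen Ω
  isConnected : IsConnected Ω
  isBounded : Bornology.IsBounded Ω
  smooth_boundary : ∀ x ∈ frontier Ω, ∃ (U : Set (Eucl N)) (ρ : Eucl N → ℝ),
    IsOpen U ∧ x ∈ U ∧ ContDiff ℝ ∞ ρ ∧ fderiv ℝ ρ x ≠ 0 ∧ Ω ∩ U = {y ∈ U | ρ y < 0}

/-- Lebesgue measure on `Ω`. -/
abbrev vol {N : ℕ} (Ω : Set (Eucl N)) : Measure (Eucl N) := volume.restrict Ω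

/-- The real Hilbert space `L²(Ω)`. -/
abbrev L2 {N : ℕ} (Ω : Set (Eucl N)) : Type := Lp ℝ 2 (vol Ω)

/-- Test functions `C_c^∞(Ω)`. -/
structure IsTest {N : ℕ} (Ω : Set (Eucl N)) (ψ : Eucl N → ℝ) : Prop where
  smooth : ContDiff ℝ ∞ ψ
  compact : HasCompactSupport ψ
  support : tsupport ψ ⊆ Ω

/-- `u ∈ H_0^1(Ω)` with weak gradient `G`, where `H_0^1(Ω)` is the closure of `C_c^∞(Ω)` for the
norm `(‖u‖₂² + ‖∇u‖₂²)^{1/2}`. -/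
def HasH10Gradient {N : ℕ} (Ω : Set (Eucl N)) (u : Eucl N → ℝ) (G : Eucl N → Eucl N) : Prop :=
  MemLp u 2 (vol Ω) ∧ MemLp G 2 (vol Ω) ∧
  ∃ ψ : ℕ → Eucl N → ℝ, (∀ n, IsTest Ω (ψ n)) ∧
    Tendsto (fun n => eLpNorm (fun x => ψ n x - u x) 2 (vol Ω)) atTop (𝓝 0) ∧
    Tendsto (fun n => eLpNorm (fun x => gradient (ψ n) x - G x) 2 (vol Ω)) atTop (𝓝 0)

/-- `u ∈ H_0^1(Ω)` and `-Δ u = lam u` weakly in `Ω`. -/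
def IsDirichletEigenfunction {N : ℕ} (Ω : Set (Eucl N)) (lam : ℝ) (u : Eucl N → ℝ) : Prop :=
  ∃ G : Eucl N → Eucl N, HasH10Gradient Ω u G ∧
    ∀ ψ : Eucl N → ℝ, IsTest Ω ψ →
      ∫ x in Ω, inner ℝ (G x) (gradient ψ x) = lam * ∫ x in Ω, u x * ψ x

/-- A complete `L²`-orthonormal system of eigenfunctions of `-Δ` with zero Dirichlet boundary
values; the positive eigenvalues are listed in nondecreasing order, with multiplicity. -/
structure DirichletEigenbasis {N : ℕ} (Ω : Set (Eucl N)) where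
  /-- the eigenfunctions -/
  φ : HilbertBasis ℕ ℝ (L2 Ω)
  /-- the eigenvalues -/
  ev : ℕ → ℝ
  ev_pos : ∀ k, 0 < ev k
  ev_mono : Monotone ev
  eigen : ∀ k, IsDirichletEigenfunction Ω (ev k) (φ k)

variable {N : ℕ} {Ω : Set (Eucl N)}

/-- The Fourier coefficient `ξ_k = ∫_Ω u φ_k`. -/
def fourier (B : DirichletEigenbasis Ω) (u : L2 Ω) (k : ℕ) : ℝ := inner ℝ (B.φ k) u

theorem fourier_add (B : DirichletEigenbasis Ω) (u v : L2 Ω) (k : ℕ) :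
    fourier B (u + v) k = fourier B u k + fourier B v k := inner_add_right _ _ _

theorem fourier_smul (B : DirichletEigenbasis Ω) (c : ℝ) (u : L2 Ω) (k : ℕ) :
    fourier B (c • u) k = c * fourier B u k := real_inner_smul_right _ _ _

theorem fourier_φ (B : DirichletEigenbasis Ω) (j k : ℕ) :
    fourier B (B.φ j) k = if k = j then 1 else 0 :=
  orthonormal_iff_ite.mp B.φ.orthonormal k j

theorem eq_zero_of_fourier (B : DirichletEigenbasis Ω) {u : L2 Ω} (h : ∀ k, fourier B u k = 0) :
    u = 0 := by
  apply B.φ.repr.injective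
  ext k
  rw [B.φ.repr_apply_apply, map_zero]
  exact h k

theorem summable_weight {a x y : ℕ → ℝ} (ha : ∀ k, 0 ≤ a k)
    (hx : Summable fun k => a k * x k ^ 2) (hy : Summable fun k => a k * y k ^ 2) :
    Summable fun k => a k * (x k * y k) := by
  refine Summable.of_norm_bounded (hx.add hy) fun k => ?_
  rw [Real.norm_eq_abs, abs_mul, abs_of_nonneg (ha k), ← mul_add]
  refine mul_le_mul_of_nonneg_left ?_ (ha k)
  rw [abs_le]
  constructor <;> nlinarith [sq_nonneg (x k + y k), sq_nonneg (x k - y k)]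

/-- `{∑ ξ_k φ_k ∈ L²(Ω) : ∑ λ_k^s ξ_k² < ∞}`, the domain of `(-Δ)^{s/2}` for `s ≥ 0`. -/
def thetaSubmodule (B : DirichletEigenbasis Ω) (s : ℝ) : Submodule ℝ (L2 Ω) where
  carrier := {u | Summable fun k => B.ev k ^ s * fourier B u k ^ 2}
  zero_mem' := by simp [fourier, summable_zero]
  add_mem' := by
    intro u v hu hv
    have h := (hu.add hv).add
      ((summable_weight (fun k => Real.rpow_nonneg (B.ev_pos k).le s) hu hv).mul_left 2)
    refine h.congr fun k => ?_
    rw [fourier_add]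
    ring
  smul_mem' := by
    intro c u hu
    refine (Summable.mul_left (c ^ 2) hu).congr fun k => ?_
    rw [fourier_smul]
    ring

/-- The space `Θ^s(Ω)` as a type of its own: its norm is not the one of `L²(Ω)`. -/
def Theta (B : DirichletEigenbasis Ω) (s : ℝ) : Type := thetaSubmodule B s

namespace Theta

variable {B : DirichletEigenbasis Ω} {s : ℝ}

instance : AddCommGroup (Theta B s) := inferInstanceAs (AddCommGroup (thetaSubmodule B s))

instance : Module ℝ (Theta B s) := inferInstanceAs (Module ℝ (thetaSubmodule B s))

/-- The underlying function in `L²(Ω)`, as a linear map. -/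
def toL2 : Theta B s →ₗ[ℝ] L2 Ω := (thetaSubmodule B s).subtype

theorem toL2_injective : Function.Injective (toL2 : Theta B s →ₗ[ℝ] L2 Ω) :=
  Subtype.val_injective

/-- The Fourier coefficients of an element of `Θ^s(Ω)`. -/
def coeff (u : Theta B s) (k : ℕ) : ℝ := fourier B (toL2 u) k

theorem coeff_add (u v : Theta B s) (k : ℕ) : coeff (u + v) k = coeff u k + coeff v k := by
  simp [coeff, fourier_add]

theorem coeff_smul (c : ℝ) (u : Theta B s) (k : ℕ) : coeff (c • u) k = c * coeff u k := by
  simp [coeff, fourier_smul]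

theorem summable (u : Theta B s) : Summable fun k => B.ev k ^ s * coeff u k ^ 2 := u.2

theorem summable_inner (u v : Theta B s) :
    Summable fun k => B.ev k ^ s * (coeff u k * coeff v k) :=
  summable_weight (fun k => Real.rpow_nonneg (B.ev_pos k).le s) u.summable v.summable

/-- The inner product `(u, v)_{Θ^s} = ∑ λ_k^s ξ_k η_k`. -/
abbrev core (B : DirichletEigenbasis Ω) (s : ℝ) : InnerProductSpace.Core ℝ (Theta B s) where
  inner u v := ∑' k, B.ev k ^ s * (coeff u k * coeff v k)
  conj_inner_symm u v := by
    simp only [conj_trivial]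
    exact tsum_congr fun k => by ring
  re_inner_nonneg u := by
    simp only [RCLike.re_to_real]
    exact tsum_nonneg fun k =>
      mul_nonneg (Real.rpow_nonneg (B.ev_pos k).le s) (mul_self_nonneg _)
  add_left u v w := by
    rw [← (summable_inner u w).tsum_add (summable_inner v w)]
    exact tsum_congr fun k => by rw [coeff_add]; ring
  smul_left u v c := by
    simp only [conj_trivial]
    rw [← tsum_mul_left]
    exact tsum_congr fun k => by rw [coeff_smul]; ring
  definite u hu := by
    have h0 : ∀ k, 0 ≤ B.ev k ^ s * (coeff u k * coeff u k) := fun k =>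
      mul_nonneg (Real.rpow_nonneg (B.ev_pos k).le s) (mul_self_nonneg _)
    have h1 := (hasSum_zero_iff_of_nonneg h0).mp (hu ▸ (summable_inner u u).hasSum)
    apply toL2_injective
    rw [map_zero]
    refine eq_zero_of_fourier B fun k => ?_
    have h2 : B.ev k ^ s * (coeff u k * coeff u k) = 0 := congrFun h1 k
    rcases mul_eq_zero.mp h2 with h | h
    · exact absurd h (Real.rpow_pos_of_pos (B.ev_pos k) s).ne'
    · exact mul_self_eq_zero.mp h

instance : NormedAddCommGroup (Theta B s) :=
  @InnerProductSpace.Core.toNormedAddCommGroup ℝ (Theta B s) _ _ _ (core B s)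

instance : InnerProductSpace ℝ (Theta B s) := InnerProductSpace.ofCore (core B s).toCore

theorem inner_eq (u v : Theta B s) :
    inner ℝ u v = ∑' k, B.ev k ^ s * (coeff u k * coeff v k) := rfl

/-- The eigenfunction `φ_k` as an element of `Θ^s(Ω)`. -/
def eigenfunction (B : DirichletEigenbasis Ω) (s : ℝ) (k : ℕ) : Theta B s :=
  ⟨B.φ k, summable_of_hasFiniteSupport <| (Set.finite_singleton k).subset fun j hj => by
    by_contra hne
    exact hj (by simp [fourier_φ, show ¬ j = k from hne])⟩

end Theta

/-- The Hilbert space `E^r(Ω) = Θ^r(Ω) × Θ^{2-r}(Ω)`, with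
`‖(u, v)‖² = ‖u‖²_{Θ^r} + ‖v‖²_{Θ^{2-r}}`. -/
abbrev Er (B : DirichletEigenbasis Ω) (r : ℝ) : Type :=
  WithLp 2 (Theta B r × Theta B (2 - r))

variable {B : DirichletEigenbasis Ω} {r : ℝ}

/-- First component `u` of `w = (u, v) ∈ E^r(Ω)`, as a function on `Ω`. -/
def compU (w : Er B r) : L2 Ω := Theta.toL2 w.fst

/-- Second component `v` of `w = (u, v) ∈ E^r(Ω)`, as a function on `Ω`. -/
def compV (w : Er B r) : L2 Ω := Theta.toL2 w.snd

/-- The quadratic form `½ (L w, w)_{E^r} = ∑ λ_k ξ_k η_k`, which extends `∫_Ω ∇u·∇v`; here `ξ_k`,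
`η_k` are the Fourier coefficients of the components `u`, `v` of `w`. -/
def quadForm (w : Er B r) : ℝ :=
  ∑' k, B.ev k * (Theta.coeff w.fst k * Theta.coeff w.snd k)

theorem summable_quadForm (w : Er B r) :
    Summable fun k => B.ev k * (Theta.coeff w.fst k * Theta.coeff w.snd k) := by
  have h := summable_weight (a := fun _ => 1)
    (x := fun k => B.ev k ^ (r / 2) * Theta.coeff w.fst k)
    (y := fun k => B.ev k ^ ((2 - r) / 2) * Theta.coeff w.snd k) (fun _ => zero_le_one)
    (w.fst.summable.congr fun k => by
      rw [one_mul, mul_pow, ← Real.rpow_mul_natCast (B.ev_pos k).le]; norm_num)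
    (w.snd.summable.congr fun k => by
      rw [one_mul, mul_pow, ← Real.rpow_mul_natCast (B.ev_pos k).le]; norm_num)
  refine h.congr fun k => ?_
  rw [one_mul, mul_mul_mul_comm, ← Real.rpow_add (B.ev_pos k),
    show r / 2 + (2 - r) / 2 = 1 by ring, Real.rpow_one]

/-- `1/(q+1) ∫_Ω |u|^{q+1} + 1/(p+1) ∫_Ω |v|^{p+1}`. -/
def powerTerm (p q : ℝ) (w : Er B r) : ℝ :=
  1 / (q + 1) * (∫ x in Ω, |compU w x| ^ (q + 1)) +
    1 / (p + 1) * (∫ x in Ω, |compV w x| ^ (p + 1))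

/-- The perturbation term `∫_Ω k u + ∫_Ω h v`. -/
def pertTerm (h k : L2 Ω) (w : Er B r) : ℝ :=
  (∫ x in Ω, k x * compU w x) + ∫ x in Ω, h x * compV w x

/-- The functional `I` of the perturbed system. -/
def functionalI (p q : ℝ) (h k : L2 Ω) (w : Er B r) : ℝ :=
  quadForm w - powerTerm p q w - pertTerm h k w

/-- `A` is an admissible constant for the cut-off: if `I'(w) w = 0` then
`1/(q+1) ∫ |u|^{q+1} + 1/(p+1) ∫ |v|^{p+1} ≤ A √(I(w)² + 1)`. -/
def IsCutoffConstant (B : DirichletEigenbasis Ω) (r p q : ℝ) (h k : L2 Ω) (A : ℝ) : Prop :=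
  ∀ w : Er B r, fderiv ℝ (functionalI p q h k) w w = 0 →
    powerTerm p q w ≤ A * √(functionalI p q h k w ^ 2 + 1)

/-- A smooth cut-off function `χ`. -/
structure IsCutoff (χ : ℝ → ℝ) : Prop where
  smooth : ContDiff ℝ ∞ χ
  eq_one : ∀ t, t ≤ 1 → χ t = 1
  eq_zero : ∀ t, 2 ≤ t → χ t = 0
  deriv_mem : ∀ t, 1 < t → t < 2 → -2 < deriv χ t ∧ deriv χ t < 0

/-- `Q(w) = 2 A √(I(w)² + 1)`. -/
def functionalQ (p q : ℝ) (h k : L2 Ω) (A : ℝ) (w : Er B r) : ℝ :=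
  2 * A * √(functionalI p q h k w ^ 2 + 1)

/-- The factor `ψ(w)` which cuts off the perturbation. -/
def cutoffFactor (p q : ℝ) (h k : L2 Ω) (A : ℝ) (χ : ℝ → ℝ) (w : Er B r) : ℝ :=
  χ (1 / functionalQ p q h k A w * powerTerm p q w)

/-- The modified functional `J`. -/
def functionalJ (p q : ℝ) (h k : L2 Ω) (A : ℝ) (χ : ℝ → ℝ) (w : Er B r) : ℝ :=
  quadForm w - powerTerm p q w - cutoffFactor p q h k A χ w * pertTerm h k w

/-- The eigenspace `E^+ = {(u, (-Δ)^{r-1} u) : u ∈ Θ^r(Ω)}` of `L`. -/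
def Eplus (B : DirichletEigenbasis Ω) (r : ℝ) : Submodule ℝ (Er B r) where
  carrier := {w | ∀ k, Theta.coeff w.snd k = B.ev k ^ (r - 1) * Theta.coeff w.fst k}
  zero_mem' k := by simp [Theta.coeff, fourier]
  add_mem' := by
    intro w z hw hz k
    rw [WithLp.add_fst, WithLp.add_snd, Theta.coeff_add, Theta.coeff_add, hw k, hz k]
    ring
  smul_mem' := by
    intro c w hw k
    rw [WithLp.smul_fst, WithLp.smul_snd, Theta.coeff_smul, Theta.coeff_smul, hw k]
    ring

/-- The unit vectors `e_k^- = 2^{-1/2} (λ_k^{-r/2} φ_k, -λ_k^{r/2-1} φ_k)` spanning the eigenspace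
`E^-` of `L`. -/
def eMinus (B : DirichletEigenbasis Ω) (r : ℝ) (k : ℕ) : Er B r :=
  (1 / √2) • WithLp.toLp 2
    (B.ev k ^ (-r / 2) • Theta.eigenfunction B r k,
      -(B.ev k ^ (r / 2 - 1) • Theta.eigenfunction B (2 - r) k))

/-- The Galerkin space `X_n = ⟨e_1^-, …, e_n^-⟩ ⊕ E^+` (the numbering of the `e_k^-` here starts
with `0`). -/
def galerkinSpace (B : DirichletEigenbasis Ω) (r : ℝ) (n : ℕ) : Submodule ℝ (Er B r) :=
  Submodule.span ℝ (eMinus B r '' {j | j < n}) ⊔ Eplus B r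

/-- `(PS)_c`: every sequence with `F(w_n) → c` and `F'(w_n) → 0` has a convergent subsequence. -/
def PalaisSmale {E : Type*} [NormedAddCommGroup E] [NormedSpace ℝ E] (F : E → ℝ) (c : ℝ) : Prop :=
  ∀ w : ℕ → E, Tendsto (fun n => F (w n)) atTop (𝓝 c) →
    Tendsto (fun n => ‖fderiv ℝ F (w n)‖) atTop (𝓝 0) →
    ∃ (w₀ : E) (σ : ℕ → ℕ), StrictMono σ ∧ Tendsto (fun n => w (σ n)) atTop (𝓝 w₀)

/-- `(PS)_c^*` with respect to subspaces `X_n`: every sequence with `w_n ∈ X_n`, `F(w_n) → c` and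
`(F|X_n)'(w_n) → 0` has a subsequence which converges in the whole space. -/
def GalerkinPalaisSmale {E : Type*} [NormedAddCommGroup E] [NormedSpace ℝ E]
    (X : ℕ → Submodule ℝ E) (F : E → ℝ) (c : ℝ) : Prop :=
  ∀ w : ∀ n, X n, Tendsto (fun n => F (w n)) atTop (𝓝 c) →
    Tendsto (fun n => ‖fderiv ℝ (fun z : X n => F z) (w n)‖) atTop (𝓝 0) →
    ∃ (w₀ : E) (σ : ℕ → ℕ), StrictMono σ ∧ Tendsto (fun n => (w (σ n) : E)) atTop (𝓝 w₀)

end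

end HamiltonianSystem

open HamiltonianSystem

/-! Write λ_k for the eigenvalues. Both factors of E^r are isometric to ℓ² by weighting the Fourier
coefficients, and in these coordinates the quadratic form is ½(Sw, w), where S exchanges the two
components (`quadForm_eq_inner_reflection`). S is a symmetric involution, hence an isometry; E^+ is
its fixed space and the e_k^- are eigenvectors for -1. The proposition is therefore a statement
about ½(Sw, w) - P - χ(P/Q)ℓ on a Hilbert space, with Q = 2A√(I² + 1). Only a few facts about P and
ℓ are used: P is C¹ and even, a sum of two superquadratic powers on every ray, P' grows sublinearly
in P and is compact (`IsPowerPotential`), and |ℓ| ≤ K(P^{1/(q+1)} + P^{1/(p+1)}) with K depending on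
h, k only through their norms (`IsLowerOrder`).

These facts rest on the compact embeddings Θ^r ⊂ L^{q+1} and Θ^{2-r} ⊂ L^{p+1}. For an L²-normalised
combination of eigenfunctions with eigenvalues at most Λ, Moser iteration gives ‖u‖_t ≤
CΛ^{(N/2)(1/2 - 1/t)} (`spectralBound`). Splitting the spectrum dyadically and summing yields Θ^s ⊂
L^t for s > N(1/2 - 1/t). The room left by the strict inequality, together with λ_k → ∞, makes the
embedding a norm limit of finite rank operators (`exists_compact_embedding`).

The derivative of J is (1 + T₁)Sw - (1 + T₂)P' - (χ + T₁)ℓ, with corrections T₁, T₂ that are small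
where J is large (`exists_corr_le`). This gives the three claims. Almost evenness: only χℓ is not
even, and where χ ≠ 0 the potential P is at most C(|J| + 1), so |ℓ| is of the order of the
right-hand side (`exists_almost_even`). Critical points: if J'(w) = 0 at a high level, then I'(w)w
is small relative to P'(w)w, and superquadraticity gives τ near 1 with I'(τw)τw = 0 exactly.
Admissibility at τw passes to w with 2A in place of A, that is P(w) ≤ Q(w), where χ = 1 and χ' = 0
(`exists_ray_bound`, `exists_critical_level`). Palais-Smale: J - ½J'(w)w, suitably weighted, bounds
P by a multiple of 1 + ‖w‖; testing with Sw then bounds ‖w‖, and compactness of P' with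
invertibility of S gives convergence (`exists_palaisSmale_level`). -/

namespace HamiltonianSystem

/-! ### Weak solutions of the Dirichlet problem and the Sobolev inequality -/

section WeakSolutions

variable {N : ℕ} {Ω : Set (Eucl N)}

theorem norm_gradient_eq (ψ : Eucl N → ℝ) (x : Eucl N) : ‖gradient ψ x‖ = ‖fderiv ℝ ψ x‖ :=
  LinearIsometryEquiv.norm_map _ _

theorem gradient_comp {F : ℝ → ℝ} {ψ : Eucl N → ℝ} (hF : Differentiable ℝ F)
    (hψ : Differentiable ℝ ψ) (x : Eucl N) :
    gradient (F ∘ ψ) x = deriv F (ψ x) • gradient ψ x := by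
  have h := ((hF (ψ x)).hasDerivAt.comp_hasFDerivAt x (hψ x).hasFDerivAt).fderiv
  simp only [gradient, h, map_smul]

theorem IsTest.comp {F : ℝ → ℝ} {ψ : Eucl N → ℝ} (hψ : IsTest Ω ψ) (hF : ContDiff ℝ ∞ F)
    (hF0 : F 0 = 0) : IsTest Ω (F ∘ ψ) where
  smooth := hF.comp hψ.smooth
  compact := hψ.compact.comp_left hF0
  support := (tsupport_comp_subset hF0 ψ).trans hψ.support

theorem IsTest.memLp {ψ : Eucl N → ℝ} (hψ : IsTest Ω ψ) (t : ENNReal) : MemLp ψ t (vol Ω) :=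
  (hψ.smooth.continuous.memLp_of_hasCompactSupport hψ.compact).restrict _

theorem IsTest.differentiable {ψ : Eucl N → ℝ} (hψ : IsTest Ω ψ) : Differentiable ℝ ψ :=
  hψ.smooth.differentiable (by simp)

theorem IsTest.continuous_gradient {ψ : Eucl N → ℝ} (hψ : IsTest Ω ψ) :
    Continuous (gradient ψ) :=
  (LinearIsometryEquiv.continuous _).comp (hψ.smooth.continuous_fderiv (by simp))

theorem IsTest.memLp_gradient {ψ : Eucl N → ℝ} (hψ : IsTest Ω ψ) (t : ENNReal) :
    MemLp (gradient ψ) t (vol Ω) := by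
  refine (hψ.continuous_gradient.memLp_of_hasCompactSupport ?_).restrict _
  exact (hψ.compact.fderiv ℝ).comp_left (map_zero _)

/-- `u ∈ H_0^1(Ω)` and `-Δ u = f` weakly in `Ω`, with `f ∈ L²(Ω)`. -/
def IsWeakSolution (Ω : Set (Eucl N)) (u f : Eucl N → ℝ) : Prop :=
  MemLp f 2 (vol Ω) ∧ ∃ G : Eucl N → Eucl N, HasH10Gradient Ω u G ∧
    ∀ ψ : Eucl N → ℝ, IsTest Ω ψ →
      ∫ x in Ω, inner ℝ (G x) (gradient ψ x) = ∫ x in Ω, f x * ψ x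

theorem IsWeakSolution.congr {u f u' f' : Eucl N → ℝ} (h : IsWeakSolution Ω u f)
    (hu : u =ᵐ[vol Ω] u') (hf : f =ᵐ[vol Ω] f') : IsWeakSolution Ω u' f' := by
  obtain ⟨hfm, G, ⟨hu2, hG2, ψ, hψ, h1, h2⟩, hw⟩ := h
  refine ⟨hfm.ae_eq hf, G, ⟨hu2.ae_eq hu, hG2, ψ, hψ, h1.congr fun n => ?_, h2⟩, fun η hη => ?_⟩
  · refine eLpNorm_congr_ae ?_
    filter_upwards [hu] with x hx
    rw [hx]
  · rw [hw η hη]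
    refine integral_congr_ae ?_
    filter_upwards [hf] with x hx
    rw [hx]

theorem IsDirichletEigenfunction.isWeakSolution {u : Eucl N → ℝ} {lam : ℝ}
    (h : IsDirichletEigenfunction Ω lam u) : IsWeakSolution Ω u (fun x => lam * u x) := by
  obtain ⟨G, hG, hw⟩ := h
  refine ⟨hG.1.const_mul lam, G, hG, fun ψ hψ => ?_⟩
  rw [hw ψ hψ, ← integral_const_mul]
  simp only [mul_assoc]

theorem integrable_inner_of_memLp_two {X : Type*} [MeasurableSpace X] {μ : Measure X} {V : Type*}
    [NormedAddCommGroup V] [InnerProductSpace ℝ V] {f g : X → V} (hf : MemLp f 2 μ)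
    (hg : MemLp g 2 μ) : Integrable (fun x => inner ℝ (f x) (g x)) μ := by
  refine ((hf.norm.integrable_mul hg.norm)).mono' (hf.1.inner hg.1) ?_
  filter_upwards with x
  exact norm_inner_le_norm _ _

theorem abs_integral_inner_le {X : Type*} [MeasurableSpace X] {μ : Measure X} {V : Type*}
    [NormedAddCommGroup V] [InnerProductSpace ℝ V] {f g : X → V} (hf : MemLp f 2 μ)
    (hg : MemLp g 2 μ) :
    |∫ x, inner ℝ (f x) (g x) ∂μ| ≤ (eLpNorm f 2 μ).toReal * (eLpNorm g 2 μ).toReal := by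
  have h := abs_real_inner_le_norm (hf.toLp f) (hg.toLp g)
  rw [L2.inner_def, Lp.norm_toLp, Lp.norm_toLp] at h
  convert h using 2
  refine integral_congr_ae ?_
  filter_upwards [hf.coeFn_toLp, hg.coeFn_toLp] with x hx hy
  rw [hx, hy]

theorem isWeakSolution_zero : IsWeakSolution Ω (fun _ => 0) (fun _ => 0) := by
  refine ⟨MemLp.zero', fun _ => 0, ⟨MemLp.zero', MemLp.zero', fun _ _ => 0, fun n => ?_, ?_, ?_⟩,
    fun ψ _ => by simp⟩
  · exact ⟨contDiff_const, HasCompactSupport.zero, by simp [tsupport]⟩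
  · simp
  · have h : ∀ x : Eucl N, gradient (fun _ : Eucl N => (0 : ℝ)) x = 0 := fun x => by
      simp [gradient]
    simp [h]

theorem IsWeakSolution.add {u f u' f' : Eucl N → ℝ} (h : IsWeakSolution Ω u f)
    (h' : IsWeakSolution Ω u' f') :
    IsWeakSolution Ω (fun x => u x + u' x) (fun x => f x + f' x) := by
  obtain ⟨hf, G, ⟨hu2, hG2, ψ, hψ, h1, h2⟩, hw⟩ := h
  obtain ⟨hf', G', ⟨hu2', hG2', ψ', hψ', h1', h2'⟩, hw'⟩ := h'
  refine ⟨hf.add hf', fun x => G x + G' x, ⟨hu2.add hu2', hG2.add hG2', fun n x => ψ n x + ψ' n x,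
    fun n => ⟨(hψ n).smooth.add (hψ' n).smooth, (hψ n).compact.add (hψ' n).compact, ?_⟩, ?_, ?_⟩,
    fun η hη => ?_⟩
  · exact (tsupport_add (ψ n) (ψ' n)).trans (union_subset (hψ n).support (hψ' n).support)
  · have h0 := h1.add h1'
    rw [add_zero] at h0
    refine tendsto_of_tendsto_of_tendsto_of_le_of_le tendsto_const_nhds h0 (fun _ => zero_le)
      fun n => ?_
    refine le_trans (le_of_eq ?_) (eLpNorm_add_le ((hψ n).memLp 2 |>.sub hu2).1
      ((hψ' n).memLp 2 |>.sub hu2').1 (by norm_num))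
    congr 1
    ext x
    simp only [Pi.add_apply]
    ring
  · have h0 := h2.add h2'
    rw [add_zero] at h0
    refine tendsto_of_tendsto_of_tendsto_of_le_of_le tendsto_const_nhds h0 (fun _ => zero_le)
      fun n => ?_
    refine le_trans (le_of_eq ?_) (eLpNorm_add_le ((hψ n).memLp_gradient 2 |>.sub hG2).1
      ((hψ' n).memLp_gradient 2 |>.sub hG2').1 (by norm_num))
    congr 1
    ext1 x
    have : gradient (fun x => ψ n x + ψ' n x) x = gradient (ψ n) x + gradient (ψ' n) x := by
      simp only [gradient]
      rw [fderiv_fun_add ((hψ n).differentiable x) ((hψ' n).differentiable x), map_add]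
    simp only [Pi.add_apply, this]
    abel
  · simp only [inner_add_left, add_mul]
    rw [integral_add (integrable_inner_of_memLp_two hG2 (hη.memLp_gradient 2))
      (integrable_inner_of_memLp_two hG2' (hη.memLp_gradient 2)), hw η hη, hw' η hη, integral_add]
    · exact hf.integrable_mul (hη.memLp 2)
    · exact hf'.integrable_mul (hη.memLp 2)

theorem IsWeakSolution.const_mul {u f : Eucl N → ℝ} (h : IsWeakSolution Ω u f) (c : ℝ) :
    IsWeakSolution Ω (fun x => c * u x) (fun x => c * f x) := by
  obtain ⟨hf, G, ⟨hu2, hG2, ψ, hψ, h1, h2⟩, hw⟩ := h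
  have hgr : ∀ n x, gradient (fun y => c * ψ n y) x = c • gradient (ψ n) x := fun n x => by
    simp only [gradient]
    rw [fderiv_const_mul ((hψ n).differentiable x), map_smul]
  have key : ∀ {a : ℕ → ENNReal}, Tendsto a atTop (𝓝 0) →
      Tendsto (fun n => ‖c‖ₑ * a n) atTop (𝓝 0) := fun ha => by
    have := ENNReal.Tendsto.const_mul (a := ‖c‖ₑ) ha (Or.inr enorm_ne_top)
    rwa [mul_zero] at this
  refine ⟨hf.const_mul c, fun x => c • G x, ⟨hu2.const_mul c, hG2.const_smul c,
    fun n x => c * ψ n x, fun n => ⟨contDiff_const.mul (hψ n).smooth, (hψ n).compact.mul_left, ?_⟩,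
    (key h1).congr fun n => ?_, (key h2).congr fun n => ?_⟩, fun η hη => ?_⟩
  · exact (tsupport_mul_subset_right (f := fun _ => c)).trans (hψ n).support
  · rw [← eLpNorm_const_smul]
    congr 1
    ext x
    simp [mul_sub]
  · rw [← eLpNorm_const_smul]
    congr 1
    ext1 x
    simp only [hgr, Pi.smul_apply, smul_sub]
  · simp only [real_inner_smul_left, mul_assoc]
    rw [integral_const_mul, integral_const_mul, hw η hη]

/-- The Sobolev exponent `2N/(N-2)`. -/
noncomputable def sobExp (N : ℕ) : ℝ := 2 * N / (N - 2)

/-- This is the Gagliardo-Nirenberg-Sobolev inequality on the whole space: a test function and its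
gradient vanish outside Ω, so restricting the measure changes neither norm. -/
theorem exists_sobolev_const (hN : 3 ≤ N) (Ω : Set (Eucl N)) :
    ∃ C : ℝ, 0 ≤ C ∧ ∀ ψ : Eucl N → ℝ, IsTest Ω ψ →
      eLpNorm ψ (ENNReal.ofReal (sobExp N)) (vol Ω) ≤
        ENNReal.ofReal C * eLpNorm (gradient ψ) 2 (vol Ω) := by
  have hN' : (3 : ℝ) ≤ N := by exact_mod_cast hN
  have hs : 0 ≤ sobExp N := div_nonneg (by positivity) (by linarith)
  refine ⟨SNormLESNormFDerivOfEqConst ℝ (volume : Measure (Eucl N)) ((2 : NNReal) : ℝ), by positivity,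
    fun ψ hψ => ?_⟩
  have h := eLpNorm_le_eLpNorm_fderiv_of_eq (volume : Measure (Eucl N)) (u := ψ)
    (hψ.smooth.of_le (by simp)) hψ.compact (p := 2) (p' := (sobExp N).toNNReal) (by norm_num)
    (by simp; omega) (by
      rw [Real.coe_toNNReal _ hs, finrank_euclideanSpace_fin, sobExp]
      have : (N : ℝ) - 2 ≠ 0 := by linarith
      have : (N : ℝ) ≠ 0 := by linarith
      push_cast
      field_simp)
  rw [ENNReal.ofReal_coe_nnreal]
  have e1 : eLpNorm ψ (ENNReal.ofReal (sobExp N)) (vol Ω) =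
      eLpNorm ψ (ENNReal.ofReal (sobExp N)) volume :=
    eLpNorm_restrict_eq_of_support_subset ((subset_tsupport _).trans hψ.support)
  have e2 : eLpNorm (gradient ψ) 2 (vol Ω) = eLpNorm (fderiv ℝ ψ) 2 volume := by
    rw [eLpNorm_restrict_eq_of_support_subset]
    · exact eLpNorm_congr_norm_ae (Eventually.of_forall fun x => norm_gradient_eq ψ x)
    · intro x hx
      refine hψ.support (support_fderiv_subset ℝ (f := ψ) fun h0 => hx ?_)
      simp only [gradient, h0, map_zero]
  rw [e1, e2]
  exact h

end WeakSolutions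

end HamiltonianSystem

namespace HamiltonianSystem

/-! ### Energy estimates from nonlinear test functions -/

section Energy

variable {N : ℕ} {Ω : Set (Eucl N)}

theorem eLpNorm_two_sq {X : Type*} [MeasurableSpace X] {μ : Measure X} {V : Type*}
    [NormedAddCommGroup V] [InnerProductSpace ℝ V] {g : X → V} (hg : MemLp g 2 μ) :
    eLpNorm g 2 μ ^ 2 = ENNReal.ofReal (∫ x, inner ℝ (g x) (g x) ∂μ) := by
  have h : ‖hg.toLp g‖ ^ 2 = ∫ x, inner ℝ (g x) (g x) ∂μ := by
    rw [← real_inner_self_eq_norm_sq, L2.inner_def]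
    refine integral_congr_ae ?_
    filter_upwards [hg.coeFn_toLp] with x hx
    rw [hx]
  rw [← h, Lp.norm_toLp, ENNReal.ofReal_pow ENNReal.toReal_nonneg, ENNReal.ofReal_toReal hg.2.ne]

theorem exists_subseq_ae_tendsto {X : Type*} [MeasurableSpace X] {μ : Measure X}
    {ψ : ℕ → X → ℝ} {u : X → ℝ} {t : ENNReal} (ht : t ≠ 0) (hψ : ∀ n, AEStronglyMeasurable (ψ n) μ)
    (hu : AEStronglyMeasurable u μ)
    (h : Tendsto (fun n => eLpNorm (fun x => ψ n x - u x) t μ) atTop (𝓝 0)) :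
    ∃ ns : ℕ → ℕ, StrictMono ns ∧ ∀ᵐ x ∂μ, Tendsto (fun n => ψ (ns n) x) atTop (𝓝 (u x)) :=
  (tendstoInMeasure_of_tendsto_eLpNorm ht hψ hu h).exists_seq_tendsto_ae

/-- Testing `-Δ u = f` with `F(u)`: a Sobolev bound for `H(u)` if `(H')² ≤ κ F'`. -/
theorem IsWeakSolution.energy {C : ℝ} (hC : ∀ ψ : Eucl N → ℝ, IsTest Ω ψ →
      eLpNorm ψ (ENNReal.ofReal (sobExp N)) (vol Ω) ≤
        ENNReal.ofReal C * eLpNorm (gradient ψ) 2 (vol Ω)) (hC0 : 0 ≤ C)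
    {u f : Eucl N → ℝ} (h : IsWeakSolution Ω u f)
    {F H : ℝ → ℝ} (hF : ContDiff ℝ ∞ F) (hH : ContDiff ℝ ∞ H) (hF0 : F 0 = 0) (hH0 : H 0 = 0)
    {κ K : ℝ} (hκ : 0 ≤ κ) (hK : ∀ s, |deriv F s| ≤ K)
    (hFH : ∀ s, deriv H s ^ 2 ≤ κ * deriv F s) :
    eLpNorm (fun x => H (u x)) (ENNReal.ofReal (sobExp N)) (vol Ω) ^ 2 ≤
      ENNReal.ofReal (C ^ 2 * κ * ∫ x in Ω, f x * F (u x)) := by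
  obtain ⟨hf, G, ⟨hu2, hG2, ψ, hψ, h1, h2⟩, hw⟩ := h
  have hFd : Differentiable ℝ F := hF.differentiable (by simp)
  have hHd : Differentiable ℝ H := hH.differentiable (by simp)
  have hK0 : 0 ≤ K := (abs_nonneg _).trans (hK 0)
  have hFlip : ∀ s t, |F s - F t| ≤ K * |s - t| := fun s t => by
    have := convex_univ.norm_image_sub_le_of_norm_deriv_le (f := F) (C := K) (x := t) (y := s)
      (fun x _ => hFd x) (fun x _ => hK x) (mem_univ _) (mem_univ _)
    simpa [Real.norm_eq_abs] using this
  have hFu : MemLp (fun x => F (u x)) 2 (vol Ω) := by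
    refine (hu2.norm.const_mul K).mono' (hF.continuous.comp_aestronglyMeasurable hu2.1) ?_
    filter_upwards with x
    simpa [hF0] using hFlip (u x) 0
  set d : ℕ → ℝ := fun n => (eLpNorm (fun x => ψ n x - u x) 2 (vol Ω)).toReal with hd
  set e : ℕ → ℝ := fun n => (eLpNorm (fun x => gradient (ψ n) x - G x) 2 (vol Ω)).toReal with he
  have hd0 : Tendsto d atTop (𝓝 0) := by
    have h0 := (ENNReal.tendsto_toReal ENNReal.zero_ne_top).comp h1
    rw [ENNReal.toReal_zero] at h0
    exact h0
  have he0 : Tendsto e atTop (𝓝 0) := by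
    have h0 := (ENNReal.tendsto_toReal ENNReal.zero_ne_top).comp h2
    rw [ENNReal.toReal_zero] at h0
    exact h0
  set g : ℝ := (eLpNorm G 2 (vol Ω)).toReal with hg
  set f0 : ℝ := (eLpNorm f 2 (vol Ω)).toReal with hf0
  -- the error of the approximation tends to zero
  have hgrad : ∀ n, (eLpNorm (gradient (ψ n)) 2 (vol Ω)).toReal ≤ e n + g := fun n => by
    have hm := ((hψ n).memLp_gradient 2).sub hG2
    have h3 : eLpNorm (gradient (ψ n)) 2 (vol Ω) ≤
        eLpNorm (fun x => gradient (ψ n) x - G x) 2 (vol Ω) + eLpNorm G 2 (vol Ω) := by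
      refine le_trans (le_of_eq ?_) (eLpNorm_add_le hm.1 hG2.1 (by norm_num))
      congr 1
      ext1 x
      simp
    have h4 := ENNReal.toReal_mono (ENNReal.add_ne_top.2 ⟨hm.2.ne, hG2.2.ne⟩) h3
    rwa [ENNReal.toReal_add hm.2.ne hG2.2.ne] at h4
  have hint : ∀ n, |(∫ x in Ω, f x * F (ψ n x)) - ∫ x in Ω, f x * F (u x)| ≤ f0 * (K * d n) :=
    fun n => by
    have hm : MemLp (fun x => F (ψ n x)) 2 (vol Ω) := ((hψ n).comp hF hF0).memLp 2
    rw [← integral_sub (show Integrable (fun x => f x * F (ψ n x)) (vol Ω) from hf.integrable_mul hm)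
      (show Integrable (fun x => f x * F (u x)) (vol Ω) from hf.integrable_mul hFu)]
    have h3 := abs_integral_inner_le hf (hm.sub hFu)
    have h4 : (eLpNorm ((fun x => F (ψ n x)) - fun x => F (u x)) 2 (vol Ω)).toReal ≤ K * d n := by
      have hs := ((hψ n).memLp 2).sub hu2
      have : eLpNorm ((fun x => F (ψ n x)) - fun x => F (u x)) 2 (vol Ω) ≤
          ENNReal.ofReal K * eLpNorm (fun x => ψ n x - u x) 2 (vol Ω) :=
        eLpNorm_le_mul_eLpNorm_of_ae_le_mul (Eventually.of_forall fun x => hFlip _ _) 2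
      have := ENNReal.toReal_mono (ENNReal.mul_ne_top ENNReal.ofReal_ne_top hs.2.ne) this
      rwa [ENNReal.toReal_mul, ENNReal.toReal_ofReal hK0] at this
    refine le_trans (le_of_eq ?_) (h3.trans (mul_le_mul_of_nonneg_left h4 ENNReal.toReal_nonneg))
    congr 1
    refine integral_congr_ae (Eventually.of_forall fun x => ?_)
    simp only [Pi.sub_apply, RCLike.inner_apply, conj_trivial]
    ring
  -- The Lipschitz bound `K` of F multiplies only the approximation error `e n`, so it drops out in
  -- the limit. Truncations with very large `K` are therefore free.
  set y : ℕ → ℝ := fun n => C ^ 2 * (κ * ((∫ x in Ω, f x * F (ψ n x)) + e n * (K * (e n + g))))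
    with hy
  have hylim : Tendsto y atTop (𝓝 (C ^ 2 * κ * ∫ x in Ω, f x * F (u x))) := by
    have h3 : Tendsto (fun n => ∫ x in Ω, f x * F (ψ n x)) atTop (𝓝 (∫ x in Ω, f x * F (u x))) := by
      rw [tendsto_iff_norm_sub_tendsto_zero]
      refine squeeze_zero (fun _ => norm_nonneg _) hint ?_
      simpa using (hd0.const_mul K).const_mul f0
    have h4 := ((h3.add (he0.mul ((he0.add_const g).const_mul K))).const_mul κ).const_mul (C ^ 2)
    simpa [mul_assoc] using h4
  have hstep : ∀ n, eLpNorm (fun x => H (ψ n x)) (ENNReal.ofReal (sobExp N)) (vol Ω) ≤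
      ENNReal.ofReal (y n) ^ (1 / 2 : ℝ) := fun n => by
    have hHt : IsTest Ω (H ∘ ψ n) := (hψ n).comp hH hH0
    have hFt : IsTest Ω (F ∘ ψ n) := (hψ n).comp hF hF0
    have hGm := (hψ n).memLp_gradient 2
    have hFm := hFt.memLp_gradient 2
    have hsq : eLpNorm (gradient (H ∘ ψ n)) 2 (vol Ω) ^ 2 ≤
        ENNReal.ofReal (κ * ((∫ x in Ω, f x * F (ψ n x)) + e n * (K * (e n + g)))) := by
      rw [eLpNorm_two_sq (hHt.memLp_gradient 2)]
      refine ENNReal.ofReal_le_ofReal ?_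
      -- By the chain rule |∇H(ψ)|² = H'(ψ)²|∇ψ|² ≤ κF'(ψ)|∇ψ|² = κ∇ψ·∇F(ψ), and the last expression
      -- is what the weak equation controls.
      have i1 : ∫ x in Ω, inner ℝ (gradient (H ∘ ψ n) x) (gradient (H ∘ ψ n) x) ≤
          ∫ x in Ω, κ * inner ℝ (gradient (ψ n) x) (gradient (F ∘ ψ n) x) := by
        refine integral_mono (integrable_inner_of_memLp_two (hHt.memLp_gradient 2)
          (hHt.memLp_gradient 2)) ((integrable_inner_of_memLp_two hGm hFm).const_mul κ) fun x => ?_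
        simp only [gradient_comp hHd (hψ n).differentiable, gradient_comp hFd (hψ n).differentiable,
          real_inner_smul_left, real_inner_smul_right]
        rw [← mul_assoc, ← mul_assoc, ← sq]
        exact mul_le_mul_of_nonneg_right (hFH _) real_inner_self_nonneg
      rw [integral_const_mul] at i1
      refine i1.trans (mul_le_mul_of_nonneg_left ?_ hκ)
      have i2 : ∫ x in Ω, inner ℝ (gradient (ψ n) x) (gradient (F ∘ ψ n) x) =
          (∫ x in Ω, f x * F (ψ n x)) +
          ∫ x in Ω, inner ℝ ((gradient (ψ n) - G) x) (gradient (F ∘ ψ n) x) := by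
        have := hw _ hFt
        simp only [Function.comp_apply] at this
        rw [← this, ← integral_add (integrable_inner_of_memLp_two hG2 hFm)
          (integrable_inner_of_memLp_two (hGm.sub hG2) hFm)]
        refine integral_congr_ae (Eventually.of_forall fun x => ?_)
        simp only [Pi.sub_apply]
        rw [← inner_add_left, add_sub_cancel]
      rw [i2]
      gcongr
      refine (le_abs_self _).trans ((abs_integral_inner_le (hGm.sub hG2) hFm).trans ?_)
      refine mul_le_mul_of_nonneg_left ?_ ENNReal.toReal_nonneg
      have i3 : eLpNorm (gradient (F ∘ ψ n)) 2 (vol Ω) ≤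
          ENNReal.ofReal K * eLpNorm (gradient (ψ n)) 2 (vol Ω) := by
        refine eLpNorm_le_mul_eLpNorm_of_ae_le_mul (Eventually.of_forall fun x => ?_) 2
        rw [gradient_comp hFd (hψ n).differentiable, norm_smul]
        exact mul_le_mul_of_nonneg_right (hK _) (norm_nonneg _)
      have i4 := ENNReal.toReal_mono (ENNReal.mul_ne_top ENNReal.ofReal_ne_top hGm.2.ne) i3
      rw [ENNReal.toReal_mul, ENNReal.toReal_ofReal hK0] at i4
      exact i4.trans (mul_le_mul_of_nonneg_left (hgrad n) hK0)
    have h5 := hC _ hHt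
    have h6 : eLpNorm (fun x => H (ψ n x)) (ENNReal.ofReal (sobExp N)) (vol Ω) ^ 2 ≤
        ENNReal.ofReal (y n) := by
      refine (pow_le_pow_left₀ zero_le h5 2).trans ?_
      rw [mul_pow, hy, ENNReal.ofReal_mul (by positivity), ENNReal.ofReal_pow hC0]
      gcongr
    rw [← ENNReal.rpow_le_rpow_iff (z := 2) (by norm_num), ← ENNReal.rpow_mul]
    simpa using h6
  obtain ⟨ns, hns, hae⟩ := exists_subseq_ae_tendsto (by norm_num) (fun n => ((hψ n).memLp 2).1)
    hu2.1 h1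
  have hfat : eLpNorm (fun x => H (u x)) (ENNReal.ofReal (sobExp N)) (vol Ω) ≤
      ENNReal.ofReal (C ^ 2 * κ * ∫ x in Ω, f x * F (u x)) ^ (1 / 2 : ℝ) := by
    refine (Lp.eLpNorm_lim_le_liminf_eLpNorm (f := fun n x => H (ψ (ns n) x))
      (fun n => ((hψ (ns n)).comp hH hH0 |>.memLp 2).1) _ ?_).trans ?_
    · filter_upwards [hae] with x hx
      exact (hH.continuous.tendsto _).comp hx
    · have h7 : Tendsto (fun n => ENNReal.ofReal (y (ns n)) ^ (1 / 2 : ℝ)) atTop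
          (𝓝 (ENNReal.ofReal (C ^ 2 * κ * ∫ x in Ω, f x * F (u x)) ^ (1 / 2 : ℝ))) :=
        ((ENNReal.continuous_rpow_const.comp ENNReal.continuous_ofReal).tendsto _).comp
          (hylim.comp hns.tendsto_atTop)
      rw [← h7.liminf_eq]
      exact liminf_le_liminf (Eventually.of_forall fun n => hstep (ns n))
  rw [← ENNReal.rpow_le_rpow_iff (z := 2) (by norm_num), ← ENNReal.rpow_mul] at hfat
  simpa using hfat

end Energy

end HamiltonianSystem

namespace HamiltonianSystem

/-! ### One step of the Moser iteration -/

section Moser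

variable {N : ℕ} {Ω : Set (Eucl N)}

/-- A smooth truncation of `s (1 + s²)^k`. -/
noncomputable def truncPow (ε k s : ℝ) : ℝ := s * ((1 + s ^ 2) / (1 + ε * s ^ 2)) ^ k

theorem truncPow_base_pos {ε : ℝ} (hε : 0 ≤ ε) (s : ℝ) : 0 < (1 + s ^ 2) / (1 + ε * s ^ 2) := by
  positivity

theorem contDiff_truncPow {ε : ℝ} (hε : 0 ≤ ε) (k : ℝ) : ContDiff ℝ ∞ (truncPow ε k) := by
  refine contDiff_id.mul (ContDiff.rpow_const_of_ne ?_ fun s => (truncPow_base_pos hε s).ne')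
  refine ContDiff.div (by fun_prop) (by fun_prop) fun s => ?_
  have : 0 ≤ ε * s ^ 2 := by positivity
  linarith

theorem truncPow_zero (ε k : ℝ) : truncPow ε k 0 = 0 := by simp [truncPow]

/-- The logarithmic derivative factor of `truncPow`. -/
theorem deriv_truncPow {ε : ℝ} (hε : 0 ≤ ε) (hε1 : ε ≤ 1) (s : ℝ) : ∃ θ : ℝ, 0 ≤ θ ∧ θ ≤ 2 ∧
    ∀ k : ℝ, deriv (truncPow ε k) s = ((1 + s ^ 2) / (1 + ε * s ^ 2)) ^ k * (1 + k * θ) := by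
  have hp : 0 < 1 + ε * s ^ 2 := by positivity
  have hq : 0 < 1 + s ^ 2 := by positivity
  have hg := truncPow_base_pos hε s
  refine ⟨2 * s ^ 2 * (1 - ε) / ((1 + ε * s ^ 2) * (1 + s ^ 2)), ?_, ?_, fun k => ?_⟩
  · exact div_nonneg (mul_nonneg (by positivity) (by linarith)) (by positivity)
  · rw [div_le_iff₀ (by positivity)]
    nlinarith [sq_nonneg s, mul_nonneg hε (sq_nonneg s),
      mul_nonneg (mul_nonneg hε (sq_nonneg s)) (sq_nonneg s)]
  · have h1 : HasDerivAt (fun s : ℝ => (1 + s ^ 2) / (1 + ε * s ^ 2))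
        ((2 * s * (1 + ε * s ^ 2) - (1 + s ^ 2) * (ε * (2 * s))) / (1 + ε * s ^ 2) ^ 2) s := by
      have a1 : HasDerivAt (fun s : ℝ => 1 + s ^ 2) (2 * s) s := by
        simpa using (hasDerivAt_pow 2 s).const_add 1
      have a2 : HasDerivAt (fun s : ℝ => 1 + ε * s ^ 2) (ε * (2 * s)) s := by
        simpa using ((hasDerivAt_pow 2 s).const_mul ε).const_add 1
      exact a1.div a2 hp.ne'
    have h2 := (hasDerivAt_id s).mul (h1.rpow_const (p := k) (Or.inl hg.ne'))
    have h3 : deriv (truncPow ε k) s = _ := h2.deriv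
    rw [h3, Real.rpow_sub_one hg.ne']
    simp only [id]
    field_simp
    ring

theorem deriv_truncPow_nonneg {ε k : ℝ} (hε : 0 ≤ ε) (hε1 : ε ≤ 1) (hk : 0 ≤ k) (s : ℝ) :
    0 ≤ deriv (truncPow ε k) s := by
  obtain ⟨θ, h0, -, h⟩ := deriv_truncPow hε hε1 s
  rw [h k]
  have := truncPow_base_pos hε s
  positivity

/-- The bound blows up as ε → 0. This is harmless, since `IsWeakSolution.energy` needs some finite
bound and its conclusion does not contain it. -/
theorem abs_deriv_truncPow_le {ε k : ℝ} (hε : 0 < ε) (hε1 : ε ≤ 1) (hk : 0 ≤ k) (s : ℝ) :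
    |deriv (truncPow ε k) s| ≤ (1 / ε) ^ k * (1 + k * 2) := by
  rw [abs_of_nonneg (deriv_truncPow_nonneg hε.le hε1 hk s)]
  obtain ⟨θ, h0, h2, h⟩ := deriv_truncPow hε.le hε1 s
  rw [h k]
  have hg := truncPow_base_pos hε.le s
  have : (1 + s ^ 2) / (1 + ε * s ^ 2) ≤ 1 / ε := by
    rw [div_le_div_iff₀ (by positivity) hε]
    nlinarith
  gcongr

/-- The hypothesis (H')² ≤ κF' of the energy estimate, with κ = 1 + k independent of ε. With θ from
`deriv_truncPow` it amounts to (1 + kθ/2)² ≤ (1 + k)(1 + kθ), true because 0 ≤ θ ≤ 2. -/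
theorem deriv_truncPow_half_sq_le {ε k : ℝ} (hε : 0 ≤ ε) (hε1 : ε ≤ 1) (hk : 0 ≤ k) (s : ℝ) :
    deriv (truncPow ε (k / 2)) s ^ 2 ≤ (1 + k) * deriv (truncPow ε k) s := by
  obtain ⟨θ, h0, h2, h⟩ := deriv_truncPow hε hε1 s
  have hg := truncPow_base_pos hε s
  have h3 : (((1 + s ^ 2) / (1 + ε * s ^ 2)) ^ (k / 2)) ^ 2 =
      ((1 + s ^ 2) / (1 + ε * s ^ 2)) ^ k := by
    rw [← Real.rpow_mul_natCast hg.le]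
    norm_num
  rw [h, h, mul_pow, h3, mul_left_comm]
  refine mul_le_mul_of_nonneg_left ?_ (Real.rpow_nonneg hg.le _)
  nlinarith [mul_nonneg hk h0, mul_nonneg (mul_nonneg hk hk) (mul_nonneg h0 (sub_nonneg.2 h2)),
    mul_nonneg (mul_nonneg hk hk) h0]

theorem abs_truncPow_le {ε k : ℝ} (hε : 0 ≤ ε) (hk : 0 ≤ k) (s : ℝ) :
    |truncPow ε k s| ≤ |s| * (1 + s ^ 2) ^ k := by
  have hg := truncPow_base_pos hε s
  rw [truncPow, abs_mul, abs_of_nonneg (Real.rpow_nonneg hg.le k)]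
  have : (1 + s ^ 2) / (1 + ε * s ^ 2) ≤ 1 + s ^ 2 :=
    div_le_self (by positivity) (by nlinarith [mul_nonneg hε (sq_nonneg s)])
  gcongr

theorem tendsto_truncPow (k s : ℝ) :
    Tendsto (fun n : ℕ => truncPow (1 / ((n : ℝ) + 1)) k s) atTop (𝓝 (s * (1 + s ^ 2) ^ k)) := by
  have h0 := tendsto_one_div_add_atTop_nhds_zero_nat (𝕜 := ℝ)
  have h1 : Tendsto (fun n : ℕ => (1 + s ^ 2) / (1 + 1 / ((n : ℝ) + 1) * s ^ 2)) atTop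
      (𝓝 (1 + s ^ 2)) := by
    have := (tendsto_const_nhds (x := 1 + s ^ 2)).div ((h0.mul_const (s ^ 2)).const_add 1)
      (by simp)
    rw [zero_mul, add_zero, div_one] at this
    exact this
  exact (h1.rpow_const (Or.inl (by positivity))).const_mul s

/-- Separates the right-hand side f (as `y`) from the solution u (as `s`) in the energy estimate.
The left side is at most the power m/2 of 1 + y² + s², which is at most three times its largest
summand; hence 3^{m/2}. -/
theorem mul_mul_rpow_le {y s m : ℝ} (hm : 2 ≤ m) :
    |y| * (|s| * (1 + s ^ 2) ^ (m / 2 - 1)) ≤ 3 ^ (m / 2) * (1 + |y| ^ m + |s| ^ m) := by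
  have hsq : ∀ x : ℝ, (x ^ 2) ^ (m / 2) = |x| ^ m := fun x => by
    rw [← sq_abs, ← Real.rpow_natCast_mul (abs_nonneg x)]
    congr 1
    push_cast
    ring
  set B := 1 + y ^ 2 + s ^ 2 with hB
  have hB0 : 0 < B := by positivity
  have h1 : |y| * (|s| * (1 + s ^ 2) ^ (m / 2 - 1)) ≤ B ^ (m / 2) := by
    have e : B ^ (m / 2) = B * B ^ (m / 2 - 1) := by
      rw [Real.rpow_sub_one hB0.ne']
      field_simp
    rw [e, ← mul_assoc]
    refine mul_le_mul ?_ (Real.rpow_le_rpow (by positivity) ?_ (by linarith)) (by positivity)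
      hB0.le
    · nlinarith [sq_nonneg (|y| - |s|), sq_abs y, sq_abs s, mul_nonneg (abs_nonneg y) (abs_nonneg s)]
    · nlinarith [sq_nonneg y]
  refine h1.trans ?_
  set M := max 1 (max (y ^ 2) (s ^ 2)) with hM
  have hM0 : 0 < M := lt_max_of_lt_left one_pos
  have h2 : B ≤ 3 * M := by
    have := le_max_left 1 (max (y ^ 2) (s ^ 2))
    have h3 := le_max_right 1 (max (y ^ 2) (s ^ 2))
    have h4 := le_max_left (y ^ 2) (s ^ 2)
    have h5 := le_max_right (y ^ 2) (s ^ 2)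
    linarith
  have h3 : M ^ (m / 2) ≤ 1 + |y| ^ m + |s| ^ m := by
    have p1 : 0 ≤ |y| ^ m := by positivity
    have p2 : 0 ≤ |s| ^ m := by positivity
    rcases max_choice 1 (max (y ^ 2) (s ^ 2)) with h | h
    · rw [hM, h, Real.one_rpow]; linarith
    · rcases max_choice (y ^ 2) (s ^ 2) with h' | h' <;> rw [hM, h, h', hsq] <;> linarith
  calc B ^ (m / 2) ≤ (3 * M) ^ (m / 2) := Real.rpow_le_rpow hB0.le h2 (by linarith)
    _ = 3 ^ (m / 2) * M ^ (m / 2) := Real.mul_rpow (by norm_num) hM0.le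
    _ ≤ _ := by gcongr

theorem sobExp_pos (hN : 3 ≤ N) : 0 < sobExp N := by
  have hN' : (3 : ℝ) ≤ N := by exact_mod_cast hN
  exact div_pos (by linarith) (by linarith)

theorem eLpNorm_rpow_eq_lintegral {X : Type*} [MeasurableSpace X] {μ : Measure X} {V : Type*}
    [NormedAddCommGroup V] {t : ℝ} (ht : 0 < t) (f : X → V) :
    eLpNorm f (ENNReal.ofReal t) μ ^ t = ∫⁻ x, ‖f x‖ₑ ^ t ∂μ := by
  rw [eLpNorm_eq_lintegral_rpow_enorm_toReal (by simpa using ht) ENNReal.ofReal_ne_top,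
    ENNReal.toReal_ofReal ht.le, ← ENNReal.rpow_mul, one_div_mul_cancel ht.ne', ENNReal.rpow_one]

/-- One step of the Moser iteration for `-Δ u = Λ f`. -/
theorem IsWeakSolution.moser_step {C : ℝ} (hN : 3 ≤ N) (hC : ∀ ψ : Eucl N → ℝ, IsTest Ω ψ →
      eLpNorm ψ (ENNReal.ofReal (sobExp N)) (vol Ω) ≤
        ENNReal.ofReal C * eLpNorm (gradient ψ) 2 (vol Ω)) (hC0 : 0 ≤ C)
    {u f : Eucl N → ℝ} {Λ m : ℝ} (hΛ : 0 ≤ Λ) (hm : 2 ≤ m)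
    (h : IsWeakSolution Ω u (fun x => Λ * f x)) (hf : AEStronglyMeasurable f (vol Ω)) :
    ∫⁻ x in Ω, ‖u x‖ₑ ^ (sobExp N / 2 * m) ≤
      (ENNReal.ofReal (C ^ 2 * (m / 2) * 3 ^ (m / 2) * Λ) *
        ((vol Ω) univ + (∫⁻ x in Ω, ‖f x‖ₑ ^ m) + ∫⁻ x in Ω, ‖u x‖ₑ ^ m)) ^ (sobExp N / 2) := by
  -- For ε = 0 the functions F = `truncPow ε k` and H = `truncPow ε (k / 2)` grow like |s|^{m-1} and
  -- |s|^{m/2}. So L^m bounds of f and u control ∫ f F(u), and the estimate for H(u) is one for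
  -- |u|^{m/2} in the Sobolev exponent. The constant κ is 1 + k = m/2.
  set k := m / 2 - 1 with hk
  have hk0 : 0 ≤ k := by linarith
  have hs := sobExp_pos hN
  have hum : AEStronglyMeasurable u (vol Ω) := by
    obtain ⟨-, G, hG, -⟩ := h
    exact hG.1.1
  set R := ENNReal.ofReal (C ^ 2 * (m / 2) * 3 ^ (m / 2) * Λ) *
        ((vol Ω) univ + (∫⁻ x in Ω, ‖f x‖ₑ ^ m) + ∫⁻ x in Ω, ‖u x‖ₑ ^ m) with hR
  have hR2 : ENNReal.ofReal (C ^ 2 * (1 + k)) *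
      ∫⁻ x in Ω, ENNReal.ofReal (Λ * (|f x| * (|u x| * (1 + u x ^ 2) ^ k))) ≤ R := by
    have hpt : ∀ x, ENNReal.ofReal (Λ * (|f x| * (|u x| * (1 + u x ^ 2) ^ k))) ≤
        ENNReal.ofReal (Λ * 3 ^ (m / 2)) * (1 + ‖f x‖ₑ ^ m + ‖u x‖ₑ ^ m) := fun x => by
      have : (1 : ENNReal) + ‖f x‖ₑ ^ m + ‖u x‖ₑ ^ m =
          ENNReal.ofReal (1 + |f x| ^ m + |u x| ^ m) := by
        rw [ENNReal.ofReal_add (by positivity) (by positivity),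
          ENNReal.ofReal_add (by positivity) (by positivity), Real.enorm_eq_ofReal_abs,
          Real.enorm_eq_ofReal_abs, ENNReal.ofReal_rpow_of_nonneg (abs_nonneg _) (by linarith),
          ENNReal.ofReal_rpow_of_nonneg (abs_nonneg _) (by linarith), ENNReal.ofReal_one]
      rw [this, ← ENNReal.ofReal_mul (by positivity), mul_assoc]
      exact ENNReal.ofReal_le_ofReal (mul_le_mul_of_nonneg_left (mul_mul_rpow_le hm) hΛ)
    have h1 : AEMeasurable (fun x => ‖f x‖ₑ ^ m) (vol Ω) := hf.enorm.pow_const _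
    have h2 : AEMeasurable (fun x => ‖u x‖ₑ ^ m) (vol Ω) := hum.enorm.pow_const _
    calc _ ≤ ENNReal.ofReal (C ^ 2 * (1 + k)) * ∫⁻ x in Ω,
          ENNReal.ofReal (Λ * 3 ^ (m / 2)) * (1 + ‖f x‖ₑ ^ m + ‖u x‖ₑ ^ m) := by
          gcongr
          exact hpt _
      _ = R := by
          rw [lintegral_const_mul' _ _ ENNReal.ofReal_ne_top, lintegral_add_right' _ h2,
            lintegral_add_right' _ h1,
            lintegral_one, ← mul_assoc, ← ENNReal.ofReal_mul (by positivity), hR]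
          congr 2
          rw [hk]
          ring
  have hstep : ∀ n : ℕ, eLpNorm (fun x => truncPow (1 / ((n : ℝ) + 1)) (k / 2) (u x))
      (ENNReal.ofReal (sobExp N)) (vol Ω) ≤ R ^ (1 / 2 : ℝ) := fun n => by
    have hε : (0 : ℝ) < 1 / ((n : ℝ) + 1) := by positivity
    have hε1 : 1 / ((n : ℝ) + 1) ≤ 1 := by
      rw [div_le_one (by positivity)]
      linarith [n.cast_nonneg (α := ℝ)]
    have h3 := h.energy hC hC0 (contDiff_truncPow hε.le k) (contDiff_truncPow hε.le (k / 2))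
      (truncPow_zero _ _) (truncPow_zero _ _) (by linarith : (0 : ℝ) ≤ 1 + k)
      (abs_deriv_truncPow_le hε hε1 hk0) (deriv_truncPow_half_sq_le hε.le hε1 hk0)
    have h4 : ENNReal.ofReal (C ^ 2 * (1 + k) * ∫ x in Ω, Λ * f x *
        truncPow (1 / ((n : ℝ) + 1)) k (u x)) ≤ R := by
      refine le_trans ?_ hR2
      rw [ENNReal.ofReal_mul (by positivity)]
      gcongr
      refine (ENNReal.ofReal_le_ofReal (le_abs_self _)).trans ?_
      rw [← Real.enorm_eq_ofReal_abs]
      refine (enorm_integral_le_lintegral_enorm _).trans (lintegral_mono fun x => ?_)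
      rw [Real.enorm_eq_ofReal_abs]
      refine ENNReal.ofReal_le_ofReal ?_
      rw [abs_mul, abs_mul, abs_of_nonneg hΛ, mul_assoc]
      gcongr
      exact abs_truncPow_le hε.le hk0 _
    have h5 := h3.trans h4
    rw [← ENNReal.rpow_le_rpow_iff (z := 2) (by norm_num), ← ENNReal.rpow_mul]
    simpa using h5
  -- Fatou's lemma removes the truncation ε = 1/(n+1), because `R` does not depend on n.
  have hlim : eLpNorm (fun x => u x * (1 + u x ^ 2) ^ (k / 2)) (ENNReal.ofReal (sobExp N)) (vol Ω) ≤
      R ^ (1 / 2 : ℝ) := by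
    refine (Lp.eLpNorm_lim_le_liminf_eLpNorm
      (f := fun (n : ℕ) x => truncPow (1 / ((n : ℝ) + 1)) (k / 2) (u x))
      (fun n => (contDiff_truncPow (by positivity) _).continuous.comp_aestronglyMeasurable hum) _
      (Eventually.of_forall fun x => tendsto_truncPow _ _)).trans ?_
    exact (liminf_le_liminf (Eventually.of_forall hstep)).trans (by simp)
  calc ∫⁻ x in Ω, ‖u x‖ₑ ^ (sobExp N / 2 * m)
      ≤ ∫⁻ x in Ω, ‖u x * (1 + u x ^ 2) ^ (k / 2)‖ₑ ^ sobExp N := by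
        refine lintegral_mono fun x => ?_
        have : |u x| ^ (m / 2) ≤ |u x * (1 + u x ^ 2) ^ (k / 2)| := by
          rcases eq_or_ne (u x) 0 with h0 | h0
          · simp [h0, Real.zero_rpow (by linarith : m / 2 ≠ 0)]
          · rw [abs_mul, abs_of_nonneg (by positivity : 0 ≤ (1 + u x ^ 2) ^ (k / 2)),
              show m / 2 = 1 + 2 * (k / 2) by rw [hk]; ring,
              Real.rpow_add (abs_pos.2 h0), Real.rpow_one, Real.rpow_mul (abs_nonneg _),
              Real.rpow_two, sq_abs]
            gcongr
            linarith
        have h6 : ‖u x‖ₑ ^ (m / 2) ≤ ‖u x * (1 + u x ^ 2) ^ (k / 2)‖ₑ := by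
          rw [Real.enorm_eq_ofReal_abs, Real.enorm_eq_ofReal_abs,
            ENNReal.ofReal_rpow_of_nonneg (abs_nonneg _) (by linarith)]
          exact ENNReal.ofReal_le_ofReal this
        calc ‖u x‖ₑ ^ (sobExp N / 2 * m) = (‖u x‖ₑ ^ (m / 2)) ^ sobExp N := by
              rw [← ENNReal.rpow_mul]; congr 1; ring
          _ ≤ _ := ENNReal.rpow_le_rpow h6 hs.le
    _ = eLpNorm (fun x => u x * (1 + u x ^ 2) ^ (k / 2)) (ENNReal.ofReal (sobExp N)) (vol Ω) ^
          sobExp N := (eLpNorm_rpow_eq_lintegral hs _).symm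
    _ ≤ (R ^ (1 / 2 : ℝ)) ^ sobExp N := ENNReal.rpow_le_rpow hlim hs.le
    _ = _ := by rw [← ENNReal.rpow_mul]; congr 1; ring

end Moser

end HamiltonianSystem

namespace HamiltonianSystem

/-! ### L^t bounds for combinations of eigenfunctions with bounded eigenvalues -/

section SpectralBounds

variable {N : ℕ} {Ω : Set (Eucl N)}

/-- A finite linear combination of eigenfunctions. -/
noncomputable def eigenComb (B : DirichletEigenbasis Ω) (S : Finset ℕ) (c : ℕ → ℝ) : L2 Ω :=
  ∑ k ∈ S, c k • B.φ k

theorem isWeakSolution_eigenComb (B : DirichletEigenbasis Ω) (S : Finset ℕ) (c : ℕ → ℝ) :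
    IsWeakSolution Ω (eigenComb B S c) (eigenComb B S fun k => B.ev k * c k) := by
  classical
  induction S using Finset.induction_on with
  | empty =>
    refine isWeakSolution_zero.congr ?_ ?_ <;>
    · simp only [eigenComb, Finset.sum_empty]
      exact (Lp.coeFn_zero _ _ _).symm
  | insert a S ha ih =>
    refine (((B.eigen a).isWeakSolution.const_mul (c a)).add ih).congr ?_ ?_
    · have e : eigenComb B (insert a S) c = c a • B.φ a + eigenComb B S c := by
        simp [eigenComb, Finset.sum_insert ha]
      rw [e]
      filter_upwards [Lp.coeFn_add (c a • B.φ a) (eigenComb B S c),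
        Lp.coeFn_smul (c a) (B.φ a)] with x h1 h2
      rw [h1, Pi.add_apply, h2, Pi.smul_apply, smul_eq_mul]
    · have e : eigenComb B (insert a S) (fun k => B.ev k * c k) =
          (B.ev a * c a) • B.φ a + eigenComb B S (fun k => B.ev k * c k) := by
        simp [eigenComb, Finset.sum_insert ha]
      rw [e]
      filter_upwards [Lp.coeFn_add ((B.ev a * c a) • B.φ a) (eigenComb B S fun k => B.ev k * c k),
        Lp.coeFn_smul (B.ev a * c a) (B.φ a)] with x h1 h2
      rw [h1, Pi.add_apply, h2, Pi.smul_apply, smul_eq_mul]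
      ring

theorem norm_eigenComb_sq (B : DirichletEigenbasis Ω) (S : Finset ℕ) (c : ℕ → ℝ) :
    ‖eigenComb B S c‖ ^ 2 = ∑ k ∈ S, c k ^ 2 := by
  rw [← real_inner_self_eq_norm_sq, eigenComb, B.φ.orthonormal.inner_sum]
  simp [sq]

theorem eLpNorm_coeFn_eq_ofReal {X : Type*} [MeasurableSpace X] {μ : Measure X} {t : ENNReal}
    (u : Lp ℝ t μ) : eLpNorm u t μ = ENNReal.ofReal ‖u‖ := by
  rw [Lp.norm_def, ENNReal.ofReal_toReal (Lp.eLpNorm_ne_top u)]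

/-- The bound `∫ |u|^m ≤ C Λ^{N(m-2)/4}` for `L²`-normalized combinations `u` of eigenfunctions
with eigenvalues at most `Λ`. -/
def SpectralBound (B : DirichletEigenbasis Ω) (m : ℝ) : Prop :=
  ∃ C : ℝ, 0 < C ∧ ∀ (Λ : ℝ) (S : Finset ℕ) (c : ℕ → ℝ), 1 ≤ Λ → (∀ k ∈ S, B.ev k ≤ Λ) →
    ∑ k ∈ S, c k ^ 2 ≤ 1 →
    ∫⁻ x in Ω, ‖eigenComb B S c x‖ₑ ^ m ≤ ENNReal.ofReal (C * Λ ^ ((N : ℝ) / 4 * (m - 2)))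

theorem spectralBound_two (B : DirichletEigenbasis Ω) : SpectralBound B 2 := by
  refine ⟨1, one_pos, fun Λ S c _ _ hc => ?_⟩
  have h := eLpNorm_rpow_eq_lintegral (μ := vol Ω) (two_pos) (eigenComb B S c)
  rw [← h, ENNReal.ofReal_ofNat, eLpNorm_coeFn_eq_ofReal,
    ENNReal.ofReal_rpow_of_nonneg (norm_nonneg _) two_pos.le, Real.rpow_two, norm_eigenComb_sq]
  refine ENNReal.ofReal_le_ofReal ?_
  simpa using hc

/-- For u = Σ c_k φ_k with λ_k ≤ Λ one has -Δu = Λf, where f has the coefficients (λ_k/Λ)c_k and so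
satisfies the same constraints as u. Hence the bound at the power m applies to both u and f, and the
Moser step carries it to the next power. -/
theorem SpectralBound.step (hN : 3 ≤ N) [IsFiniteMeasure (vol Ω)] {B : DirichletEigenbasis Ω}
    {m : ℝ} (hm : 2 ≤ m) (h : SpectralBound B m) : SpectralBound B (sobExp N / 2 * m) := by
  obtain ⟨K, hK0, hK⟩ := exists_sobolev_const hN Ω
  obtain ⟨C, hC, hb⟩ := h
  have hs := sobExp_pos hN
  have hN' : (3 : ℝ) ≤ N := by exact_mod_cast hN
  have hβ : 0 ≤ (N : ℝ) / 4 * (m - 2) := mul_nonneg (by positivity) (by linarith)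
  set v := ((vol Ω) univ).toReal with hv
  set D := K ^ 2 * (m / 2) * 3 ^ (m / 2) + 1 with hD
  have hD0 : 0 < D := by positivity
  refine ⟨(D * (v + C + C)) ^ (sobExp N / 2), by positivity, fun Λ S c hΛ hS hc => ?_⟩
  have hΛ0 : 0 < Λ := by linarith
  have hΛβ : 1 ≤ Λ ^ ((N : ℝ) / 4 * (m - 2)) := Real.one_le_rpow hΛ hβ
  have hw : IsWeakSolution Ω (eigenComb B S c)
      (fun x => Λ * eigenComb B S (fun k => B.ev k / Λ * c k) x) := by
    refine (isWeakSolution_eigenComb B S c).congr (ae_eq_refl _) ?_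
    have e : (eigenComb B S fun k => B.ev k * c k) =
        Λ • eigenComb B S (fun k => B.ev k / Λ * c k) := by
      simp only [eigenComb, Finset.smul_sum, smul_smul]
      refine Finset.sum_congr rfl fun k _ => ?_
      congr 1
      field_simp
    rw [e]
    filter_upwards [Lp.coeFn_smul Λ (eigenComb B S (fun k => B.ev k / Λ * c k))] with x h1
    rw [h1, Pi.smul_apply, smul_eq_mul]
  refine (hw.moser_step hN hK hK0 hΛ0.le hm (Lp.aestronglyMeasurable _)).trans ?_
  have h1 := hb Λ S c hΛ hS hc
  have h2 := hb Λ S (fun k => B.ev k / Λ * c k) hΛ hS (by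
    refine (Finset.sum_le_sum fun k hk => ?_).trans hc
    rw [mul_pow]
    refine mul_le_of_le_one_left (sq_nonneg _) (pow_le_one₀ (by have := B.ev_pos k; positivity) ?_)
    exact (div_le_one hΛ0).2 (hS k hk))
  have hv' : (vol Ω) univ = ENNReal.ofReal v := (ENNReal.ofReal_toReal (measure_ne_top _ _)).symm
  have hfin : C * Λ ^ ((N : ℝ) / 4 * (m - 2)) ≥ 0 := by positivity
  have hv0 : 0 ≤ v := ENNReal.toReal_nonneg
  calc _ ≤ (ENNReal.ofReal (K ^ 2 * (m / 2) * 3 ^ (m / 2) * Λ) * (ENNReal.ofReal v +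
        ENNReal.ofReal (C * Λ ^ ((N : ℝ) / 4 * (m - 2))) +
        ENNReal.ofReal (C * Λ ^ ((N : ℝ) / 4 * (m - 2))))) ^ (sobExp N / 2) := by
        rw [hv']
        gcongr
    _ = ENNReal.ofReal ((K ^ 2 * (m / 2) * 3 ^ (m / 2) * Λ * (v +
        C * Λ ^ ((N : ℝ) / 4 * (m - 2)) + C * Λ ^ ((N : ℝ) / 4 * (m - 2)))) ^ (sobExp N / 2)) := by
        rw [← ENNReal.ofReal_add hv0 hfin, ← ENNReal.ofReal_add (by positivity) hfin,
          ← ENNReal.ofReal_mul (by positivity),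
          ENNReal.ofReal_rpow_of_nonneg (by positivity) (by positivity)]
    _ ≤ _ := by
        refine ENNReal.ofReal_le_ofReal ?_
        -- The exponent N(m-2)/4 is preserved exactly by the iteration: with κ = N/(N-2), N(κm -
        -- 2)/4 = κ(1 + N(m-2)/4). No power of Λ is lost, which the sharp range of s later depends
        -- on.
        have e : Λ ^ ((N : ℝ) / 4 * (sobExp N / 2 * m - 2)) =
            (Λ * Λ ^ ((N : ℝ) / 4 * (m - 2))) ^ (sobExp N / 2) := by
          rw [← Real.rpow_one_add' hΛ0.le (by linarith), ← Real.rpow_mul hΛ0.le]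
          congr 1
          rw [sobExp]
          have : (N : ℝ) - 2 ≠ 0 := by linarith
          field_simp
          ring
        rw [e, ← Real.mul_rpow (by positivity) (by positivity)]
        refine Real.rpow_le_rpow (by positivity) ?_ (by positivity)
        have h3 : K ^ 2 * (m / 2) * 3 ^ (m / 2) ≤ D := by rw [hD]; linarith
        calc K ^ 2 * (m / 2) * 3 ^ (m / 2) * Λ * (v +
            C * Λ ^ ((N : ℝ) / 4 * (m - 2)) + C * Λ ^ ((N : ℝ) / 4 * (m - 2)))
            ≤ D * Λ * (v * Λ ^ ((N : ℝ) / 4 * (m - 2)) +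
            C * Λ ^ ((N : ℝ) / 4 * (m - 2)) + C * Λ ^ ((N : ℝ) / 4 * (m - 2))) := by
              gcongr
              exact le_mul_of_one_le_right hv0 hΛβ
          _ = _ := by ring

/-- Hölder interpolation between L² and L^T. As N(m-2)/4 is affine in m and vanishes at m = 2,
interpolation reproduces the exponent of Λ. -/
theorem SpectralBound.mono {B : DirichletEigenbasis Ω} {t T : ℝ} (h : SpectralBound B T)
    (ht : 2 ≤ t) (htT : t ≤ T) : SpectralBound B t := by
  rcases eq_or_lt_of_le (ht.trans htT) with h2 | h2
  · rwa [le_antisymm htT (h2 ▸ ht)]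
  obtain ⟨C₁, hC₁, hb₁⟩ := spectralBound_two B
  obtain ⟨C, hC, hb⟩ := h
  set θ := (T - t) / (T - 2) with hθ
  have hT : 0 < T - 2 := by linarith
  have hθ0 : 0 ≤ θ := div_nonneg (by linarith) hT.le
  have hθ1 : 0 ≤ 1 - θ := by
    rw [hθ, sub_nonneg, div_le_one hT]; linarith
  have hθt : (T - 2) * (1 - θ) = t - 2 := by
    rw [hθ]
    field_simp
    ring
  refine ⟨C₁ ^ θ * C ^ (1 - θ), by positivity, fun Λ S c hΛ hS hc => ?_⟩
  have hΛ0 : 0 < Λ := by linarith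
  have hm : AEMeasurable (fun x => ‖eigenComb B S c x‖ₑ) (vol Ω) :=
    (Lp.aestronglyMeasurable _).enorm
  have key := ENNReal.lintegral_mul_norm_pow_le (hm.pow_const (2 : ℝ)) (hm.pow_const T) hθ0 hθ1
    (by ring)
  calc _ = ∫⁻ x in Ω, (‖eigenComb B S c x‖ₑ ^ (2 : ℝ)) ^ θ *
        (‖eigenComb B S c x‖ₑ ^ T) ^ (1 - θ) := by
        refine lintegral_congr fun x => ?_
        rw [← ENNReal.rpow_mul, ← ENNReal.rpow_mul, ← ENNReal.rpow_add_of_nonneg _ _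
          (by positivity) (mul_nonneg (by linarith) hθ1)]
        congr 1
        linarith
    _ ≤ _ := key
    _ ≤ ENNReal.ofReal (C₁ * Λ ^ ((N : ℝ) / 4 * (2 - 2))) ^ θ *
        ENNReal.ofReal (C * Λ ^ ((N : ℝ) / 4 * (T - 2))) ^ (1 - θ) := by
        gcongr
        · exact hb₁ Λ S c hΛ hS hc
        · exact hb Λ S c hΛ hS hc
    _ = _ := by
        rw [ENNReal.ofReal_rpow_of_nonneg (by positivity) hθ0,
          ENNReal.ofReal_rpow_of_nonneg (by positivity) hθ1, ← ENNReal.ofReal_mul (by positivity),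
          Real.mul_rpow hC₁.le (by positivity), Real.mul_rpow hC.le (by positivity)]
        rw [← Real.rpow_mul hΛ0.le, ← Real.rpow_mul hΛ0.le, sub_self, mul_zero, zero_mul,
          Real.rpow_zero, mul_one, mul_assoc, mul_assoc, hθt]

theorem spectralBound (hN : 3 ≤ N) [IsFiniteMeasure (vol Ω)] (B : DirichletEigenbasis Ω) {t : ℝ}
    (ht : 2 ≤ t) : SpectralBound B t := by
  have hN' : (3 : ℝ) ≤ N := by exact_mod_cast hN
  have hχ : 1 < sobExp N / 2 := by
    rw [sobExp, lt_div_iff₀ two_pos, lt_div_iff₀ (by linarith)]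
    linarith
  have hit : ∀ j : ℕ, SpectralBound B ((sobExp N / 2) ^ j * 2) := fun j => by
    induction j with
    | zero => simpa using spectralBound_two B
    | succ j ih =>
      rw [pow_succ', mul_assoc]
      exact ih.step hN (le_mul_of_one_le_left two_pos.le (one_le_pow₀ hχ.le))
  obtain ⟨j, hj⟩ := pow_unbounded_of_one_lt t hχ
  exact (hit j).mono ht (hj.le.trans (le_mul_of_one_le_right (by positivity) one_le_two))

end SpectralBounds

end HamiltonianSystem

namespace HamiltonianSystem

/-! ### Sobolev embedding of the spectral spaces, and divergence of the eigenvalues -/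

section Embedding

variable {N : ℕ} {Ω : Set (Eucl N)}

theorem eLpNorm_coeFn_add_le {X : Type*} [MeasurableSpace X] {μ : Measure X} {t : ENNReal}
    (ht : 1 ≤ t) (u v : Lp ℝ 2 μ) : eLpNorm (u + v : Lp ℝ 2 μ) t μ ≤ eLpNorm u t μ + eLpNorm v t μ := by
  rw [eLpNorm_congr_ae (Lp.coeFn_add u v)]
  exact eLpNorm_add_le (Lp.aestronglyMeasurable u) (Lp.aestronglyMeasurable v) ht

theorem eLpNorm_coeFn_sum_le {X ι : Type*} [MeasurableSpace X] {μ : Measure X} {t : ENNReal}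
    (ht : 1 ≤ t) (T : Finset ι) (u : ι → Lp ℝ 2 μ) :
    eLpNorm (∑ j ∈ T, u j : Lp ℝ 2 μ) t μ ≤ ∑ j ∈ T, eLpNorm (u j) t μ :=
  Finset.le_sum_of_subadditive (fun w : Lp ℝ 2 μ => eLpNorm w t μ)
    (by simp only [eLpNorm_congr_ae (Lp.coeFn_zero ℝ 2 μ), eLpNorm_zero]; rfl)
    (eLpNorm_coeFn_add_le ht) T u

/-- Fatou's lemma along an almost everywhere convergent subsequence; it extends the estimates from
finite sums to all of Θ^s. -/
theorem eLpNorm_le_of_tendsto_L2 {X : Type*} [MeasurableSpace X] {μ : Measure X} {t : ENNReal}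
    {w : ℕ → Lp ℝ 2 μ} {u : Lp ℝ 2 μ} (h : Tendsto w atTop (𝓝 u)) {K : ENNReal}
    (hK : ∀ n, eLpNorm (w n) t μ ≤ K) : eLpNorm u t μ ≤ K := by
  obtain ⟨ns, -, hae⟩ := (tendstoInMeasure_of_tendsto_Lp h).exists_seq_tendsto_ae
  refine (Lp.eLpNorm_lim_le_liminf_eLpNorm (f := fun n => w (ns n))
    (fun n => Lp.aestronglyMeasurable _) _ hae).trans ?_
  exact (liminf_le_liminf (Eventually.of_forall fun n => hK (ns n))).trans (by simp)

theorem SpectralBound.eLpNorm_le {B : DirichletEigenbasis Ω} {t : ℝ} (ht : 2 ≤ t)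
    (h : SpectralBound B t) : ∃ C : ℝ, 0 < C ∧ ∀ (Λ : ℝ) (S : Finset ℕ) (c : ℕ → ℝ), 1 ≤ Λ →
      (∀ k ∈ S, B.ev k ≤ Λ) → eLpNorm (eigenComb B S c) (ENNReal.ofReal t) (vol Ω) ≤
        ENNReal.ofReal (C * Λ ^ ((N : ℝ) / 2 * (1 / 2 - 1 / t)) * √(∑ k ∈ S, c k ^ 2)) := by
  obtain ⟨C, hC, hb⟩ := h
  have ht0 : 0 < t := by linarith
  refine ⟨C ^ (1 / t), by positivity, fun Λ S c hΛ hS => ?_⟩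
  have hΛ0 : 0 < Λ := by linarith
  rcases (Finset.sum_nonneg fun k _ => sq_nonneg (c k) : 0 ≤ ∑ k ∈ S, c k ^ 2).eq_or_lt with h0 | h0
  · have : eigenComb B S c = 0 := by
      rw [← norm_eq_zero, ← sq_eq_zero_iff, norm_eigenComb_sq, h0]
    rw [this, eLpNorm_congr_ae (Lp.coeFn_zero ℝ 2 _)]
    simp
  · set r := √(∑ k ∈ S, c k ^ 2) with hr
    have hr0 : 0 < r := Real.sqrt_pos.2 h0
    have h1 := hb Λ S (fun k => c k / r) hΛ hS (by
      simp only [div_pow, hr, Real.sq_sqrt h0.le]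
      rw [← Finset.sum_div, div_self h0.ne'])
    rw [← eLpNorm_rpow_eq_lintegral ht0] at h1
    have e : eigenComb B S c = r • eigenComb B S (fun k => c k / r) := by
      simp only [eigenComb, Finset.smul_sum, smul_smul]
      refine Finset.sum_congr rfl fun k _ => ?_
      congr 1
      field_simp
    have h2 : eLpNorm (eigenComb B S fun k => c k / r) (ENNReal.ofReal t) (vol Ω) ≤
        ENNReal.ofReal (C ^ (1 / t) * Λ ^ ((N : ℝ) / 2 * (1 / 2 - 1 / t))) := by
      rw [← ENNReal.rpow_le_rpow_iff ht0]
      refine h1.trans (le_of_eq ?_)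
      rw [ENNReal.ofReal_rpow_of_nonneg (by positivity) ht0.le,
        Real.mul_rpow (by positivity) (by positivity), ← Real.rpow_mul hC.le,
        ← Real.rpow_mul hΛ0.le, one_div_mul_cancel ht0.ne', Real.rpow_one]
      congr 3
      field_simp
      ring
    rw [e, eLpNorm_congr_ae (Lp.coeFn_smul r _), eLpNorm_const_smul, mul_comm,
      ENNReal.ofReal_mul (by positivity), Real.enorm_eq_ofReal_abs, abs_of_pos hr0]
    gcongr

theorem tendsto_eigenComb (B : DirichletEigenbasis Ω) (u : L2 Ω) :
    Tendsto (fun n => eigenComb B (Finset.range n) (fourier B u)) atTop (𝓝 u) := by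
  have h := (B.φ.hasSum_repr u).tendsto_sum_nat
  simp only [B.φ.repr_apply_apply] at h
  exact h

/-- `b k` is the least j with λ_k ≤ 2^j. Minimality gives the lower bound with factor 1/2 when j >
0. All eigenvalues at most 1 lie in the block j = 0, where the smallest eigenvalue `B.ev 0` serves.
-/
theorem exists_dyadic_index (B : DirichletEigenbasis Ω) : ∃ (b : ℕ → ℕ) (κ : ℝ), 0 < κ ∧
    ∀ k, B.ev k ≤ 2 ^ b k ∧ κ * 2 ^ b k ≤ B.ev k := by
  classical
  have hex : ∀ k, ∃ j : ℕ, B.ev k ≤ 2 ^ j := fun k =>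
    (pow_unbounded_of_one_lt (B.ev k) one_lt_two).imp fun _ h => h.le
  refine ⟨fun k => Nat.find (hex k), min (1 / 2) (B.ev 0), lt_min (by norm_num) (B.ev_pos 0),
    fun k => ⟨Nat.find_spec (hex k), ?_⟩⟩
  rcases Nat.eq_zero_or_pos (Nat.find (hex k)) with h | h
  · simp only [h, pow_zero, mul_one]
    exact (min_le_right _ _).trans (B.ev_mono (Nat.zero_le k))
  · have h1 := Nat.find_min (hex k) (Nat.sub_lt h one_pos)
    push Not at h1
    have h2 : (2 : ℝ) ^ Nat.find (hex k) = 2 * 2 ^ (Nat.find (hex k) - 1) := by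
      rw [← pow_succ', Nat.sub_add_cancel h]
    have h3 : min (1 / 2) (B.ev 0) ≤ 1 / 2 := min_le_left _ _
    have h4 : (0 : ℝ) < 2 ^ Nat.find (hex k) := by positivity
    nlinarith

/-- Sobolev embedding for finite sums, by dyadic decomposition of the spectrum. -/
theorem exists_eLpNorm_eigenComb_le (hN : 3 ≤ N) [IsFiniteMeasure (vol Ω)]
    (B : DirichletEigenbasis Ω) {t s : ℝ} (ht : 2 ≤ t) (hs : (N : ℝ) * (1 / 2 - 1 / t) < s) :
    ∃ C : ℝ, 0 < C ∧ ∀ (S : Finset ℕ) (c : ℕ → ℝ),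
      eLpNorm (eigenComb B S c) (ENNReal.ofReal t) (vol Ω) ≤
        ENNReal.ofReal (C * √(∑ k ∈ S, B.ev k ^ s * c k ^ 2)) := by
  classical
  obtain ⟨C, hC, hb⟩ := (spectralBound hN B ht).eLpNorm_le ht
  obtain ⟨b, κ, hκ, hbk⟩ := exists_dyadic_index B
  set σ := (N : ℝ) / 2 * (1 / 2 - 1 / t) with hσ
  have h2t : 1 / t ≤ 1 / 2 := one_div_le_one_div_of_le two_pos ht
  have hσs : σ < s / 2 := by rw [hσ]; linarith
  have hσ0 : 0 ≤ σ := mul_nonneg (by positivity) (by linarith)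
  have hs0 : 0 < s := by linarith
  -- The block of eigenvalues comparable to 2^j costs a factor 2^{jσ} by the spectral bound and
  -- gains 2^{-js/2} from the weight. The hypothesis on s says σ < s/2, so the blocks are dominated
  -- by a convergent geometric series.
  set ρ : ℝ := 2 ^ (σ - s / 2) with hρ
  have hρ0 : 0 < ρ := by positivity
  have hρ1 : ρ < 1 := Real.rpow_lt_one_of_one_lt_of_neg one_lt_two (by linarith)
  refine ⟨C * κ ^ (-(s / 2)) * (1 - ρ)⁻¹, by have := sub_pos.2 hρ1; positivity, fun S c => ?_⟩
  set W := ∑ k ∈ S, B.ev k ^ s * c k ^ 2 with hW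
  have hnn : ∀ k, 0 ≤ B.ev k ^ s * c k ^ 2 := fun k => by have := B.ev_pos k; positivity
  have e : eigenComb B S c = ∑ j ∈ S.image b, eigenComb B (S.filter fun k => b k = j) c :=
    (Finset.sum_fiberwise_of_maps_to (fun k hk => Finset.mem_image_of_mem b hk) _).symm
  have hblock : ∀ j, eLpNorm (eigenComb B (S.filter fun k => b k = j) c) (ENNReal.ofReal t) (vol Ω) ≤
      ENNReal.ofReal (C * κ ^ (-(s / 2)) * √W * ρ ^ j) := fun j => by
    refine (hb (2 ^ j) _ c (one_le_pow₀ one_le_two) fun k hk => ?_).trans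
      (ENNReal.ofReal_le_ofReal ?_)
    · rw [← (Finset.mem_filter.1 hk).2]
      exact (hbk k).1
    · have hK : (0 : ℝ) < κ * 2 ^ j := by positivity
      have h1 : ∑ k ∈ S with b k = j, c k ^ 2 ≤ (κ * 2 ^ j) ^ (-s) * W := by
        calc _ ≤ ∑ k ∈ S with b k = j, (κ * 2 ^ j) ^ (-s) * (B.ev k ^ s * c k ^ 2) := by
              refine Finset.sum_le_sum fun k hk => ?_
              have h2 := (hbk k).2
              rw [(Finset.mem_filter.1 hk).2] at h2
              rw [← mul_assoc]
              refine le_mul_of_one_le_left (sq_nonneg _) ?_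
              rw [Real.rpow_neg hK.le, inv_mul_eq_div, one_le_div (by positivity)]
              exact Real.rpow_le_rpow hK.le h2 hs0.le
          _ = (κ * 2 ^ j) ^ (-s) * ∑ k ∈ S with b k = j, B.ev k ^ s * c k ^ 2 := by
              rw [Finset.mul_sum]
          _ ≤ _ := by
              refine mul_le_mul_of_nonneg_left ?_ (by positivity)
              exact Finset.sum_le_sum_of_subset_of_nonneg (Finset.filter_subset _ _)
                fun k _ _ => hnn k
      have h2 : √(∑ k ∈ S with b k = j, c k ^ 2) ≤ (κ * 2 ^ j) ^ (-(s / 2)) * √W := by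
        refine (Real.sqrt_le_sqrt h1).trans (le_of_eq ?_)
        rw [Real.sqrt_mul (by positivity), Real.sqrt_eq_rpow, ← Real.rpow_mul hK.le]
        congr 2
        ring
      refine (mul_le_mul_of_nonneg_left h2 (by positivity)).trans (le_of_eq ?_)
      have h3 : ρ ^ j = ((2 : ℝ) ^ j) ^ σ * ((2 : ℝ) ^ j) ^ (-(s / 2)) := by
        rw [← Real.rpow_add (by positivity), hρ, ← Real.rpow_natCast, ← Real.rpow_natCast,
          ← Real.rpow_mul two_pos.le, ← Real.rpow_mul two_pos.le]
        congr 1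
        ring
      rw [Real.mul_rpow hκ.le (by positivity), h3]
      ring
  rw [e]
  refine (eLpNorm_coeFn_sum_le ?_ _ _).trans ((Finset.sum_le_sum fun j _ => hblock j).trans ?_)
  · rw [ENNReal.one_le_ofReal]; linarith
  · rw [← ENNReal.ofReal_sum_of_nonneg fun j _ => by positivity, ← Finset.mul_sum]
    refine ENNReal.ofReal_le_ofReal ?_
    have h4 : ∑ j ∈ S.image b, ρ ^ j ≤ (1 - ρ)⁻¹ := by
      rw [← tsum_geometric_of_lt_one hρ0.le hρ1]
      exact (summable_geometric_of_lt_one hρ0.le hρ1).sum_le_tsum _ fun j _ => by positivity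
    calc _ ≤ C * κ ^ (-(s / 2)) * √W * (1 - ρ)⁻¹ := by gcongr
      _ = _ := by ring

/-- Sobolev embedding of `Θ^s(Ω)` into `L^t(Ω)` for `s > N (1/2 - 1/t)`. -/
theorem exists_eLpNorm_le_theta (hN : 3 ≤ N) [IsFiniteMeasure (vol Ω)]
    (B : DirichletEigenbasis Ω) {t s : ℝ} (ht : 2 ≤ t) (hs : (N : ℝ) * (1 / 2 - 1 / t) < s) :
    ∃ C : ℝ, 0 < C ∧ ∀ u : L2 Ω, (Summable fun k => B.ev k ^ s * fourier B u k ^ 2) →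
      eLpNorm u (ENNReal.ofReal t) (vol Ω) ≤
        ENNReal.ofReal (C * √(∑' k, B.ev k ^ s * fourier B u k ^ 2)) := by
  obtain ⟨C, hC, hb⟩ := exists_eLpNorm_eigenComb_le hN B ht hs
  refine ⟨C, hC, fun u hu => eLpNorm_le_of_tendsto_L2 (tendsto_eigenComb B u) fun n => ?_⟩
  refine (hb _ _).trans (ENNReal.ofReal_le_ofReal ?_)
  gcongr
  exact hu.sum_le_tsum _ fun k _ => by have := B.ev_pos k; positivity

/-- If the eigenvalues were bounded, the spectral bound for one fixed Λ would hold on all of L² and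
give ‖u‖₄ ≤ D‖u‖₂. The indicator function of a ball of measure m then satisfies m^{1/4} ≤ Dm^{1/2},
that is 1 ≤ D⁴m, which fails for small balls. -/
theorem tendsto_ev_atTop (hN : 3 ≤ N) [IsFiniteMeasure (vol Ω)] (hΩ : IsOpen Ω) (hne : Ω.Nonempty)
    (B : DirichletEigenbasis Ω) : Tendsto B.ev atTop atTop := by
  refine B.ev_mono.tendsto_atTop_atTop fun Λ => ?_
  by_contra hcon
  push Not at hcon
  obtain ⟨C, hC, hb⟩ := (spectralBound hN B (t := 4) (by norm_num)).eLpNorm_le (by norm_num)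
  set D := C * (max Λ 1) ^ ((N : ℝ) / 2 * (1 / 2 - 1 / 4)) with hD
  have hΛ0 : 0 < max Λ 1 := lt_max_of_lt_right one_pos
  have hD0 : 0 < D := by positivity
  have hall : ∀ u : L2 Ω, eLpNorm u (ENNReal.ofReal 4) (vol Ω) ≤ ENNReal.ofReal (D * ‖u‖) :=
    fun u => by
    refine eLpNorm_le_of_tendsto_L2 (tendsto_eigenComb B u) fun n => ?_
    refine (hb (max Λ 1) _ _ (le_max_right _ _) fun k _ =>
      (hcon k).le.trans (le_max_left _ _)).trans (ENNReal.ofReal_le_ofReal ?_)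
    refine mul_le_mul_of_nonneg_left ?_ hD0.le
    refine Real.sqrt_le_iff.2 ⟨norm_nonneg _, ?_⟩
    have := B.φ.orthonormal.sum_inner_products_le u (s := Finset.range n)
    simpa [fourier] using this
  obtain ⟨x₀, hx₀⟩ := hne
  obtain ⟨R, hR, hball⟩ := Metric.isOpen_iff.1 hΩ x₀ hx₀
  have hNpos : 0 < N := by omega
  have : Nonempty (Fin N) := ⟨⟨0, hNpos⟩⟩
  have : Nontrivial (Eucl N) := inferInstance
  -- the indicator functions of small balls violate the bound
  have hsmall : ∀ ε : ℝ, 0 < ε → ε ≤ R →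
      1 ≤ D ^ 4 * (volume (Metric.ball x₀ ε)).toReal := fun ε hε hεR => by
    set m := (volume (Metric.ball x₀ ε)).toReal with hm
    have hmeas : vol Ω (Metric.ball x₀ ε) = volume (Metric.ball x₀ ε) :=
      Measure.restrict_eq_self _ ((Metric.ball_subset_ball hεR).trans hball)
    have hfin : vol Ω (Metric.ball x₀ ε) ≠ ⊤ := measure_ne_top _ _
    have hfin' : volume (Metric.ball x₀ ε) ≠ ⊤ := hmeas ▸ hfin
    have hm0 : 0 < m := ENNReal.toReal_pos (Metric.measure_ball_pos _ _ hε).ne' hfin'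
    have hvol : vol Ω (Metric.ball x₀ ε) = ENNReal.ofReal m := by
      rw [hmeas, hm, ENNReal.ofReal_toReal hfin']
    have h1 := hall (indicatorConstLp 2 measurableSet_ball hfin (1 : ℝ))
    rw [eLpNorm_congr_ae indicatorConstLp_coeFn, norm_indicatorConstLp (by norm_num) (by norm_num),
      eLpNorm_indicator_const measurableSet_ball (by norm_num) (by norm_num),
      measureReal_def, hvol, ENNReal.toReal_ofReal hm0.le, ENNReal.ofReal_rpow_of_nonneg hm0.le (by positivity), enorm_one, one_mul,
      ENNReal.ofReal_le_ofReal_iff (by positivity)] at h1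
    have h2 := pow_le_pow_left₀ (by positivity) h1 4
    rw [norm_one, one_mul, mul_pow, ← Real.rpow_mul_natCast hm0.le,
      ← Real.rpow_mul_natCast hm0.le] at h2
    norm_num at h2
    rw [sq, ← mul_assoc] at h2
    exact le_of_mul_le_mul_right (by linarith) hm0
  have hlim : Tendsto (fun n : ℕ => (volume (Metric.ball x₀ (R / (n + 1)))).toReal) atTop (𝓝 0) := by
    have h1 : ∀ n : ℕ, (volume (Metric.ball x₀ (R / (n + 1)))).toReal =
        (R / (n + 1)) ^ N * (volume (Metric.ball (0 : Eucl N) 1)).toReal := fun n => by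
      rw [Measure.addHaar_ball _ _ (by positivity), finrank_euclideanSpace_fin, ENNReal.toReal_mul,
        ENNReal.toReal_ofReal (by positivity)]
    simp only [h1]
    have h2 : Tendsto (fun n : ℕ => R / ((n : ℝ) + 1)) atTop (𝓝 0) := by
      have := (tendsto_one_div_add_atTop_nhds_zero_nat (𝕜 := ℝ)).const_mul R
      simpa [div_eq_mul_inv] using this
    have h3 := (h2.pow N).mul_const (volume (Metric.ball (0 : Eucl N) 1)).toReal
    rwa [zero_pow hNpos.ne', zero_mul] at h3
  have h5 := ge_of_tendsto' (hlim.const_mul (D ^ 4)) fun n =>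
    hsmall (R / (n + 1)) (by positivity) (div_le_self hR.le (by linarith [n.cast_nonneg (α := ℝ)]))
  rw [mul_zero] at h5
  linarith

end Embedding

end HamiltonianSystem

namespace HamiltonianSystem

/-! ### The spaces Θ^s as copies of ℓ², and compactness of the embeddings -/

section ThetaSpaces

variable {N : ℕ} {Ω : Set (Eucl N)} {B : DirichletEigenbasis Ω} {s : ℝ}

theorem rpow_half_sq {x : ℝ} (hx : 0 ≤ x) (s : ℝ) : (x ^ (s / 2)) ^ 2 = x ^ s := by
  rw [← Real.rpow_mul_natCast hx]
  norm_num

theorem memℓp_two_of_summable {x : ℕ → ℝ} (h : Summable fun k => x k ^ 2) : Memℓp x 2 := by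
  refine memℓp_gen (h.congr fun k => ?_)
  simp

theorem summable_sq_lp (x : lp (fun _ : ℕ => ℝ) 2) : Summable fun k => x k ^ 2 := by
  have h := (memℓp_gen_iff (p := 2) (by norm_num)).1 (lp.memℓp x)
  refine h.congr fun k => ?_
  simp

theorem Theta.ext_coeff {u v : Theta B s} (h : ∀ k, coeff u k = coeff v k) : u = v := by
  rw [← sub_eq_zero]
  apply toL2_injective
  rw [map_zero]
  refine eq_zero_of_fourier B fun k => ?_
  have := h k
  simp only [coeff] at this
  rw [map_sub, fourier, inner_sub_right, sub_eq_zero]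
  exact this

theorem coeff_eigenfunction (j k : ℕ) :
    Theta.coeff (Theta.eigenfunction B s j) k = if k = j then 1 else 0 :=
  fourier_φ B j k

theorem Theta.norm_sq_eq (u : Theta B s) : ‖u‖ ^ 2 = ∑' k, B.ev k ^ s * coeff u k ^ 2 := by
  rw [← real_inner_self_eq_norm_sq, inner_eq]
  simp only [sq]

/-- The isometry `∑ ξ_k φ_k ↦ (λ_k^{s/2} ξ_k)_k` into `ℓ²`. -/
noncomputable def thetaIsometry (B : DirichletEigenbasis Ω) (s : ℝ) :
    Theta B s →ₗᵢ[ℝ] lp (fun _ : ℕ => ℝ) 2 where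
  toFun u := ⟨fun k => B.ev k ^ (s / 2) * Theta.coeff u k,
    memℓp_two_of_summable (u.summable.congr fun k => by
      rw [mul_pow, rpow_half_sq (B.ev_pos k).le])⟩
  map_add' u v := by
    ext k
    simp only [Theta.coeff_add, lp.coeFn_add, Pi.add_apply]
    ring
  map_smul' c u := by
    ext k
    simp only [Theta.coeff_smul, lp.coeFn_smul, Pi.smul_apply, smul_eq_mul, RingHom.id_apply]
    ring
  norm_map' u := by
    rw [← sq_eq_sq₀ (norm_nonneg _) (norm_nonneg _), Theta.norm_sq_eq, ← real_inner_self_eq_norm_sq,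
      lp.inner_eq_tsum]
    refine tsum_congr fun k => ?_
    simp only [LinearMap.coe_mk, AddHom.coe_mk, RCLike.inner_apply, conj_trivial]
    rw [← sq, mul_pow, rpow_half_sq (B.ev_pos k).le]

/-- The condition s ≥ 0 ensures that the preimage lies in L²: dividing by λ_k^{s/2} keeps a sequence
in ℓ², since the eigenvalues are bounded below by `B.ev 0`. -/
theorem thetaIsometry_surjective (B : DirichletEigenbasis Ω) (hs : 0 ≤ s) :
    Function.Surjective (thetaIsometry B s) := fun x => by
  have hev := B.ev_pos
  have hx := summable_sq_lp x
  have hy : Summable fun k => (B.ev k ^ (-s / 2) * x k) ^ 2 := by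
    refine Summable.of_nonneg_of_le (fun k => sq_nonneg _) (fun k => ?_) (hx.mul_left (B.ev 0 ^ (-s)))
    rw [mul_pow, rpow_half_sq (hev k).le]
    refine mul_le_mul_of_nonneg_right ?_ (sq_nonneg _)
    exact Real.rpow_le_rpow_of_nonpos (hev 0) (B.ev_mono (Nat.zero_le k)) (by linarith)
  set u : L2 Ω := B.φ.repr.symm ⟨_, memℓp_two_of_summable hy⟩ with hu
  have hc : ∀ k, fourier B u k = B.ev k ^ (-s / 2) * x k := fun k => by
    rw [fourier, ← B.φ.repr_apply_apply, hu, LinearIsometryEquiv.apply_symm_apply]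
  have hk : ∀ k, B.ev k ^ (s / 2) * fourier B u k = x k := fun k => by
    rw [hc, ← mul_assoc, ← Real.rpow_add (hev k), show s / 2 + -s / 2 = 0 by ring, Real.rpow_zero,
      one_mul]
  refine ⟨⟨u, hx.congr fun k => ?_⟩, ?_⟩
  · rw [← hk, mul_pow, rpow_half_sq (hev k).le]
  · ext k
    exact hk k

/-- `Θ^s(Ω)` is isometric to `ℓ²`. -/
noncomputable def thetaRepr (B : DirichletEigenbasis Ω) (hs : 0 ≤ s) :
    Theta B s ≃ₗᵢ[ℝ] lp (fun _ : ℕ => ℝ) 2 :=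
  LinearIsometryEquiv.ofSurjective (thetaIsometry B s) (thetaIsometry_surjective B hs)

theorem thetaRepr_apply (hs : 0 ≤ s) (u : Theta B s) (k : ℕ) :
    thetaRepr B hs u k = B.ev k ^ (s / 2) * Theta.coeff u k := rfl

theorem completeSpace_theta (B : DirichletEigenbasis Ω) (hs : 0 ≤ s) : CompleteSpace (Theta B s) :=
  (completeSpace_congr (e := (thetaRepr B hs).toEquiv)
    (thetaRepr B hs).isometry.isUniformEmbedding).2 inferInstance

/-- The Hilbert basis `λ_k^{-s/2} φ_k` of `Θ^s(Ω)`. -/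
noncomputable def thetaBasis (B : DirichletEigenbasis Ω) (hs : 0 ≤ s) :
    HilbertBasis ℕ ℝ (Theta B s) := HilbertBasis.ofRepr (thetaRepr B hs)

theorem inner_thetaBasis (hs : 0 ≤ s) (u : Theta B s) (k : ℕ) :
    inner ℝ (thetaBasis B hs k) u = B.ev k ^ (s / 2) * Theta.coeff u k := by
  rw [← (thetaBasis B hs).repr_apply_apply]
  rfl

theorem thetaBasis_eq (hs : 0 ≤ s) (k : ℕ) :
    thetaBasis B hs k = B.ev k ^ (-s / 2) • Theta.eigenfunction B s k := by
  refine Theta.ext_coeff fun j => ?_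
  have h := inner_thetaBasis hs (thetaBasis B hs k) j
  rw [orthonormal_iff_ite.1 (thetaBasis B hs).orthonormal] at h
  have hp := Real.rpow_pos_of_pos (B.ev_pos j) (s / 2)
  rw [Theta.coeff_smul, coeff_eigenfunction]
  refine mul_left_cancel₀ hp.ne' ?_
  rw [← h]
  split_ifs with hjk
  · rw [hjk, mul_one, ← Real.rpow_add (B.ev_pos k), show s / 2 + -s / 2 = 0 by ring, Real.rpow_zero]
  · simp

/-- The compact Sobolev embedding `Θ^s(Ω) ⊂ L^t(Ω)` for `s > N (1/2 - 1/t)`. -/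
theorem exists_compact_embedding (hN : 3 ≤ N) [IsFiniteMeasure (vol Ω)] (hΩ : IsOpen Ω)
    (hne : Ω.Nonempty) (B : DirichletEigenbasis Ω) {t s : ℝ} (ht : 2 ≤ t)
    (hs : (N : ℝ) * (1 / 2 - 1 / t) < s) [Fact (1 ≤ ENNReal.ofReal t)] :
    ∃ j : Theta B s →L[ℝ] Lp ℝ (ENNReal.ofReal t) (vol Ω),
      (∀ u, j u =ᵐ[vol Ω] Theta.toL2 u) ∧ IsCompactOperator j := by
  have h2t : 1 / t ≤ 1 / 2 := one_div_le_one_div_of_le two_pos ht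
  have hN0 : 0 ≤ (N : ℝ) * (1 / 2 - 1 / t) := mul_nonneg (by positivity) (by linarith)
  have hs0 : 0 ≤ s := by linarith
  have hev := B.ev_pos
  -- The embedding still holds for a smaller exponent s'. On the modes k ≥ n the Θ^{s'} norm is at
  -- most λ_n^{(s'-s)/2} times the Θ^s norm, so the tails of the embedding tend to zero in operator
  -- norm.
  obtain ⟨s', hs1, hs2⟩ := exists_between hs
  obtain ⟨C, hC, hb⟩ := exists_eLpNorm_le_theta hN B ht hs
  obtain ⟨C', hC', hb'⟩ := exists_eLpNorm_le_theta hN B ht hs1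
  have hmem : ∀ u : Theta B s, MemLp (Theta.toL2 u) (ENNReal.ofReal t) (vol Ω) := fun u =>
    ⟨Lp.aestronglyMeasurable _, (hb _ u.summable).trans_lt ENNReal.ofReal_lt_top⟩
  let j₀ : Theta B s →ₗ[ℝ] Lp ℝ (ENNReal.ofReal t) (vol Ω) :=
    { toFun := fun u => (hmem u).toLp _
      map_add' := fun u v => by
        rw [← MemLp.toLp_add (hmem u) (hmem v)]
        refine MemLp.toLp_congr _ _ ?_
        rw [map_add]
        exact Lp.coeFn_add _ _
      map_smul' := fun c u => by
        rw [RingHom.id_apply, ← MemLp.toLp_const_smul c (hmem u)]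
        refine MemLp.toLp_congr _ _ ?_
        rw [map_smul]
        exact Lp.coeFn_smul _ _ }
  have hnorm : ∀ u, ‖j₀ u‖ ≤ C * ‖u‖ := fun u => by
    change ‖(hmem u).toLp _‖ ≤ _
    rw [Lp.norm_toLp]
    refine ENNReal.toReal_le_of_le_ofReal (by positivity) ((hb _ u.summable).trans (le_of_eq ?_))
    congr 2
    rw [← Real.sqrt_sq (norm_nonneg u), Theta.norm_sq_eq]
    rfl
  let j := j₀.mkContinuous C hnorm
  refine ⟨j, fun u => (hmem u).coeFn_toLp, ?_⟩
  set b := thetaBasis B hs0 with hbdef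
  let F : ℕ → Theta B s →L[ℝ] Lp ℝ (ENNReal.ofReal t) (vol Ω) := fun n =>
    ∑ k ∈ Finset.range n, (innerSL ℝ (b k)).smulRight (j (b k))
  have hF : ∀ n u, F n u = j (∑ k ∈ Finset.range n, inner ℝ (b k) u • b k) := fun n u => by
    simp [F, map_sum]
  refine isCompactOperator_of_tendsto (F := F) (l := atTop) ?_ (Eventually.of_forall fun n => ?_)
  · -- the truncations converge in operator norm
    have hrate : Tendsto (fun n => C' * (B.ev n) ^ ((s' - s) / 2)) atTop (𝓝 0) := by
      have h1 := (tendsto_rpow_neg_atTop (y := (s - s') / 2) (by linarith)).comp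
        (tendsto_ev_atTop hN hΩ hne B)
      have h2 := h1.const_mul C'
      rw [mul_zero] at h2
      refine h2.congr fun n => ?_
      simp only [Function.comp_apply]
      congr 2
      ring
    rw [tendsto_iff_norm_sub_tendsto_zero]
    refine squeeze_zero (fun _ => norm_nonneg _) (fun n => ?_) hrate
    refine ContinuousLinearMap.opNorm_le_bound _ (by have := hev n; positivity) fun u => ?_
    set w := u - ∑ k ∈ Finset.range n, inner ℝ (b k) u • b k with hw
    have hwu : (F n - j) u = -j w := by
      rw [sub_apply, hF, hw, map_sub]
      abel
    have hin : ∀ k, inner ℝ (b k) w = if k < n then 0 else inner ℝ (b k) u := fun k => by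
      rw [hw, inner_sub_right, inner_sum]
      simp only [inner_smul_right, orthonormal_iff_ite.1 b.orthonormal]
      split_ifs with hk
      · rw [Finset.sum_eq_single k]
        · simp
        · intro i _ hi
          simp [Ne.symm hi]
        · intro h
          exact absurd (Finset.mem_range.2 hk) h
      · rw [Finset.sum_eq_zero, sub_zero]
        intro i hi
        have : k ≠ i := fun h => hk (h ▸ Finset.mem_range.1 hi)
        simp [this]
    have hcoef : ∀ v : Theta B s, ∀ k, B.ev k ^ s' * Theta.coeff v k ^ 2 =
        B.ev k ^ (s' - s) * inner ℝ (b k) v ^ 2 := fun v k => by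
      rw [hbdef, inner_thetaBasis, mul_pow, rpow_half_sq (hev k).le, ← mul_assoc,
        ← Real.rpow_add (hev k), sub_add_cancel]
    have hterm : ∀ k, B.ev k ^ s' * Theta.coeff w k ^ 2 ≤
        B.ev n ^ (s' - s) * (B.ev k ^ s * Theta.coeff u k ^ 2) := fun k => by
      rw [hcoef, hin]
      have e : B.ev k ^ s * Theta.coeff u k ^ 2 = inner ℝ (b k) u ^ 2 := by
        rw [hbdef, inner_thetaBasis, mul_pow, rpow_half_sq (hev k).le]
      rw [e]
      split_ifs with hk
      · have := hev n
        simp only [ne_eq, OfNat.ofNat_ne_zero, not_false_eq_true, zero_pow, mul_zero]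
        positivity
      · refine mul_le_mul_of_nonneg_right ?_ (sq_nonneg _)
        exact Real.rpow_le_rpow_of_nonpos (hev n) (B.ev_mono (not_lt.1 hk)) (by linarith)
    have hsum : Summable fun k => B.ev k ^ s' * Theta.coeff w k ^ 2 :=
      Summable.of_nonneg_of_le (fun k => by have := hev k; positivity) hterm
        (u.summable.mul_left _)
    have hjw : ‖j w‖ ≤ C' * √(∑' k, B.ev k ^ s' * Theta.coeff w k ^ 2) := by
      change ‖(hmem w).toLp _‖ ≤ _
      rw [Lp.norm_toLp]
      exact ENNReal.toReal_le_of_le_ofReal (by positivity) (hb' _ hsum)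
    rw [hwu, norm_neg]
    refine hjw.trans ?_
    rw [mul_assoc]
    refine mul_le_mul_of_nonneg_left (Real.sqrt_le_iff.2 ⟨by have := hev n; positivity, ?_⟩) hC'.le
    rw [mul_pow, rpow_half_sq (hev n).le, Theta.norm_sq_eq, ← tsum_mul_left]
    exact hsum.tsum_le_tsum hterm (u.summable.mul_left _)
  · classical
    simp only [F]
    induction n with
    | zero =>
      simp only [Finset.range_zero, Finset.sum_empty]
      exact isCompactOperator_zero
    | succ n ih =>
      rw [Finset.sum_range_succ]
      refine ih.add ?_
      have h1 : IsCompactOperator (ContinuousLinearMap.toSpanSingleton ℝ (j (b n))) :=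
        isCompactOperator_of_locallyCompactSpace_rng
          (ContinuousLinearMap.toSpanSingleton ℝ (j (b n)))
      exact h1.comp_clm (innerSL ℝ (b n))

end ThetaSpaces

/-! ### The reflection S of E^r and the Galerkin spaces -/

section Reflection

variable {N : ℕ} {Ω : Set (Eucl N)} {B : DirichletEigenbasis Ω} {r : ℝ}

/-- The reflection `(u, v) ↦ ((-Δ)^{1-r} v, (-Δ)^{r-1} u)` of `E^r(Ω)`. -/
noncomputable def reflection (B : DirichletEigenbasis Ω) (hr : 0 ≤ r) (hr' : 0 ≤ 2 - r) :
    Er B r →L[ℝ] Er B r :=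
  LinearIsometry.toContinuousLinearMap
    { toFun := fun w => WithLp.toLp 2 ((thetaRepr B hr).symm (thetaRepr B hr' w.snd),
        (thetaRepr B hr').symm (thetaRepr B hr w.fst))
      map_add' := fun w z => by
        simp only [WithLp.add_snd, WithLp.add_fst, map_add]
        rfl
      map_smul' := fun c w => by
        simp only [WithLp.smul_snd, WithLp.smul_fst, map_smul]
        rfl
      norm_map' := fun w => by
        rw [← sq_eq_sq₀ (norm_nonneg _) (norm_nonneg _), WithLp.prod_norm_sq_eq_of_L2,
          WithLp.prod_norm_sq_eq_of_L2]
        simp [add_comm] }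

variable (hr : 0 ≤ r) (hr' : 0 ≤ 2 - r)

theorem reflection_fst (w : Er B r) :
    (reflection B hr hr' w).fst = (thetaRepr B hr).symm (thetaRepr B hr' w.snd) := rfl

theorem reflection_snd (w : Er B r) :
    (reflection B hr hr' w).snd = (thetaRepr B hr').symm (thetaRepr B hr w.fst) := rfl

theorem Er.ext {w z : Er B r} (h1 : w.fst = z.fst) (h2 : w.snd = z.snd) : w = z :=
  (WithLp.equiv 2 _).injective (Prod.ext h1 h2)

theorem reflection_reflection (w : Er B r) : reflection B hr hr' (reflection B hr hr' w) = w := by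
  refine Er.ext ?_ ?_
  · simp [reflection_fst, reflection_snd]
  · simp [reflection_fst, reflection_snd]

theorem inner_thetaRepr_symm (hr : 0 ≤ r) (x : lp (fun _ : ℕ => ℝ) 2) (u : Theta B r) :
    inner ℝ ((thetaRepr B hr).symm x) u = inner ℝ x (thetaRepr B hr u) := by
  rw [← (thetaRepr B hr).inner_map_map, LinearIsometryEquiv.apply_symm_apply]

theorem inner_thetaRepr_symm_right (hr : 0 ≤ r) (x : lp (fun _ : ℕ => ℝ) 2) (u : Theta B r) :
    inner ℝ u ((thetaRepr B hr).symm x) = inner ℝ (thetaRepr B hr u) x := by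
  rw [← (thetaRepr B hr).inner_map_map, LinearIsometryEquiv.apply_symm_apply]

theorem inner_reflection_left (w z : Er B r) :
    inner ℝ (reflection B hr hr' w) z = inner ℝ w (reflection B hr hr' z) := by
  rw [WithLp.prod_inner_apply, WithLp.prod_inner_apply]
  change inner ℝ (reflection B hr hr' w).fst z.fst + inner ℝ (reflection B hr hr' w).snd z.snd =
    inner ℝ w.fst (reflection B hr hr' z).fst + inner ℝ w.snd (reflection B hr hr' z).snd
  rw [reflection_fst, reflection_snd, reflection_fst, reflection_snd, inner_thetaRepr_symm,
    inner_thetaRepr_symm, inner_thetaRepr_symm_right, inner_thetaRepr_symm_right, add_comm]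

theorem coeff_reflection_fst (w : Er B r) (k : ℕ) :
    B.ev k ^ (r / 2) * Theta.coeff (reflection B hr hr' w).fst k =
      B.ev k ^ ((2 - r) / 2) * Theta.coeff w.snd k := by
  rw [← thetaRepr_apply hr, reflection_fst, LinearIsometryEquiv.apply_symm_apply, thetaRepr_apply]

theorem coeff_reflection_snd (w : Er B r) (k : ℕ) :
    B.ev k ^ ((2 - r) / 2) * Theta.coeff (reflection B hr hr' w).snd k =
      B.ev k ^ (r / 2) * Theta.coeff w.fst k := by
  rw [← thetaRepr_apply hr', reflection_snd, LinearIsometryEquiv.apply_symm_apply, thetaRepr_apply]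

/-- In the ℓ² coordinates x_k = λ_k^{r/2}ξ_k and y_k = λ_k^{(2-r)/2}η_k the form is (x, y), because
the weights multiply to λ_k, while S exchanges x and y. So (Sw, w) = 2(x, y), and S is the operator
L of the quadratic form. -/
theorem quadForm_eq_inner_reflection (w : Er B r) :
    quadForm w = 1 / 2 * inner ℝ (reflection B hr hr' w) w := by
  have h : ∀ x : lp (fun _ : ℕ => ℝ) 2, ∀ y : lp (fun _ : ℕ => ℝ) 2,
      inner ℝ x y = ∑' k, x k * y k := fun x y => by
    rw [lp.inner_eq_tsum]
    refine tsum_congr fun k => ?_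
    simp [mul_comm]
  have e : quadForm w = inner ℝ (thetaRepr B hr w.fst) (thetaRepr B hr' w.snd) := by
    rw [h, quadForm]
    refine tsum_congr fun k => ?_
    rw [thetaRepr_apply, thetaRepr_apply, mul_mul_mul_comm, ← Real.rpow_add (B.ev_pos k),
      show r / 2 + (2 - r) / 2 = 1 by ring, Real.rpow_one]
  rw [WithLp.prod_inner_apply]
  change _ = 1 / 2 * (inner ℝ (reflection B hr hr' w).fst w.fst +
    inner ℝ (reflection B hr hr' w).snd w.snd)
  rw [reflection_fst, reflection_snd, inner_thetaRepr_symm, inner_thetaRepr_symm, real_inner_comm,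
    ← e]
  ring

theorem mem_Eplus_iff (w : Er B r) : w ∈ Eplus B r ↔ reflection B hr hr' w = w := by
  have hp : ∀ k, B.ev k ^ ((2 - r) / 2) * B.ev k ^ (r - 1) = B.ev k ^ (r / 2) := fun k => by
    rw [← Real.rpow_add (B.ev_pos k)]
    congr 1
    ring
  constructor
  · intro h
    have hw : ∀ k, B.ev k ^ ((2 - r) / 2) * Theta.coeff w.snd k =
        B.ev k ^ (r / 2) * Theta.coeff w.fst k := fun k => by
      rw [show Theta.coeff w.snd k = B.ev k ^ (r - 1) * Theta.coeff w.fst k from h k, ← mul_assoc, hp]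
    refine Er.ext (Theta.ext_coeff fun k => ?_) (Theta.ext_coeff fun k => ?_)
    · refine mul_left_cancel₀ (Real.rpow_pos_of_pos (B.ev_pos k) (r / 2)).ne' ?_
      rw [coeff_reflection_fst, hw]
    · refine mul_left_cancel₀ (Real.rpow_pos_of_pos (B.ev_pos k) ((2 - r) / 2)).ne' ?_
      rw [coeff_reflection_snd, hw]
  · intro h k
    refine mul_left_cancel₀ (Real.rpow_pos_of_pos (B.ev_pos k) ((2 - r) / 2)).ne' ?_
    rw [← mul_assoc, hp, ← coeff_reflection_snd hr hr', h]

theorem eMinus_eq (k : ℕ) : eMinus B r k = (1 / √2) •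
    WithLp.toLp 2 (thetaBasis B hr k, -thetaBasis B hr' k) := by
  rw [eMinus, thetaBasis_eq, thetaBasis_eq]
  congr 5
  ring_nf

theorem reflection_eMinus (k : ℕ) : reflection B hr hr' (eMinus B r k) = -eMinus B r k := by
  have h1 : thetaRepr B hr (thetaBasis B hr k) = lp.single 2 k (1 : ℝ) :=
    (thetaBasis B hr).repr_self k
  have h2 : thetaRepr B hr' (thetaBasis B hr' k) = lp.single 2 k (1 : ℝ) :=
    (thetaBasis B hr').repr_self k
  rw [eMinus_eq hr hr', map_smul, ← smul_neg]
  congr 1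
  refine Er.ext ?_ ?_
  · rw [reflection_fst]
    change (thetaRepr B hr).symm (thetaRepr B hr' (-thetaBasis B hr' k)) = -thetaBasis B hr k
    rw [map_neg, h2, ← h1, map_neg, LinearIsometryEquiv.symm_apply_apply]
  · rw [reflection_snd]
    change (thetaRepr B hr').symm (thetaRepr B hr (thetaBasis B hr k)) = - -thetaBasis B hr' k
    rw [neg_neg, h1, ← h2, LinearIsometryEquiv.symm_apply_apply]

/-- Allows a Galerkin Palais-Smale sequence to be tested with Sw, which is what bounds ‖w‖. -/
theorem reflection_mem_galerkinSpace {n : ℕ} {w : Er B r} (hw : w ∈ galerkinSpace B r n) :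
    reflection B hr hr' w ∈ galerkinSpace B r n := by
  have h : galerkinSpace B r n ≤
      (galerkinSpace B r n).comap (reflection B hr hr' : Er B r →ₗ[ℝ] Er B r) := by
    refine sup_le (Submodule.span_le.2 ?_) fun z hz => ?_
    · rintro _ ⟨k, hk, rfl⟩
      change reflection B hr hr' (eMinus B r k) ∈ galerkinSpace B r n
      rw [reflection_eMinus]
      exact neg_mem (Submodule.mem_sup_left (Submodule.subset_span ⟨k, hk, rfl⟩))
    · change reflection B hr hr' z ∈ galerkinSpace B r n
      rw [(mem_Eplus_iff hr hr' z).1 hz]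
      exact Submodule.mem_sup_right hz
  exact h hw

/-- The part (w + Sw)/2 belongs to E^+ and so to every X_n. Only (w - Sw)/2 has to be truncated, and
since S changes its sign it expands along the e_k^-. -/
theorem exists_tendsto_galerkinSpace (hr : 0 ≤ r) (hr' : 0 ≤ 2 - r) (w : Er B r) :
    ∃ y : ℕ → Er B r, (∀ n, y n ∈ galerkinSpace B r n) ∧ Tendsto y atTop (𝓝 w) := by
  set S := reflection B hr hr' with hS
  set z := (1 / 2 : ℝ) • (w - S w) with hz
  have hp : (1 / 2 : ℝ) • (w + S w) ∈ Eplus B r := by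
    rw [mem_Eplus_iff hr hr', ← hS, map_smul, map_add, hS, reflection_reflection, add_comm]
  have hSz : S z = -z := by
    rw [hz, map_smul, map_sub, hS, reflection_reflection, ← smul_neg, neg_sub]
  set a : ℕ → ℝ := fun k => inner ℝ (thetaBasis B hr k) z.fst with ha
  have ha' : ∀ k, inner ℝ (thetaBasis B hr' k) z.snd = -a k := fun k => by
    rw [inner_thetaBasis, ← coeff_reflection_fst hr hr', ← hS, hSz, WithLp.neg_fst]
    have : Theta.coeff (-z.fst) k = -Theta.coeff z.fst k := by
      rw [← neg_one_smul ℝ, Theta.coeff_smul, neg_one_mul]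
    rw [this, mul_neg, ha]
    simp only [inner_thetaBasis]
  have h1 := ((thetaBasis B hr).hasSum_repr z.fst).tendsto_sum_nat
  have h2 := ((thetaBasis B hr').hasSum_repr z.snd).tendsto_sum_nat
  simp only [HilbertBasis.repr_apply_apply, ha'] at h1 h2
  have h3 : Tendsto (fun n => WithLp.toLp 2 (∑ k ∈ Finset.range n, a k • thetaBasis B hr k,
      ∑ k ∈ Finset.range n, -a k • thetaBasis B hr' k)) atTop (𝓝 z) :=
    ((WithLp.prod_continuous_toLp 2 _ _).tendsto (z.fst, z.snd)).comp (h1.prodMk_nhds h2)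
  have h4 : ∀ n, WithLp.toLp 2 (∑ k ∈ Finset.range n, a k • thetaBasis B hr k,
      ∑ k ∈ Finset.range n, -a k • thetaBasis B hr' k) =
      ∑ k ∈ Finset.range n, (a k * √2) • eMinus B r k := fun n => by
    induction n with
    | zero => simp
    | succ n ih =>
      rw [Finset.sum_range_succ, Finset.sum_range_succ, Finset.sum_range_succ, ← ih,
        eMinus_eq hr hr', smul_smul]
      have : a n * √2 * (1 / √2) = a n := by field_simp
      rw [this, ← WithLp.toLp_smul, ← WithLp.toLp_add]
      simp
  refine ⟨fun n => ∑ k ∈ Finset.range n, (a k * √2) • eMinus B r k + (1 / 2 : ℝ) • (w + S w),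
    fun n => ?_, ?_⟩
  · refine add_mem (Submodule.sum_mem _ fun k hk => Submodule.smul_mem _ _ ?_)
      (Submodule.mem_sup_right hp)
    exact Submodule.mem_sup_left (Submodule.subset_span ⟨k, Finset.mem_range.1 hk, rfl⟩)
  · have h5 := (h3.congr h4).add_const ((1 / 2 : ℝ) • (w + S w))
    have e : z + (1 / 2 : ℝ) • (w + S w) = w := by
      rw [hz, ← smul_add, sub_add_add_cancel, ← two_smul ℝ w, smul_smul]
      norm_num
    rwa [e] at h5

end Reflection

end HamiltonianSystem

namespace HamiltonianSystem

/-! ### Pointwise estimates for |s|^t -/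

section PowerPointwise

variable {t : ℝ}

theorem rpow_sub_rpow_le {x y p : ℝ} (hx : 0 < x) (hy : 0 ≤ y) (hp : 1 ≤ p) :
    x ^ p - y ^ p ≤ p * x ^ (p - 1) * (x - y) := by
  have h := one_add_mul_self_le_rpow_one_add (s := (y - x) / x) (p := p) (by
    rw [le_div_iff₀ hx]; linarith) hp
  have e : 1 + (y - x) / x = y / x := by field_simp; ring
  rw [e, Real.div_rpow hy hx.le, le_div_iff₀ (by positivity)] at h
  have e2 : (1 + p * ((y - x) / x)) * x ^ p = x ^ p - p * x ^ (p - 1) * (x - y) := by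
    rw [Real.rpow_sub_one hx.ne']
    field_simp
    ring
  linarith

theorem abs_signedPow_sub_le_of_le (ht : 2 < t) {a b : ℝ} (hab : |b| ≤ |a|) :
    |(|a| ^ (t - 2) * a - |b| ^ (t - 2) * b)| ≤ t * (|a| + |b|) ^ (t - 2) * |a - b| := by
  rcases eq_or_ne a 0 with h0 | h0
  · have : b = 0 := by simpa [h0] using hab
    simp [h0, this]
  have hx : 0 < |a| := abs_pos.2 h0
  have hy : 0 ≤ |b| := abs_nonneg b
  have e : |a| ^ (t - 2) * a - |b| ^ (t - 2) * b =
      |a| ^ (t - 2) * (a - b) + (|a| ^ (t - 2) - |b| ^ (t - 2)) * b := by ring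
  have hmono : |b| ^ (t - 2) ≤ |a| ^ (t - 2) := Real.rpow_le_rpow hy hab (by linarith)
  have h1 : (|a| ^ (t - 2) - |b| ^ (t - 2)) * |b| ≤ (t - 1) * |a| ^ (t - 2) * |a - b| := by
    -- The convexity bound is applied to the power t - 1 > 1, because t - 2 may be less than 1. The
    -- assumption |b| ≤ |a| then turns |a|^{t-2}|b| into at most |a|^{t-1}.
    have h2 := rpow_sub_rpow_le (p := t - 1) hx hy (by linarith)
    have e1 : |a| ^ (t - 1) = |a| ^ (t - 2) * |a| := by
      rw [← Real.rpow_add_one hx.ne']; congr 1; ring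
    have e2 : |b| ^ (t - 1) = |b| ^ (t - 2) * |b| := by
      rw [← Real.rpow_add_one' hy (by linarith)]; congr 1; ring
    rw [e1, e2, show t - 1 - 1 = t - 2 by ring] at h2
    have h3 : |a| - |b| ≤ |a - b| := abs_sub_abs_le_abs_sub a b
    have h4 : |a| ^ (t - 2) * |b| ≤ |a| ^ (t - 2) * |a| := by gcongr
    have h5 : (t - 1) * |a| ^ (t - 2) * (|a| - |b|) ≤ (t - 1) * |a| ^ (t - 2) * |a - b| :=
      mul_le_mul_of_nonneg_left h3 (mul_nonneg (by linarith) (by positivity))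
    linarith
  have h6 : |a| ^ (t - 2) ≤ (|a| + |b|) ^ (t - 2) :=
    Real.rpow_le_rpow hx.le (by linarith) (by linarith)
  rw [e]
  refine (abs_add_le _ _).trans ?_
  rw [abs_mul, abs_mul, abs_of_nonneg (by positivity : 0 ≤ |a| ^ (t - 2)),
    abs_of_nonneg (sub_nonneg.2 hmono)]
  calc _ ≤ |a| ^ (t - 2) * |a - b| + (t - 1) * |a| ^ (t - 2) * |a - b| := by gcongr
    _ = t * |a| ^ (t - 2) * |a - b| := by ring
    _ ≤ _ := by gcongr

/-- `s ↦ |s|^{t-2} s` is locally Lipschitz, quantitatively. -/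
theorem abs_signedPow_sub_le (ht : 2 < t) (a b : ℝ) :
    |(|a| ^ (t - 2) * a - |b| ^ (t - 2) * b)| ≤ t * (|a| + |b|) ^ (t - 2) * |a - b| := by
  rcases le_total |b| |a| with h | h
  · exact abs_signedPow_sub_le_of_le ht h
  · have := abs_signedPow_sub_le_of_le ht h
    rwa [abs_sub_comm, add_comm, abs_sub_comm a b]

/-- Mean value inequality for s ↦ |a + sb|^t minus its linear part on [0, 1], whose derivative is
small by `abs_signedPow_sub_le`. The remainder has the shape needed for Hölder's inequality with
three factors. -/
theorem abs_rpow_taylor (ht : 2 < t) (a b : ℝ) :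
    |(|a + b| ^ t - |a| ^ t - t * (|a| ^ (t - 2) * a * b))| ≤
      t * t * 2 ^ (t - 2) * ((|a| + |b|) ^ (t - 2) * |b| * |b|) := by
  have hd : ∀ s : ℝ, HasDerivAt (fun s : ℝ => |a + s * b| ^ t - s * (t * (|a| ^ (t - 2) * a * b)))
      (t * |a + s * b| ^ (t - 2) * (a + s * b) * b - t * (|a| ^ (t - 2) * a * b)) s := fun s => by
    have h1 : HasDerivAt (fun s : ℝ => a + s * b) b s := by
      simpa using ((hasDerivAt_id s).mul_const b).const_add a
    have h2 := (hasDerivAt_abs_rpow (a + s * b) (by linarith : 1 < t)).comp s h1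
    have h3 := (hasDerivAt_id s).mul_const (t * (|a| ^ (t - 2) * a * b))
    have h4 := h2.sub h3
    rw [one_mul] at h4
    exact h4
  have hbd : ∀ s ∈ Icc (0 : ℝ) 1, ‖t * |a + s * b| ^ (t - 2) * (a + s * b) * b -
      t * (|a| ^ (t - 2) * a * b)‖ ≤ t * t * 2 ^ (t - 2) * ((|a| + |b|) ^ (t - 2) * |b| * |b|) :=
    fun s hs => by
    have hsb : |s * b| ≤ |b| := by
      rw [abs_mul, abs_of_nonneg hs.1]
      exact mul_le_of_le_one_left (abs_nonneg b) hs.2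
    have e : t * |a + s * b| ^ (t - 2) * (a + s * b) * b - t * (|a| ^ (t - 2) * a * b) =
        t * ((|a + s * b| ^ (t - 2) * (a + s * b) - |a| ^ (t - 2) * a) * b) := by ring
    rw [e, Real.norm_eq_abs, abs_mul, abs_mul, abs_of_pos (by linarith : 0 < t)]
    have h4 := abs_signedPow_sub_le ht (a + s * b) a
    rw [add_sub_cancel_left] at h4
    have h5 : (|a + s * b| + |a|) ^ (t - 2) ≤ 2 ^ (t - 2) * (|a| + |b|) ^ (t - 2) := by
      rw [← Real.mul_rpow two_pos.le (by positivity)]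
      refine Real.rpow_le_rpow (by positivity) ?_ (by linarith)
      have := abs_add_le a (s * b)
      linarith [abs_nonneg b]
    have ht0 : 0 < t := by linarith
    calc _ ≤ t * (t * (2 ^ (t - 2) * (|a| + |b|) ^ (t - 2)) * |b| * |b|) := by
          gcongr
          exact h4.trans (by gcongr)
      _ = _ := by ring
  have h := (convex_Icc (0 : ℝ) 1).norm_image_sub_le_of_norm_hasDerivWithin_le
    (fun s _ => (hd s).hasDerivWithinAt) hbd (left_mem_Icc.2 zero_le_one)
    (right_mem_Icc.2 zero_le_one)
  simp only [one_mul, zero_mul, add_zero, sub_zero, norm_one, mul_one] at h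
  rw [Real.norm_eq_abs] at h
  convert h using 2
  ring

end PowerPointwise

/-! ### Continuous differentiability of f ↦ ∫ |f|^t on L^t -/

section PowerFunctional

variable {X : Type*} [MeasurableSpace X] {μ : Measure X} {t : ℝ}

/-- Hölder's inequality with weights (t-2)/t, 1/t, 1/t. It serves for the boundedness of the
derivative, for the remainder estimate and for the continuity of the derivative. -/
theorem lintegral_three_mul_le (ht : 2 < t) {F G H : X → ℝ} (hF : AEStronglyMeasurable F μ)
    (hG : AEStronglyMeasurable G μ) (hH : AEStronglyMeasurable H μ) :
    ∫⁻ x, ‖|F x| ^ (t - 2) * |G x| * |H x|‖ₑ ∂μ ≤ eLpNorm F (ENNReal.ofReal t) μ ^ (t - 2) *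
      eLpNorm G (ENNReal.ofReal t) μ * eLpNorm H (ENNReal.ofReal t) μ := by
  have ht0 : 0 < t := by linarith
  have h := ENNReal.lintegral_prod_norm_pow_le (μ := μ) (Finset.univ : Finset (Fin 3))
    (f := ![fun x => ‖F x‖ₑ ^ t, fun x => ‖G x‖ₑ ^ t, fun x => ‖H x‖ₑ ^ t])
    (p := ![(t - 2) / t, 1 / t, 1 / t]) (by
      intro i _
      fin_cases i
      · exact hF.enorm.pow_const t
      · exact hG.enorm.pow_const t
      · exact hH.enorm.pow_const t) (by
      simp only [Fin.sum_univ_three, Matrix.cons_val_zero, Matrix.cons_val_one, Matrix.cons_val]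
      field_simp
      ring) (by
      intro i _
      fin_cases i
      · exact div_nonneg (by linarith) ht0.le
      · exact one_div_nonneg.2 ht0.le
      · exact one_div_nonneg.2 ht0.le)
  simp only [Fin.prod_univ_three, Matrix.cons_val_zero, Matrix.cons_val_one, Matrix.cons_val] at h
  have hone : ∀ z : ENNReal, (z ^ t) ^ (1 / t) = z := fun z => by
    rw [← ENNReal.rpow_mul, mul_one_div_cancel ht0.ne', ENNReal.rpow_one]
  have htwo : ∀ z : ENNReal, (z ^ t) ^ ((t - 2) / t) = z ^ (t - 2) := fun z => by
    rw [← ENNReal.rpow_mul]; congr 1; field_simp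
  simp only [← eLpNorm_rpow_eq_lintegral ht0, hone, htwo] at h
  refine le_trans (le_of_eq (lintegral_congr fun x => ?_)) h
  rw [enorm_mul, enorm_mul, ← Real.norm_eq_abs (G x), ← Real.norm_eq_abs (H x), enorm_norm,
    enorm_norm, Real.enorm_eq_ofReal (by positivity), ← ENNReal.ofReal_rpow_of_nonneg (abs_nonneg _) (by linarith), ← Real.enorm_eq_ofReal_abs]

theorem integrable_three_mul (ht : 2 < t) {F G H : X → ℝ} (hF : MemLp F (ENNReal.ofReal t) μ)
    (hG : MemLp G (ENNReal.ofReal t) μ) (hH : MemLp H (ENNReal.ofReal t) μ) :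
    Integrable (fun x => |F x| ^ (t - 2) * |G x| * |H x|) μ := by
  refine ⟨?_, (lintegral_three_mul_le ht hF.1 hG.1 hH.1).trans_lt ?_⟩
  · exact (((hF.1.norm.aemeasurable.pow_const (t - 2)).mul hG.1.norm.aemeasurable).mul
      hH.1.norm.aemeasurable).aestronglyMeasurable
  · exact ENNReal.mul_lt_top (ENNReal.mul_lt_top
      (ENNReal.rpow_lt_top_of_nonneg (by linarith) hF.2.ne) hG.2) hH.2

theorem integral_three_mul_le (ht : 2 < t) {F G H : X → ℝ} (hF : MemLp F (ENNReal.ofReal t) μ)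
    (hG : MemLp G (ENNReal.ofReal t) μ) (hH : MemLp H (ENNReal.ofReal t) μ) :
    ∫ x, |F x| ^ (t - 2) * |G x| * |H x| ∂μ ≤ (eLpNorm F (ENNReal.ofReal t) μ).toReal ^ (t - 2) *
      (eLpNorm G (ENNReal.ofReal t) μ).toReal * (eLpNorm H (ENNReal.ofReal t) μ).toReal := by
  have h := ENNReal.toReal_mono (ENNReal.mul_lt_top (ENNReal.mul_lt_top
      (ENNReal.rpow_lt_top_of_nonneg (by linarith) hF.2.ne) hG.2) hH.2).ne
    (lintegral_three_mul_le ht hF.1 hG.1 hH.1)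
  rw [ENNReal.toReal_mul, ENNReal.toReal_mul, ← ENNReal.toReal_rpow] at h
  refine (le_abs_self _).trans (le_trans ?_ h)
  rw [← Real.norm_eq_abs, ← toReal_enorm]
  exact ENNReal.toReal_mono (integrable_three_mul ht hF hG hH).2.ne
    (enorm_integral_le_lintegral_enorm _)

theorem integral_abs_rpow_eq_norm (ht : 0 < t) (f : Lp ℝ (ENNReal.ofReal t) μ) :
    ∫ x, |f x| ^ t ∂μ = ‖f‖ ^ t := by
  rw [Lp.norm_def, ENNReal.toReal_rpow, eLpNorm_rpow_eq_lintegral ht,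
    integral_eq_lintegral_of_nonneg_ae]
  · congr 1
    refine lintegral_congr fun x => ?_
    rw [Real.enorm_eq_ofReal_abs, ENNReal.ofReal_rpow_of_nonneg (abs_nonneg _) ht.le]
  · exact Eventually.of_forall fun x => by positivity
  · exact ((Lp.aestronglyMeasurable f).norm.aemeasurable.pow_const t).aestronglyMeasurable

theorem integrable_abs_rpow (ht : 0 < t) (f : Lp ℝ (ENNReal.ofReal t) μ) :
    Integrable (fun x => |f x| ^ t) μ := by
  refine ⟨((Lp.aestronglyMeasurable f).norm.aemeasurable.pow_const t).aestronglyMeasurable, ?_⟩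
  have h : ∫⁻ x, ‖|f x| ^ t‖ₑ ∂μ = eLpNorm f (ENNReal.ofReal t) μ ^ t := by
    rw [eLpNorm_rpow_eq_lintegral ht]
    refine lintegral_congr fun x => ?_
    rw [Real.enorm_eq_ofReal (by positivity), Real.enorm_eq_ofReal_abs,
      ENNReal.ofReal_rpow_of_nonneg (abs_nonneg _) ht.le]
  rw [hasFiniteIntegral_iff_enorm, h]
  exact ENNReal.rpow_lt_top_of_nonneg ht.le (Lp.eLpNorm_ne_top f)

theorem integrable_signedPow_mul (ht : 2 < t) (f g : Lp ℝ (ENNReal.ofReal t) μ) :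
    Integrable (fun x => |f x| ^ (t - 2) * f x * g x) μ := by
  refine (integrable_three_mul ht (Lp.memLp f) (Lp.memLp f) (Lp.memLp g)).mono' ?_ ?_
  · exact ((((Lp.aestronglyMeasurable f).norm.aemeasurable.pow_const (t - 2)).mul
      (Lp.aestronglyMeasurable f).aemeasurable).mul
      (Lp.aestronglyMeasurable g).aemeasurable).aestronglyMeasurable
  · filter_upwards with x
    rw [Real.norm_eq_abs, abs_mul, abs_mul, abs_of_nonneg (by positivity : 0 ≤ |f x| ^ (t - 2))]

theorem memLp_abs_add (f g : Lp ℝ (ENNReal.ofReal t) μ) :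
    MemLp (fun x => |f x| + |g x|) (ENNReal.ofReal t) μ :=
  (Lp.memLp f).norm.add (Lp.memLp g).norm

theorem integrable_three_mul_add (ht : 2 < t) (f g h k : Lp ℝ (ENNReal.ofReal t) μ) :
    Integrable (fun x => (|f x| + |g x|) ^ (t - 2) * |h x| * |k x|) μ := by
  have h1 := integrable_three_mul ht (memLp_abs_add f g) (Lp.memLp h) (Lp.memLp k)
  have e : ∀ x, |(|f x| + |g x|)| = |f x| + |g x| := fun x => abs_of_nonneg (by positivity)
  simpa only [e] using h1

variable [Fact (1 ≤ ENNReal.ofReal t)]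

/-- The derivative `g ↦ t ∫ |f|^{t-2} f g` of `f ↦ ∫ |f|^t` on `L^t`. -/
noncomputable def lpPowDeriv (ht : 2 < t) (f : Lp ℝ (ENNReal.ofReal t) μ) :
    Lp ℝ (ENNReal.ofReal t) μ →L[ℝ] ℝ :=
  LinearMap.mkContinuous
    { toFun := fun g => t * ∫ x, |f x| ^ (t - 2) * f x * g x ∂μ
      map_add' := fun g g' => by
        rw [← mul_add, ← integral_add (integrable_signedPow_mul ht f g)
          (integrable_signedPow_mul ht f g')]
        congr 1
        refine integral_congr_ae ?_
        filter_upwards [Lp.coeFn_add g g'] with x hx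
        rw [hx, Pi.add_apply, mul_add]
      map_smul' := fun c g => by
        rw [RingHom.id_apply, smul_eq_mul, mul_left_comm, ← integral_const_mul c]
        congr 1
        refine integral_congr_ae ?_
        filter_upwards [Lp.coeFn_smul (p := ENNReal.ofReal t) c g] with x hx
        rw [hx, Pi.smul_apply, smul_eq_mul]
        ring }
    (t * (‖f‖ ^ (t - 2) * ‖f‖)) fun g => by
      have h := integral_three_mul_le ht (Lp.memLp f) (Lp.memLp f) (Lp.memLp g)
      change ‖t * ∫ x, |f x| ^ (t - 2) * f x * g x ∂μ‖ ≤ _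
      rw [norm_mul, Real.norm_of_nonneg (by linarith), mul_assoc]
      refine mul_le_mul_of_nonneg_left (((norm_integral_le_integral_norm _).trans
        (le_of_eq ?_)).trans h) (by linarith)
      refine integral_congr_ae (Eventually.of_forall fun x => ?_)
      simp only [Real.norm_eq_abs, abs_mul, abs_of_nonneg (by positivity : 0 ≤ |f x| ^ (t - 2))]

theorem lpPowDeriv_apply (ht : 2 < t) (f g : Lp ℝ (ENNReal.ofReal t) μ) :
    lpPowDeriv ht f g = t * ∫ x, |f x| ^ (t - 2) * f x * g x ∂μ := rfl

theorem norm_lpPowDeriv_le (ht : 2 < t) (f : Lp ℝ (ENNReal.ofReal t) μ) :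
    ‖lpPowDeriv ht f‖ ≤ t * (‖f‖ ^ (t - 2) * ‖f‖) :=
  LinearMap.mkContinuous_norm_le _ (mul_nonneg (by linarith) (by positivity)) _

theorem toReal_eLpNorm_abs_add_le (f g : Lp ℝ (ENNReal.ofReal t) μ) :
    (eLpNorm (fun x => |f x| + |g x|) (ENNReal.ofReal t) μ).toReal ≤ ‖f‖ + ‖g‖ := by
  have h := eLpNorm_add_le (Lp.memLp f).1.norm (Lp.memLp g).1.norm (Fact.out : 1 ≤ ENNReal.ofReal t)
  rw [eLpNorm_norm, eLpNorm_norm] at h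
  have h2 := ENNReal.toReal_mono
    (ENNReal.add_ne_top.2 ⟨Lp.eLpNorm_ne_top f, Lp.eLpNorm_ne_top g⟩) h
  rw [ENNReal.toReal_add (Lp.eLpNorm_ne_top f) (Lp.eLpNorm_ne_top g)] at h2
  exact h2

theorem integral_three_mul_add_le (ht : 2 < t) (f g h k : Lp ℝ (ENNReal.ofReal t) μ) :
    ∫ x, (|f x| + |g x|) ^ (t - 2) * |h x| * |k x| ∂μ ≤ (‖f‖ + ‖g‖) ^ (t - 2) * ‖h‖ * ‖k‖ := by
  have h1 := integral_three_mul_le ht (memLp_abs_add f g) (Lp.memLp h) (Lp.memLp k)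
  have h2 := toReal_eLpNorm_abs_add_le f g
  have e : ∀ x, |(|f x| + |g x|)| = |f x| + |g x| := fun x => abs_of_nonneg (by positivity)
  simp only [e] at h1
  refine h1.trans ?_
  have h3 : (eLpNorm (fun x => |f x| + |g x|) (ENNReal.ofReal t) μ).toReal ^ (t - 2) ≤
      (‖f‖ + ‖g‖) ^ (t - 2) := Real.rpow_le_rpow ENNReal.toReal_nonneg h2 (by linarith)
  rw [← Lp.norm_def, ← Lp.norm_def]
  gcongr

theorem hasFDerivAt_lpPow (ht : 2 < t) (f : Lp ℝ (ENNReal.ofReal t) μ) :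
    HasFDerivAt (fun g : Lp ℝ (ENNReal.ofReal t) μ => ∫ x, |g x| ^ t ∂μ) (lpPowDeriv ht f) f := by
  have ht0 : 0 < t := by linarith
  rw [hasFDerivAt_iff_isLittleO_nhds_zero]
  have hb : ∀ g : Lp ℝ (ENNReal.ofReal t) μ, ‖∫ x, |(f + g : Lp ℝ (ENNReal.ofReal t) μ) x| ^ t ∂μ -
      ∫ x, |f x| ^ t ∂μ - lpPowDeriv ht f g‖ ≤
      t * t * 2 ^ (t - 2) * ((‖f‖ + ‖g‖) ^ (t - 2) * ‖g‖ * ‖g‖) := fun g => by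
    rw [lpPowDeriv_apply, ← integral_const_mul, ← integral_sub (integrable_abs_rpow ht0 _)
      (integrable_abs_rpow ht0 _), ← integral_sub (f := fun x => |(f + g : Lp ℝ (ENNReal.ofReal t) μ) x| ^ t - |f x| ^ t)
      ((integrable_abs_rpow ht0 _).sub (integrable_abs_rpow ht0 _)) ((integrable_signedPow_mul ht f g).const_mul t)]
    refine (norm_integral_le_integral_norm _).trans ?_
    refine le_trans ?_ (mul_le_mul_of_nonneg_left (integral_three_mul_add_le ht f g g g)
      (by positivity))
    rw [← integral_const_mul]
    refine integral_mono_ae (((((integrable_abs_rpow ht0 _).sub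
      (integrable_abs_rpow ht0 _)).sub ((integrable_signedPow_mul ht f g).const_mul t))).norm)
      ((integrable_three_mul_add ht f g g g).const_mul _) ?_
    filter_upwards [Lp.coeFn_add f g] with x hx
    rw [hx, Pi.add_apply, Real.norm_eq_abs]
    exact abs_rpow_taylor ht (f x) (g x)
  refine (Asymptotics.IsBigO.of_bound 1 (Eventually.of_forall fun g => ?_)).trans_isLittleO
    (g := fun g : Lp ℝ (ENNReal.ofReal t) μ =>
      t * t * 2 ^ (t - 2) * ((‖f‖ + ‖g‖) ^ (t - 2) * ‖g‖ * ‖g‖)) ?_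
  · rw [one_mul]
    exact (hb g).trans (le_abs_self _)
  · have h1 : (fun g : Lp ℝ (ENNReal.ofReal t) μ =>
        t * t * 2 ^ (t - 2) * ((‖f‖ + ‖g‖) ^ (t - 2) * ‖g‖ * ‖g‖)) =
        fun g => (t * t * 2 ^ (t - 2) * ((‖f‖ + ‖g‖) ^ (t - 2) * ‖g‖)) * ‖g‖ := by
      ext g
      ring
    rw [h1]
    have h2 : Tendsto (fun g : Lp ℝ (ENNReal.ofReal t) μ =>
        t * t * 2 ^ (t - 2) * ((‖f‖ + ‖g‖) ^ (t - 2) * ‖g‖)) (𝓝 0) (𝓝 0) := by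
      have hc : Continuous (fun g : Lp ℝ (ENNReal.ofReal t) μ =>
          t * t * 2 ^ (t - 2) * ((‖f‖ + ‖g‖) ^ (t - 2) * ‖g‖)) := by
        refine continuous_const.mul (Continuous.mul ?_ continuous_norm)
        exact (continuous_const.add continuous_norm).rpow_const fun _ => Or.inr (by linarith)
      simpa using hc.tendsto 0
    have h3 := ((Asymptotics.isLittleO_one_iff ℝ).2 h2).mul_isBigO
      (Asymptotics.isBigO_refl (fun g : Lp ℝ (ENNReal.ofReal t) μ => ‖g‖) (𝓝 0))
    simp only [one_mul] at h3
    exact h3.trans_isBigO (Asymptotics.isBigO_norm_left.2 (Asymptotics.isBigO_refl _ _))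

theorem norm_lpPowDeriv_sub_le (ht : 2 < t) (f g : Lp ℝ (ENNReal.ofReal t) μ) :
    ‖lpPowDeriv ht f - lpPowDeriv ht g‖ ≤ t * (t * ((‖f‖ + ‖g‖) ^ (t - 2) * ‖f - g‖)) := by
  have ht0 : 0 < t := by linarith
  refine ContinuousLinearMap.opNorm_le_bound _ (by positivity) fun k => ?_
  rw [sub_apply, lpPowDeriv_apply, lpPowDeriv_apply, ← mul_sub, ← integral_sub
    (integrable_signedPow_mul ht f k) (integrable_signedPow_mul ht g k), norm_mul,
    Real.norm_of_nonneg ht0.le, mul_assoc]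
  refine mul_le_mul_of_nonneg_left ?_ ht0.le
  refine (norm_integral_le_integral_norm _).trans ?_
  rw [mul_assoc]
  refine le_trans ?_ (mul_le_mul_of_nonneg_left (integral_three_mul_add_le ht f g (f - g) k) ht0.le)
  rw [← integral_const_mul]
  refine integral_mono_ae ((integrable_signedPow_mul ht f k).sub
    (integrable_signedPow_mul ht g k)).norm ((integrable_three_mul_add ht f g _ k).const_mul _) ?_
  filter_upwards [Lp.coeFn_sub f g] with x hx
  rw [hx, Pi.sub_apply, Real.norm_eq_abs, ← sub_mul, abs_mul]
  calc _ ≤ t * (|f x| + |g x|) ^ (t - 2) * |f x - g x| * |k x| :=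
        mul_le_mul_of_nonneg_right (abs_signedPow_sub_le ht _ _) (abs_nonneg _)
    _ = _ := by ring

theorem continuous_lpPowDeriv (ht : 2 < t) :
    Continuous (lpPowDeriv ht : Lp ℝ (ENNReal.ofReal t) μ → _) := by
  rw [continuous_iff_continuousAt]
  intro f
  rw [ContinuousAt, tendsto_iff_norm_sub_tendsto_zero]
  refine squeeze_zero (fun _ => norm_nonneg _) (fun g => norm_lpPowDeriv_sub_le ht g f) ?_
  have hc : Continuous (fun g : Lp ℝ (ENNReal.ofReal t) μ =>
      t * (t * ((‖g‖ + ‖f‖) ^ (t - 2) * ‖g - f‖))) := by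
    refine continuous_const.mul (continuous_const.mul (Continuous.mul ?_ (by fun_prop)))
    exact (continuous_norm.add continuous_const).rpow_const fun _ => Or.inr (by linarith)
  simpa using hc.tendsto f

end PowerFunctional

end HamiltonianSystem

namespace HamiltonianSystem

/-! ### Real variable lemmas and the behaviour of the energy along rays -/

section RealLemmas

/-- The threshold X solves X^{θ-1} = ε. Below it x^θ ≤ X^θ; above it x^θ = x^{θ-1}x ≤ εx. -/
theorem exists_rpow_le_mul_add {θ ε : ℝ} (hθ0 : 0 ≤ θ) (hθ : θ < 1) (hε : 0 < ε) :
    ∃ C : ℝ, 0 ≤ C ∧ ∀ x : ℝ, 0 ≤ x → x ^ θ ≤ ε * x + C := by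
  set X := ε ^ (1 / (θ - 1)) with hX
  have hX0 : 0 < X := by positivity
  refine ⟨X ^ θ, by positivity, fun x hx => ?_⟩
  rcases le_total x X with h | h
  · have := Real.rpow_le_rpow hx h hθ0
    nlinarith
  · have hx0 : 0 < x := hX0.trans_le h
    have h1 : x ^ (θ - 1) ≤ X ^ (θ - 1) := Real.rpow_le_rpow_of_nonpos hX0 h (by linarith)
    rw [hX, ← Real.rpow_mul hε.le, one_div_mul_cancel (by linarith), Real.rpow_one] at h1
    have h2 : x ^ θ = x ^ (θ - 1) * x := by
      rw [← Real.rpow_add_one hx0.ne', sub_add_cancel]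
    have h3 : 0 ≤ X ^ θ := by positivity
    rw [h2]
    nlinarith

theorem sqrt_sq_add_one_sub_le (x y : ℝ) : √(x ^ 2 + 1) ≤ √(y ^ 2 + 1) + |x - y| := by
  rw [Real.sqrt_le_left (by positivity)]
  have h1 : |y| ≤ √(y ^ 2 + 1) := Real.abs_le_sqrt (by linarith)
  have h2 : √(y ^ 2 + 1) ^ 2 = y ^ 2 + 1 := Real.sq_sqrt (by positivity)
  have h3 : (x - y) ^ 2 = |x - y| ^ 2 := (sq_abs _).symm
  have h4 : y * (x - y) ≤ |y| * |x - y| := by rw [← abs_mul]; exact le_abs_self _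
  have h5 := mul_le_mul_of_nonneg_right h1 (abs_nonneg (x - y))
  nlinarith

theorem abs_le_sqrt_sq_add_one (x : ℝ) : |x| ≤ √(x ^ 2 + 1) := Real.abs_le_sqrt (by linarith)

theorem one_le_sqrt_sq_add_one (x : ℝ) : 1 ≤ √(x ^ 2 + 1) :=
  Real.one_le_sqrt.2 (by nlinarith [sq_nonneg x])

theorem sqrt_sq_add_one_le (x : ℝ) : √(x ^ 2 + 1) ≤ |x| + 1 := by
  have := sqrt_sq_add_one_sub_le x 0
  simp only [ne_eq, OfNat.ofNat_ne_zero, not_false_eq_true, zero_pow, zero_add, Real.sqrt_one,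
    sub_zero] at this
  linarith

/-- A positive zero of the derivative of an energy along a ray. -/
theorem exists_ray_zero {s t a b x L : ℝ} (hs : 2 < s) (ht : 2 < t) (ha : 0 ≤ a) (hb : 0 ≤ b)
    (hab : 0 < a + b) (hx : 0 < x) (hL : L ≤ 0) :
    ∃ τ : ℝ, 0 < τ ∧ τ ^ 2 * x - (τ ^ s * a + τ ^ t * b) - τ * L = 0 := by
  set m := min s t with hm
  have hm2 : 0 < m - 2 := by
    have : 2 < m := lt_min hs ht
    linarith
  have e : ∀ τ : ℝ, 0 < τ → ∀ p : ℝ, τ ^ p = τ ^ 2 * τ ^ (p - 2) := fun τ hτ p => by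
    rw [← Real.rpow_two, ← Real.rpow_add hτ]; congr 1; ring
  -- small parameters
  have h0 : Tendsto (fun τ : ℝ => τ ^ (m - 2)) (𝓝 0) (𝓝 0) := by
    have := (Real.continuousAt_rpow_const 0 (m - 2) (Or.inr hm2.le)).tendsto
    rwa [Real.zero_rpow hm2.ne'] at this
  obtain ⟨d, hd, hd'⟩ := Metric.eventually_nhds_iff.1
    (h0.eventually (gt_mem_nhds (div_pos hx hab)))
  set τ₁ := min (d / 2) 1 with hτ₁
  have h1pos : 0 < τ₁ := lt_min (by linarith) one_pos
  have h1le : τ₁ ≤ 1 := min_le_right _ _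
  have hsmall : 0 ≤ τ₁ ^ 2 * x - (τ₁ ^ s * a + τ₁ ^ t * b) - τ₁ * L := by
    have h2 : τ₁ ^ (m - 2) < x / (a + b) := hd' (by
      rw [Real.dist_eq, sub_zero, abs_of_pos h1pos]
      exact (min_le_left _ _).trans_lt (by linarith))
    rw [lt_div_iff₀ hab] at h2
    have h3 : τ₁ ^ (s - 2) ≤ τ₁ ^ (m - 2) :=
      Real.rpow_le_rpow_of_exponent_ge h1pos h1le (by linarith [min_le_left s t])
    have h4 : τ₁ ^ (t - 2) ≤ τ₁ ^ (m - 2) :=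
      Real.rpow_le_rpow_of_exponent_ge h1pos h1le (by linarith [min_le_right s t])
    have h5 : τ₁ ^ (s - 2) * a + τ₁ ^ (t - 2) * b ≤ x := by nlinarith
    rw [e τ₁ h1pos s, e τ₁ h1pos t]
    nlinarith [mul_nonneg (sq_nonneg τ₁) (sub_nonneg.2 h5), mul_nonneg h1pos.le (neg_nonneg.2 hL)]
  obtain ⟨τ₂, h2ge, h2big⟩ := (((tendsto_rpow_atTop hm2).eventually_ge_atTop
    ((x - L) / (a + b))).and (eventually_ge_atTop 1)).exists
  have h2pos : 0 < τ₂ := by linarith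
  have hbig : τ₂ ^ 2 * x - (τ₂ ^ s * a + τ₂ ^ t * b) - τ₂ * L ≤ 0 := by
    rw [div_le_iff₀ hab] at h2ge
    have h3 : τ₂ ^ (m - 2) ≤ τ₂ ^ (s - 2) :=
      Real.rpow_le_rpow_of_exponent_le h2big (by linarith [min_le_left s t])
    have h4 : τ₂ ^ (m - 2) ≤ τ₂ ^ (t - 2) :=
      Real.rpow_le_rpow_of_exponent_le h2big (by linarith [min_le_right s t])
    have h5 : x - L ≤ τ₂ ^ (s - 2) * a + τ₂ ^ (t - 2) * b := by nlinarith
    rw [e τ₂ h2pos s, e τ₂ h2pos t]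
    nlinarith [mul_nonneg (sq_nonneg τ₂) (sub_nonneg.2 h5),
      mul_nonneg (mul_nonneg h2pos.le (sub_nonneg.2 h2big)) (neg_nonneg.2 hL)]
  have hcont : ContinuousOn (fun τ : ℝ => τ ^ 2 * x - (τ ^ s * a + τ ^ t * b) - τ * L)
      (Icc τ₁ τ₂) := by
    have c1 := Real.continuous_rpow_const (q := s) (by linarith)
    have c2 := Real.continuous_rpow_const (q := t) (by linarith)
    fun_prop
  obtain ⟨τ, hτ, h⟩ := intermediate_value_Icc' (h1le.trans h2big) hcont ⟨hbig, hsmall⟩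
  exact ⟨τ, h1pos.trans_le hτ.1, h⟩

/-- If the energy along a ray is almost critical at `1`, a bound which holds at all critical points
of the ray holds at `1` with twice the constant. -/
theorem exists_ray_bound {s t A : ℝ} (hs : 2 < s) (ht : 2 < t) (hA : 0 < A) :
    ∃ ε : ℝ, 0 < ε ∧ ε ≤ 1 / 2 ∧ ∀ a b x L : ℝ, 0 ≤ a → 0 ≤ b → 0 < a + b →
      |x - (a + b)| ≤ ε * (a + b) → |L| ≤ ε * (a + b) →
      (∀ τ : ℝ, 0 < τ → τ ^ 2 * x - (τ ^ s * a + τ ^ t * b) - τ * L = 0 →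
        τ ^ s * (a / s) + τ ^ t * (b / t) ≤
          A * √((1 / 2 * (τ ^ 2 * x) - (τ ^ s * (a / s) + τ ^ t * (b / t)) - τ * L) ^ 2 + 1)) →
      a / s + b / t ≤ 2 * A * √((1 / 2 * x - (a / s + b / t) - L) ^ 2 + 1) := by
  set M := max s t with hM
  have hM0 : 0 < M := lt_max_of_lt_left (by linarith)
  -- Passing from τ to 1 costs κp₁ in the potential and at most 3κMp₁ in the energy, where p₁ is the
  -- potential at 1. This κ makes the total loss κp₁ + A·3κMp₁ equal to p₁/2, which is absorbed on
  -- the left and produces the factor 2 in the conclusion.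
  set κ := 1 / (2 * (1 + 3 * A * M)) with hκ
  have hκ0 : 0 < κ := by positivity
  have hκ1 : κ * (1 + 3 * A * M) = 1 / 2 := by rw [hκ]; field_simp
  have hnear : ∀ p : ℝ, ∀ᶠ τ : ℝ in 𝓝 1, |τ ^ p - 1| ≤ κ := fun p => by
    have h := (Real.continuousAt_rpow_const 1 p (Or.inl one_ne_zero)).tendsto
    rw [Real.one_rpow] at h
    filter_upwards [h (Metric.closedBall_mem_nhds 1 hκ0)] with τ hτ
    exact hτ
  obtain ⟨d, hd, hd'⟩ := Metric.eventually_nhds_iff.1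
    (((hnear s).and (hnear t)).and ((hnear 2).and (hnear 1)))
  set η := min (d / 2) (1 / 2) with hη
  have hη0 : 0 < η := lt_min (by linarith) (by norm_num)
  have hη1 : η ≤ 1 / 2 := min_le_right _ _
  have hηd : η < d := (min_le_left _ _).trans_lt (by linarith)
  set τ₁ := 1 - η with hτ₁
  set τ₂ := 1 + η with hτ₂
  have h1pos : 0 < τ₁ := by linarith
  have hd1 : ∀ p : ℝ, 2 < p → τ₁ ^ p < τ₁ ^ 2 := fun p hp => by
    rw [← Real.rpow_two]
    exact Real.rpow_lt_rpow_of_exponent_gt h1pos (by linarith) hp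
  have hd2 : ∀ p : ℝ, 2 < p → τ₂ ^ 2 < τ₂ ^ p := fun p hp => by
    rw [← Real.rpow_two]
    exact Real.rpow_lt_rpow_of_exponent_lt (by linarith) hp
  -- The unperturbed function τ²(a+b) - τ^s a - τ^t b is at least ρ(a+b) at τ₁ < 1 and at most
  -- -ρ(a+b) at τ₂ > 1. The deviations of `x` from a + b and of `L` from 0 contribute at most
  -- 6ε(a+b), so with ε ≤ ρ/8 the sign change persists and gives a zero τ near 1.
  set ρ := min (min (τ₁ ^ 2 - τ₁ ^ s) (τ₁ ^ 2 - τ₁ ^ t)) (min (τ₂ ^ s - τ₂ ^ 2) (τ₂ ^ t - τ₂ ^ 2))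
    with hρ
  have hρ0 : 0 < ρ := lt_min (lt_min (sub_pos.2 (hd1 s hs)) (sub_pos.2 (hd1 t ht)))
    (lt_min (sub_pos.2 (hd2 s hs)) (sub_pos.2 (hd2 t ht)))
  have r1 : ρ ≤ τ₁ ^ 2 - τ₁ ^ s := (min_le_left _ _).trans (min_le_left _ _)
  have r2 : ρ ≤ τ₁ ^ 2 - τ₁ ^ t := (min_le_left _ _).trans (min_le_right _ _)
  have r3 : ρ ≤ τ₂ ^ s - τ₂ ^ 2 := (min_le_right _ _).trans (min_le_left _ _)
  have r4 : ρ ≤ τ₂ ^ t - τ₂ ^ 2 := (min_le_right _ _).trans (min_le_right _ _)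
  refine ⟨min (1 / 2) (ρ / 8), lt_min (by norm_num) (by positivity), min_le_left _ _,
    fun a b x L ha hb hab hx hL hcrit => ?_⟩
  set ε := min (1 / 2) (ρ / 8) with hε
  have he1 : ε ≤ 1 / 2 := min_le_left _ _
  have he2 : ε ≤ ρ / 8 := min_le_right _ _
  have he0 : 0 < ε := lt_min (by norm_num) (by positivity)
  have hx' := abs_le.1 hx
  have hL' := abs_le.1 hL
  have hcont : ContinuousOn (fun τ : ℝ => τ ^ 2 * x - (τ ^ s * a + τ ^ t * b) - τ * L)
      (Icc τ₁ τ₂) := by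
    have c1 := Real.continuous_rpow_const (q := s) (by linarith)
    have c2 := Real.continuous_rpow_const (q := t) (by linarith)
    fun_prop
  have hσε : 0 ≤ ε * (a + b) := by positivity
  have hσρ : ε * (a + b) ≤ ρ / 8 * (a + b) := mul_le_mul_of_nonneg_right he2 hab.le
  have hlow : 0 ≤ τ₁ ^ 2 * x - (τ₁ ^ s * a + τ₁ ^ t * b) - τ₁ * L := by
    have u0 : τ₁ ≤ 1 := by linarith
    have u1 : τ₁ ^ 2 ≤ 1 := pow_le_one₀ h1pos.le u0
    have u2 : τ₁ ^ 2 * ((a + b) - x) ≤ ε * (a + b) :=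
      (mul_le_mul_of_nonneg_left (by linarith) (sq_nonneg τ₁)).trans (mul_le_of_le_one_left hσε u1)
    have u3 : τ₁ * L ≤ ε * (a + b) :=
      (mul_le_mul_of_nonneg_left hL'.2 h1pos.le).trans (mul_le_of_le_one_left hσε u0)
    have u5 := mul_le_mul_of_nonneg_right r1 ha
    have u6 := mul_le_mul_of_nonneg_right r2 hb
    have u7 : 0 ≤ ρ * (a + b) := by positivity
    linarith
  have hup : τ₂ ^ 2 * x - (τ₂ ^ s * a + τ₂ ^ t * b) - τ₂ * L ≤ 0 := by
    have u0 : 0 ≤ τ₂ := by linarith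
    have u0' : τ₂ ≤ 2 := by linarith
    have u1 : τ₂ ^ 2 ≤ 4 := (pow_le_pow_left₀ u0 u0' 2).trans (by norm_num)
    have u2 : τ₂ ^ 2 * (x - (a + b)) ≤ 4 * (ε * (a + b)) :=
      (mul_le_mul_of_nonneg_left hx'.2 (sq_nonneg τ₂)).trans (mul_le_mul_of_nonneg_right u1 hσε)
    have u3 : τ₂ * -L ≤ 2 * (ε * (a + b)) :=
      (mul_le_mul_of_nonneg_left (by linarith) u0).trans (mul_le_mul_of_nonneg_right u0' hσε)
    have u5 := mul_le_mul_of_nonneg_right r3 ha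
    have u6 := mul_le_mul_of_nonneg_right r4 hb
    have u7 : 0 ≤ ρ * (a + b) := by positivity
    linarith
  obtain ⟨τ, hτ, hzero⟩ := intermediate_value_Icc' (by linarith : τ₁ ≤ τ₂) hcont ⟨hup, hlow⟩
  have hτ0 : 0 < τ := h1pos.trans_le hτ.1
  have hdist : |τ - 1| ≤ η := abs_le.2 ⟨by linarith [hτ.1], by linarith [hτ.2]⟩
  obtain ⟨⟨n1, n2⟩, n3, n4⟩ := hd' (y := τ) (by rw [Real.dist_eq]; linarith)
  rw [Real.rpow_two] at n3
  rw [Real.rpow_one] at n4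
  have hb1 := hcrit τ hτ0 hzero
  set p₁ := a / s + b / t with hp₁
  set pτ := τ ^ s * (a / s) + τ ^ t * (b / t) with hpτ
  have has : 0 ≤ a / s := div_nonneg ha (by linarith)
  have hbt : 0 ≤ b / t := div_nonneg hb (by linarith)
  have hsig : a + b ≤ M * p₁ := by
    have v1 : a ≤ M * (a / s) := by
      rw [mul_div_assoc', le_div_iff₀ (by linarith), mul_comm]
      exact mul_le_mul_of_nonneg_right (le_max_left _ _) ha
    have v2 : b ≤ M * (b / t) := by
      rw [mul_div_assoc', le_div_iff₀ (by linarith), mul_comm]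
      exact mul_le_mul_of_nonneg_right (le_max_right _ _) hb
    rw [hp₁, mul_add]
    linarith
  have hp1le : p₁ ≤ a + b := by
    have v1 : a / s ≤ a := div_le_self ha (by linarith)
    have v2 : b / t ≤ b := div_le_self hb (by linarith)
    linarith
  have hdiffp : |pτ - p₁| ≤ κ * p₁ := by
    have e : pτ - p₁ = (τ ^ s - 1) * (a / s) + (τ ^ t - 1) * (b / t) := by rw [hpτ, hp₁]; ring
    rw [e, hp₁, mul_add]
    refine (abs_add_le _ _).trans (add_le_add ?_ ?_)
    · rw [abs_mul, abs_of_nonneg has]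
      exact mul_le_mul_of_nonneg_right n1 has
    · rw [abs_mul, abs_of_nonneg hbt]
      exact mul_le_mul_of_nonneg_right n2 hbt
  have hdiff : |1 / 2 * (τ ^ 2 * x) - pτ - τ * L - (1 / 2 * x - p₁ - L)| ≤ 3 * κ * (a + b) := by
    have e : 1 / 2 * (τ ^ 2 * x) - pτ - τ * L - (1 / 2 * x - p₁ - L) =
        1 / 2 * ((τ ^ 2 - 1) * x) - (pτ - p₁) - (τ - 1) * L := by ring
    have w1 : |(τ ^ 2 - 1) * x| ≤ κ * (2 * (a + b)) := by
      rw [abs_mul]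
      refine mul_le_mul n3 ?_ (abs_nonneg _) hκ0.le
      have w0 : ε * (a + b) ≤ 1 / 2 * (a + b) := mul_le_mul_of_nonneg_right he1 hab.le
      rw [abs_le]
      constructor <;> linarith
    have w2 : |(τ - 1) * L| ≤ κ * (1 / 2 * (a + b)) := by
      rw [abs_mul]
      exact mul_le_mul n4 (hL.trans (by gcongr)) (abs_nonneg _) hκ0.le
    have w3 : κ * p₁ ≤ κ * (a + b) := by gcongr
    rw [e]
    have w4 := abs_le.1 w1
    have w5 := abs_le.1 w2
    have w6 := abs_le.1 hdiffp
    have w7 : 0 ≤ κ * (a + b) := by positivity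
    rw [abs_le]
    constructor <;> linarith
  have hfin := sqrt_sq_add_one_sub_le (1 / 2 * (τ ^ 2 * x) - pτ - τ * L) (1 / 2 * x - p₁ - L)
  have hp1 : 0 ≤ p₁ := by positivity
  have f1 : pτ ≤ A * (√((1 / 2 * x - p₁ - L) ^ 2 + 1) + 3 * κ * (M * p₁)) := by
    refine hb1.trans (mul_le_mul_of_nonneg_left (hfin.trans ?_) hA.le)
    have : 3 * κ * (a + b) ≤ 3 * κ * (M * p₁) := by gcongr
    linarith
  have f2 := (abs_le.1 hdiffp).1
  have f3 : κ * p₁ + A * (3 * κ * (M * p₁)) = 1 / 2 * p₁ := by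
    rw [← hκ1]; ring
  linarith

end RealLemmas

/-! ### Elementary properties of the cut-off -/

section CutoffLemmas

variable {χ : ℝ → ℝ}

theorem IsCutoff.deriv_eq_zero_of_le (h : IsCutoff χ) {t : ℝ} (ht : t ≤ 1) : deriv χ t = 0 := by
  have hc : Continuous (deriv χ) := h.smooth.continuous_deriv (by simp)
  have hcl : IsClosed {t | deriv χ t = 0} := isClosed_eq hc continuous_const
  have hsub : Iio (1 : ℝ) ⊆ {t | deriv χ t = 0} := fun u hu => by
    have : χ =ᶠ[𝓝 u] fun _ => 1 := by
      filter_upwards [Iio_mem_nhds hu] with y hy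
      exact h.eq_one y (le_of_lt hy)
    change deriv χ u = 0
    rw [this.deriv_eq, deriv_const]
  have := hcl.closure_subset_iff.2 hsub
  rw [closure_Iio] at this
  exact this ht

theorem IsCutoff.deriv_eq_zero_of_ge (h : IsCutoff χ) {t : ℝ} (ht : 2 ≤ t) : deriv χ t = 0 := by
  have hc : Continuous (deriv χ) := h.smooth.continuous_deriv (by simp)
  have hcl : IsClosed {t | deriv χ t = 0} := isClosed_eq hc continuous_const
  have hsub : Ioi (2 : ℝ) ⊆ {t | deriv χ t = 0} := fun u hu => by
    have : χ =ᶠ[𝓝 u] fun _ => 0 := by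
      filter_upwards [Ioi_mem_nhds hu] with y hy
      exact h.eq_zero y (le_of_lt hy)
    change deriv χ u = 0
    rw [this.deriv_eq, deriv_const]
  have := hcl.closure_subset_iff.2 hsub
  rw [closure_Ioi] at this
  exact this ht

theorem IsCutoff.abs_deriv_le (h : IsCutoff χ) (t : ℝ) : |deriv χ t| ≤ 2 := by
  rcases le_or_gt t 1 with h1 | h1
  · simp [h.deriv_eq_zero_of_le h1]
  rcases le_or_gt 2 t with h2 | h2
  · simp [h.deriv_eq_zero_of_ge h2]
  have := h.deriv_mem t h1 h2
  rw [abs_le]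
  constructor <;> linarith

theorem IsCutoff.mem_Icc (h : IsCutoff χ) (t : ℝ) : χ t ∈ Icc (0 : ℝ) 1 := by
  rcases le_or_gt t 1 with h1 | h1
  · simp [h.eq_one t h1]
  rcases le_or_gt 2 t with h2 | h2
  · simp [h.eq_zero t h2]
  have hanti : AntitoneOn χ (Icc 1 2) := by
    refine antitoneOn_of_deriv_nonpos (convex_Icc _ _) h.smooth.continuous.continuousOn
      (h.smooth.differentiable (by simp)).differentiableOn fun u hu => ?_
    rw [interior_Icc] at hu
    exact (h.deriv_mem u hu.1 hu.2).2.le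
  have ht : t ∈ Icc (1 : ℝ) 2 := ⟨h1.le, h2.le⟩
  constructor
  · rw [← h.eq_zero 2 le_rfl]
    exact hanti ht ⟨one_le_two, le_rfl⟩ h2.le
  · rw [← h.eq_one 1 le_rfl]
    exact hanti ⟨le_rfl, one_le_two⟩ ht h1.le

end CutoffLemmas

end HamiltonianSystem

namespace HamiltonianSystem

/-! ### The functionals I and J on a Hilbert space -/

section AbstractFunctionals

variable {E : Type*} [NormedAddCommGroup E] [InnerProductSpace ℝ E]

/-- A potential `P` with two powers `s` and `t`, subquadratic duality estimates, and a compact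
derivative. -/
structure IsPowerPotential (P : E → ℝ) (s t : ℝ) : Prop where
  contDiff : ContDiff ℝ 1 P
  two_lt_left : 2 < s
  two_lt_right : 2 < t
  even : ∀ w, P (-w) = P w
  ray : ∀ w, ∃ a b : ℝ, 0 ≤ a ∧ 0 ≤ b ∧ ∀ τ : ℝ, 0 < τ →
    P (τ • w) = τ ^ s * (a / s) + τ ^ t * (b / t) ∧
    fderiv ℝ P (τ • w) (τ • w) = τ ^ s * a + τ ^ t * b
  growth : ∀ δ : ℝ, 0 < δ → ∃ C : ℝ, 0 ≤ C ∧ ∀ w z, |fderiv ℝ P w z| ≤ (δ * P w + C) * ‖z‖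
  compact : ∀ w : ℕ → E, (∃ R, ∀ n, ‖w n‖ ≤ R) → ∃ (G : E →L[ℝ] ℝ) (σ : ℕ → ℕ), StrictMono σ ∧
    Tendsto (fun n => fderiv ℝ P (w (σ n))) atTop (𝓝 G)

/-- `I(w) = ½ (S w, w) - P(w) - ℓ(w)`. -/
noncomputable def energyI (S : E →L[ℝ] E) (P : E → ℝ) (ℓ : E →L[ℝ] ℝ) (w : E) : ℝ :=
  1 / 2 * inner ℝ (S w) w - P w - ℓ w

/-- `Q(w) = 2 A √(I(w)² + 1)`. -/
noncomputable def energyQ (S : E →L[ℝ] E) (P : E → ℝ) (ℓ : E →L[ℝ] ℝ) (A : ℝ) (w : E) : ℝ :=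
  2 * A * √(energyI S P ℓ w ^ 2 + 1)

/-- `P(w) / Q(w)`. -/
noncomputable def cutoffRatio (S : E →L[ℝ] E) (P : E → ℝ) (ℓ : E →L[ℝ] ℝ) (A : ℝ) (w : E) : ℝ :=
  1 / energyQ S P ℓ A w * P w

/-- `J(w) = ½ (S w, w) - P(w) - χ(P(w) / Q(w)) ℓ(w)`. -/
noncomputable def energyJ (S : E →L[ℝ] E) (P : E → ℝ) (ℓ : E →L[ℝ] ℝ) (A : ℝ) (χ : ℝ → ℝ)
    (w : E) : ℝ :=
  1 / 2 * inner ℝ (S w) w - P w - χ (cutoffRatio S P ℓ A w) * ℓ w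

/-- `A` is admissible: `P ≤ A √(I² + 1)` where `I'(w) w = 0`. -/
def IsAdmissible (S : E →L[ℝ] E) (P : E → ℝ) (ℓ : E →L[ℝ] ℝ) (A : ℝ) : Prop :=
  ∀ w : E, fderiv ℝ (energyI S P ℓ) w w = 0 → P w ≤ A * √(energyI S P ℓ w ^ 2 + 1)

/-- The correction `T₁` in the derivative of `J`. -/
noncomputable def corrOne (S : E →L[ℝ] E) (P : E → ℝ) (ℓ : E →L[ℝ] ℝ) (A : ℝ) (χ : ℝ → ℝ)
    (w : E) : ℝ :=
  deriv χ (cutoffRatio S P ℓ A w) * ℓ w * (2 * A * energyI S P ℓ w / energyQ S P ℓ A w) *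
    (2 * A / energyQ S P ℓ A w) * cutoffRatio S P ℓ A w

/-- The correction `T₂` in the derivative of `J`. -/
noncomputable def corrTwo (S : E →L[ℝ] E) (P : E → ℝ) (ℓ : E →L[ℝ] ℝ) (A : ℝ) (χ : ℝ → ℝ)
    (w : E) : ℝ :=
  corrOne S P ℓ A χ w + deriv χ (cutoffRatio S P ℓ A w) * ℓ w / energyQ S P ℓ A w

variable {S : E →L[ℝ] E} {P : E → ℝ} {s t : ℝ} {ℓ : E →L[ℝ] ℝ} {A : ℝ} {χ : ℝ → ℝ}

theorem IsPowerPotential.ray_one (hP : IsPowerPotential P s t) (w : E) : ∃ a b : ℝ, 0 ≤ a ∧ 0 ≤ b ∧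
    P w = a / s + b / t ∧ fderiv ℝ P w w = a + b ∧ ∀ τ : ℝ, 0 < τ →
    P (τ • w) = τ ^ s * (a / s) + τ ^ t * (b / t) ∧
    fderiv ℝ P (τ • w) (τ • w) = τ ^ s * a + τ ^ t * b := by
  obtain ⟨a, b, ha, hb, h⟩ := hP.ray w
  have h1 := h 1 one_pos
  simp only [one_smul, Real.one_rpow, one_mul] at h1
  exact ⟨a, b, ha, hb, h1.1, h1.2, h⟩

theorem IsPowerPotential.nonneg (hP : IsPowerPotential P s t) (w : E) : 0 ≤ P w := by
  obtain ⟨a, b, ha, hb, h, -⟩ := hP.ray_one w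
  rw [h]
  exact add_nonneg (div_nonneg ha (by linarith [hP.two_lt_left]))
    (div_nonneg hb (by linarith [hP.two_lt_right]))

/-- The Ambrosetti-Rabinowitz condition; that its exponent exceeds 2 is what bounds P in terms of I
or J. -/
theorem IsPowerPotential.min_mul_le (hP : IsPowerPotential P s t) (w : E) :
    min s t * P w ≤ fderiv ℝ P w w := by
  obtain ⟨a, b, ha, hb, h, h', -⟩ := hP.ray_one w
  have hs := hP.two_lt_left
  have ht := hP.two_lt_right
  have e1 : min s t * (a / s) ≤ a := by
    rw [mul_div_assoc', div_le_iff₀ (by linarith), mul_comm]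
    exact mul_le_mul_of_nonneg_left (min_le_left _ _) ha
  have e2 : min s t * (b / t) ≤ b := by
    rw [mul_div_assoc', div_le_iff₀ (by linarith), mul_comm]
    exact mul_le_mul_of_nonneg_left (min_le_right _ _) hb
  rw [h, h', mul_add]
  linarith

theorem IsPowerPotential.two_lt_min (hP : IsPowerPotential P s t) : 2 < min s t :=
  lt_min hP.two_lt_left hP.two_lt_right

theorem IsPowerPotential.differentiableAt (hP : IsPowerPotential P s t) (w : E) :
    DifferentiableAt ℝ P w := (hP.contDiff.differentiable one_ne_zero) w

/-- The form `|ℓ| ≤ K (P^{1/s} + P^{1/t})` of a perturbation of lower order. -/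
def IsLowerOrder (P : E → ℝ) (s t K : ℝ) (ℓ : E →L[ℝ] ℝ) : Prop :=
  ∀ w, |ℓ w| ≤ K * (P w ^ (1 / s) + P w ^ (1 / t))

/-- The powers 1/s and 1/t are less than 1, so ℓ is absorbed by any small multiple of P. The
constant is chosen before ℓ and sees it only through K; this makes the later levels uniform in h and
k of given norms. -/
theorem IsPowerPotential.exists_lowerOrder_bound (hP : IsPowerPotential P s t) {K : ℝ}
    (hK : 0 ≤ K) {ε : ℝ} (hε : 0 < ε) : ∃ C : ℝ, 0 ≤ C ∧ ∀ ℓ : E →L[ℝ] ℝ,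
      IsLowerOrder P s t K ℓ → ∀ w, |ℓ w| ≤ ε * P w + C := by
  have hs := hP.two_lt_left
  have ht := hP.two_lt_right
  have hε' : 0 < ε / (2 * (K + 1)) := by positivity
  obtain ⟨C₁, hC₁, h₁⟩ := exists_rpow_le_mul_add (θ := 1 / s) (by positivity)
    ((div_lt_one (by linarith)).2 (by linarith)) hε'
  obtain ⟨C₂, hC₂, h₂⟩ := exists_rpow_le_mul_add (θ := 1 / t) (by positivity)
    ((div_lt_one (by linarith)).2 (by linarith)) hε'
  refine ⟨K * (C₁ + C₂), by positivity, fun ℓ hℓ w => (hℓ w).trans ?_⟩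
  have hPw := hP.nonneg w
  have h3 : P w ^ (1 / s) + P w ^ (1 / t) ≤ 2 * (ε / (2 * (K + 1))) * P w + (C₁ + C₂) := by
    linarith [h₁ _ hPw, h₂ _ hPw]
  refine (mul_le_mul_of_nonneg_left h3 hK).trans ?_
  have h4 : K * (2 * (ε / (2 * (K + 1)))) ≤ ε := by
    rw [show K * (2 * (ε / (2 * (K + 1)))) = ε * (K / (K + 1)) by field_simp]
    exact mul_le_of_le_one_right hε.le ((div_le_one (by linarith)).2 (by linarith))
  nlinarith [mul_le_mul_of_nonneg_right h4 hPw]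

theorem contDiff_quadratic (S : E →L[ℝ] E) : ContDiff ℝ 1 fun w => 1 / 2 * inner ℝ (S w) w :=
  contDiff_const.mul (S.contDiff.inner ℝ contDiff_id)

theorem hasFDerivAt_quadratic (hS : ∀ x y, inner ℝ (S x) y = inner ℝ x (S y)) (w : E) :
    HasFDerivAt (fun w => 1 / 2 * inner ℝ (S w) w) (innerSL ℝ (S w)) w := by
  have h := ((S.hasFDerivAt (x := w)).inner ℝ (hasFDerivAt_id w)).const_mul (1 / 2 : ℝ)
  refine h.congr_fderiv ?_
  ext z
  simp only [id_eq, smul_apply, ContinuousLinearMap.comp_apply,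
    ContinuousLinearMap.prod_apply, fderivInnerCLM_apply, ContinuousLinearMap.id_apply, smul_eq_mul,
    innerSL_apply_apply]
  rw [hS z w, real_inner_comm]
  ring

theorem hasFDerivAt_energyI (hP : IsPowerPotential P s t)
    (hS : ∀ x y, inner ℝ (S x) y = inner ℝ x (S y)) (w : E) :
    HasFDerivAt (energyI S P ℓ) (innerSL ℝ (S w) - fderiv ℝ P w - ℓ) w :=
  ((hasFDerivAt_quadratic hS w).sub (hP.differentiableAt w).hasFDerivAt).sub ℓ.hasFDerivAt

theorem fderiv_energyI_apply (hP : IsPowerPotential P s t)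
    (hS : ∀ x y, inner ℝ (S x) y = inner ℝ x (S y)) (w z : E) :
    fderiv ℝ (energyI S P ℓ) w z = inner ℝ (S w) z - fderiv ℝ P w z - ℓ z := by
  rw [(hasFDerivAt_energyI hP hS w).fderiv]
  rfl

theorem contDiff_energyI (hP : IsPowerPotential P s t) : ContDiff ℝ 1 (energyI S P ℓ) :=
  ((contDiff_quadratic S).sub hP.contDiff).sub ℓ.contDiff

theorem energyQ_pos (hA : 0 < A) (w : E) : 0 < energyQ S P ℓ A w := by
  rw [energyQ]
  positivity

theorem contDiff_energyJ (hP : IsPowerPotential P s t) (hA : 0 < A) (hχ : IsCutoff χ) :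
    ContDiff ℝ 1 (energyJ S P ℓ A χ) := by
  have hI : ContDiff ℝ 1 (energyI S P ℓ) := contDiff_energyI hP
  have hQ : ContDiff ℝ 1 (energyQ S P ℓ A) :=
    contDiff_const.mul (((hI.pow 2).add contDiff_const).sqrt fun w => by positivity)
  have hθ : ContDiff ℝ 1 (cutoffRatio S P ℓ A) :=
    (contDiff_const.div hQ fun w => (energyQ_pos hA w).ne').mul hP.contDiff
  exact ((contDiff_quadratic S).sub hP.contDiff).sub
    (((hχ.smooth.of_le (by simp)).comp hθ).mul ℓ.contDiff)

/-- Differentiating -χ(P/Q)ℓ through Q produces a multiple of I', because Q is a function of I; this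
multiple is T₁. Differentiating through P produces -(χ'ℓ/Q)P', where χ'ℓ/Q = T₂ - T₁. Inserting I' =
Sw - P' - ℓ collects the terms. -/
theorem fderiv_energyJ_apply (hP : IsPowerPotential P s t) (hA : 0 < A) (hχ : IsCutoff χ)
    (hS : ∀ x y, inner ℝ (S x) y = inner ℝ x (S y)) (w z : E) :
    fderiv ℝ (energyJ S P ℓ A χ) w z = (1 + corrOne S P ℓ A χ w) * inner ℝ (S w) z -
      (1 + corrTwo S P ℓ A χ w) * fderiv ℝ P w z -
      (χ (cutoffRatio S P ℓ A w) + corrOne S P ℓ A χ w) * ℓ z := by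
  have hI : HasFDerivAt (energyI S P ℓ) _ w := hasFDerivAt_energyI hP hS w
  have hPd := (hP.differentiableAt w).hasFDerivAt
  have hQ0 := energyQ_pos (S := S) (P := P) (ℓ := ℓ) hA w
  have hR0 : 0 < √(energyI S P ℓ w ^ 2 + 1) := by positivity
  have hQ : HasFDerivAt (energyQ S P ℓ A) _ w :=
    (((hI.pow 2).add_const 1).sqrt (by positivity)).const_mul (2 * A)
  have hθ : HasFDerivAt (cutoffRatio S P ℓ A) _ w :=
    (((hasDerivAt_inv hQ0.ne').comp_hasFDerivAt w hQ).const_mul 1).mul hPd |>.congr_of_eventuallyEq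
      (Eventually.of_forall fun y => by simp [cutoffRatio])
  have hχd : HasDerivAt χ _ (cutoffRatio S P ℓ A w) :=
    (hχ.smooth.differentiable (by simp) _).hasDerivAt
  have hJ : HasFDerivAt (energyJ S P ℓ A χ) _ w :=
    ((hasFDerivAt_quadratic hS w).sub hPd).sub ((hχd.comp_hasFDerivAt w hθ).mul ℓ.hasFDerivAt)
  rw [hJ.fderiv]
  have hQR : energyQ S P ℓ A w = 2 * A * √(energyI S P ℓ w ^ 2 + 1) := rfl
  simp only [sub_apply, add_apply, smul_apply,
    smul_eq_mul, innerSL_apply_apply, Function.comp_apply, corrTwo, corrOne, cutoffRatio]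
  rw [hQR]
  field_simp
  ring

end AbstractFunctionals

end HamiltonianSystem

namespace HamiltonianSystem

/-! ### Admissible constants, almost evenness and critical points at high levels -/

section AbstractEstimates

variable {E : Type*} [NormedAddCommGroup E] [InnerProductSpace ℝ E]
variable {S : E →L[ℝ] E} {P : E → ℝ} {s t A K : ℝ} {χ : ℝ → ℝ}

/-- If I'(w)w = 0, then I(w) = ½P'(w)w - P(w) - ½ℓ(w) ≥ (m/2 - 1)P(w) - ½|ℓ(w)| with m = min(s, t) >
2. Half of the coefficient of P absorbs ℓ. -/
theorem exists_isAdmissible (hP : IsPowerPotential P s t)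
    (hS : ∀ x y, inner ℝ (S x) y = inner ℝ x (S y)) (hK : 0 ≤ K) :
    ∃ A : ℝ, 0 < A ∧ ∀ ℓ : E →L[ℝ] ℝ, IsLowerOrder P s t K ℓ → IsAdmissible S P ℓ A := by
  set m := min s t with hm
  have hm2 : 2 < m := hP.two_lt_min
  set c := (m / 2 - 1) / 2 with hc
  have hc0 : 0 < c := by linarith
  obtain ⟨C, hC, hb⟩ := hP.exists_lowerOrder_bound hK (ε := 2 * c) (by linarith)
  refine ⟨(1 + C) / c, by positivity, fun ℓ hℓ w hw => ?_⟩
  rw [fderiv_energyI_apply hP hS] at hw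
  have h1 := hP.min_mul_le w
  have h2 := abs_le.1 (hb ℓ hℓ w)
  have h3 : c * P w ≤ energyI S P ℓ w + C := by
    rw [energyI]
    have : c * P w * 2 = (m / 2 - 1) * P w := by rw [hc]; ring
    linarith
  have h4 := abs_le_sqrt_sq_add_one (energyI S P ℓ w)
  have h5 := one_le_sqrt_sq_add_one (energyI S P ℓ w)
  have h6 := le_abs_self (energyI S P ℓ w)
  rw [div_mul_eq_mul_div, le_div_iff₀ hc0]
  nlinarith

/-- It suffices to find one point with I'(w)w = 0 and P(w) > 0. Along a ray with (Sw, w) > 0 and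
ℓ(w) ≤ 0 the quadratic term wins for small τ and P for large τ, so the derivative has a zero;
evenness of P and of the quadratic form lets the sign of ℓ be chosen. -/
theorem IsAdmissible.pos {ℓ : E →L[ℝ] ℝ} (hA : IsAdmissible S P ℓ A) (hP : IsPowerPotential P s t)
    (hS : ∀ x y, inner ℝ (S x) y = inner ℝ x (S y)) {w₀ : E} (hw₀ : 0 < inner ℝ (S w₀) w₀)
    (hPw₀ : 0 < P w₀) : 0 < A := by
  obtain ⟨w, hw, hPw, hℓ⟩ : ∃ w, 0 < inner ℝ (S w) w ∧ 0 < P w ∧ ℓ w ≤ 0 := by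
    rcases le_total (ℓ w₀) 0 with h | h
    · exact ⟨w₀, hw₀, hPw₀, h⟩
    · exact ⟨-w₀, by simpa using hw₀, by rwa [hP.even], by simpa using h⟩
  obtain ⟨a, b, ha, hb, h1, h2, h3⟩ := hP.ray_one w
  have hs := hP.two_lt_left
  have ht := hP.two_lt_right
  have hab : 0 < a + b := by
    have e1 : a / s ≤ a := div_le_self ha (by linarith)
    have e2 : b / t ≤ b := div_le_self hb (by linarith)
    linarith
  obtain ⟨τ, hτ, hz⟩ := exists_ray_zero hs ht ha hb hab hw hℓ
  have h4 := hA (τ • w) (by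
    rw [fderiv_energyI_apply hP hS, (h3 τ hτ).2, map_smul, map_smul, real_inner_smul_left,
      real_inner_smul_right, smul_eq_mul]
    linarith)
  have h5 : 0 < P (τ • w) := by
    rw [(h3 τ hτ).1]
    have e1 : 0 < τ ^ s := by positivity
    have e2 : 0 < τ ^ t := by positivity
    rcases ha.eq_or_lt with h | h
    · have : 0 < b := by linarith
      rw [← h, zero_div, mul_zero, zero_add]
      exact mul_pos e2 (div_pos this (by linarith))
    · exact add_pos_of_pos_of_nonneg (mul_pos e1 (div_pos h (by linarith)))
        (mul_nonneg e2.le (div_nonneg hb (by linarith)))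
  by_contra hcon
  have h6 : A * √(energyI S P ℓ (τ • w) ^ 2 + 1) ≤ 0 :=
    mul_nonpos_of_nonpos_of_nonneg (not_lt.1 hcon) (Real.sqrt_nonneg _)
  linarith

/-- The corrections `T₁`, `T₂` are small where `J` is large. -/
theorem exists_corr_le (hP : IsPowerPotential P s t) (hK : 0 ≤ K) (hA : 0 < A) (hχ : IsCutoff χ)
    {δ : ℝ} (hδ : 0 < δ) : ∃ M : ℝ, ∀ ℓ : E →L[ℝ] ℝ, IsLowerOrder P s t K ℓ → ∀ w,
      M ≤ energyJ S P ℓ A χ w → |corrOne S P ℓ A χ w| ≤ δ ∧ |corrTwo S P ℓ A χ w| ≤ δ := by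
  -- In the transition region |χ'| ≤ 2, P/Q < 2 and 2A|I| ≤ Q, which gives |T₁| ≤ 8A|ℓ|/Q and |T₂ -
  -- T₁| ≤ 2|ℓ|/Q.
  set κ := 8 * A + 2 with hκ
  have hκ0 : 0 < κ := by positivity
  set ε := δ / (4 * κ) with hε
  have hε0 : 0 < ε := by positivity
  obtain ⟨C, hC, hb⟩ := hP.exists_lowerOrder_bound hK hε0
  -- The corrections vanish unless 1 < P/Q < 2. There |ℓ| ≤ 2εQ + C, so J ≤ |I| + |ℓ| ≤ (1/(2A) +
  -- 2ε)Q + C. A value of J above this level forces Q ≥ 2κC/δ, hence κ|ℓ|/Q ≤ δ.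
  refine ⟨(1 / (2 * A) + 2 * ε) * (2 * κ * C / δ) + C + 1, fun ℓ hℓ w hw => ?_⟩
  set θ := cutoffRatio S P ℓ A w with hθ
  set Q := energyQ S P ℓ A w with hQ
  set i := energyI S P ℓ w with hi
  have hQ0 : 0 < Q := energyQ_pos hA w
  by_cases h12 : 1 < θ ∧ θ < 2
  swap
  · have h0 : deriv χ θ = 0 := by
      rcases le_or_gt θ 1 with h | h
      · exact hχ.deriv_eq_zero_of_le h
      · exact hχ.deriv_eq_zero_of_ge (not_lt.1 fun h' => h12 ⟨h, h'⟩)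
    have e1 : corrOne S P ℓ A χ w = 0 := by simp [corrOne, ← hθ, h0]
    have e2 : corrTwo S P ℓ A χ w = 0 := by simp [corrTwo, e1, ← hθ, h0]
    simp [e1, e2, hδ.le]
  have hPQ : P w ≤ 2 * Q := by
    have : θ = P w / Q := by rw [hθ, cutoffRatio]; ring
    have h2 := h12.2
    rw [this, div_lt_iff₀ hQ0] at h2
    exact h2.le
  have hlw : |ℓ w| ≤ 2 * ε * Q + C := (hb ℓ hℓ w).trans (by nlinarith)
  have hiQ : 2 * A * |i| ≤ Q := by
    rw [hQ, energyQ, ← hi]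
    exact mul_le_mul_of_nonneg_left (abs_le_sqrt_sq_add_one i) (by positivity)
  have hQbig : 2 * κ * C / δ ≤ Q := by
    have hχ01 := hχ.mem_Icc θ
    have h3 : energyJ S P ℓ A χ w = i + (1 - χ θ) * ℓ w := by
      rw [energyJ, hi, energyI, ← hθ]; ring
    have h4 : (1 - χ θ) * ℓ w ≤ |ℓ w| := by
      refine (le_abs_self _).trans ?_
      rw [abs_mul]
      refine mul_le_of_le_one_left (abs_nonneg _) ?_
      rw [abs_le]
      constructor <;> linarith [hχ01.1, hχ01.2]
    have h5 : |i| ≤ 1 / (2 * A) * Q := by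
      rw [one_div_mul_eq_div, le_div_iff₀ (by positivity)]
      linarith
    have h6 := le_abs_self i
    have h7 : (1 / (2 * A) + 2 * ε) * (2 * κ * C / δ) ≤ (1 / (2 * A) + 2 * ε) * Q := by linarith
    exact le_of_mul_le_mul_left h7 (by positivity)
  have hfrac : κ * (|ℓ w| / Q) ≤ δ := by
    rw [mul_div_assoc', div_le_iff₀ hQ0]
    rw [div_le_iff₀ hδ] at hQbig
    have e : κ * ε = δ / 4 := by rw [hε]; field_simp
    calc κ * |ℓ w| ≤ κ * (2 * ε * Q + C) := by gcongr
      _ = 2 * (κ * ε) * Q + κ * C := by ring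
      _ ≤ δ * Q := by rw [e]; linarith
  have hD := hχ.abs_deriv_le θ
  have hT1 : |corrOne S P ℓ A χ w| ≤ 8 * A * (|ℓ w| / Q) := by
    have f1 : |2 * A * i / Q| ≤ 1 := by
      rw [abs_div, abs_mul, abs_of_pos hQ0, abs_of_pos (by positivity : 0 < 2 * A)]
      exact (div_le_one hQ0).2 hiQ
    have f2 : |2 * A / Q| = 2 * A / Q := abs_of_pos (by positivity)
    have f3 : |θ| ≤ 2 := abs_le.2 ⟨by linarith [h12.1], h12.2.le⟩
    rw [corrOne, ← hθ, ← hi, ← hQ, abs_mul, abs_mul, abs_mul, abs_mul, f2]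
    calc |deriv χ θ| * |ℓ w| * |2 * A * i / Q| * (2 * A / Q) * |θ|
        ≤ 2 * |ℓ w| * 1 * (2 * A / Q) * 2 := by gcongr
      _ = _ := by ring
  have hT2 : |deriv χ θ * ℓ w / Q| ≤ 2 * (|ℓ w| / Q) := by
    rw [abs_div, abs_mul, abs_of_pos hQ0, mul_div_assoc]
    gcongr
  have hnn : 0 ≤ |ℓ w| / Q := by positivity
  have hsplit : κ * (|ℓ w| / Q) = 8 * A * (|ℓ w| / Q) + 2 * (|ℓ w| / Q) := by rw [hκ]; ring
  constructor
  · linarith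
  · rw [corrTwo]
    refine (abs_add_le _ _).trans ?_
    linarith

theorem energyI_eq_energyJ (ℓ : E →L[ℝ] ℝ) (w : E) : energyI S P ℓ w =
    energyJ S P ℓ A χ w - (1 - χ (cutoffRatio S P ℓ A w)) * ℓ w := by
  rw [energyI, energyJ]
  ring

/-- `P` is controlled by `J(v)` where the cut-off factor does not vanish, for `v = ±w`. -/
theorem IsPowerPotential.exists_le_of_cutoff_ne_zero (hP : IsPowerPotential P s t) (hK : 0 ≤ K)
    (hA : 0 < A) (hχ : IsCutoff χ) : ∃ C : ℝ, 0 < C ∧ ∀ ℓ : E →L[ℝ] ℝ, IsLowerOrder P s t K ℓ →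
      ∀ w v, v = w ∨ v = -w → χ (cutoffRatio S P ℓ A w) ≠ 0 →
        P w ≤ C * (|energyJ S P ℓ A χ v| + 1) := by
  -- Where χ ≠ 0, P < 2Q = 4A√(I² + 1), and I(w) differs from J(v) by at most 2|ℓ(w)|. With ε =
  -- 1/(16A) the share of P in 4A·2|ℓ| is P/2, which moves to the left.
  obtain ⟨C, hC, hb⟩ := hP.exists_lowerOrder_bound hK (ε := 1 / (16 * A)) (by positivity)
  refine ⟨8 * A * (2 * C + 1), by positivity, fun ℓ hℓ w v hv hne => ?_⟩
  set j := energyJ S P ℓ A χ v with hj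
  have hQ0 : 0 < energyQ S P ℓ A w := energyQ_pos hA w
  have hPQ : P w < 2 * energyQ S P ℓ A w := by
    by_contra hcon
    refine hne (hχ.eq_zero _ ?_)
    rw [cutoffRatio, one_div_mul_eq_div, le_div_iff₀ hQ0]
    exact not_lt.1 hcon
  have hI : |energyI S P ℓ w| ≤ |j| + 2 * |ℓ w| := by
    have h01 := hχ.mem_Icc (cutoffRatio S P ℓ A v)
    have h1 : ∃ c : ℝ, |c| ≤ 2 ∧ energyI S P ℓ w = j + c * ℓ w := by
      rcases hv with rfl | rfl
      · refine ⟨-(1 - χ (cutoffRatio S P ℓ A v)), ?_, ?_⟩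
        · rw [abs_le]
          constructor <;> linarith [h01.1, h01.2]
        · rw [energyI_eq_energyJ (A := A) (χ := χ)]
          ring
      · refine ⟨-(1 + χ (cutoffRatio S P ℓ A (-w))), ?_, ?_⟩
        · rw [abs_le]
          constructor <;> linarith [h01.1, h01.2]
        · rw [hj, energyJ, energyI, hP.even, map_neg, inner_neg_neg, map_neg]
          ring
    obtain ⟨c, hc, he⟩ := h1
    rw [he]
    refine (abs_add_le _ _).trans ?_
    rw [abs_mul]
    gcongr
  have h2 := hb ℓ hℓ w
  have h3 := sqrt_sq_add_one_le (energyI S P ℓ w)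
  rw [energyQ] at hPQ
  have h4 : P w ≤ 4 * A * (|j| + 2 * (1 / (16 * A) * P w + C) + 1) := by
    have : 2 * (2 * A * √(energyI S P ℓ w ^ 2 + 1)) ≤ 2 * (2 * A * (|j| + 2 *
      (1 / (16 * A) * P w + C) + 1)) := by
      gcongr
      linarith
    linarith
  have h5 : 4 * A * (2 * (1 / (16 * A) * P w)) = 1 / 2 * P w := by field_simp; norm_num
  have h6 : 4 * A * (|j| + 2 * (1 / (16 * A) * P w + C) + 1) =
      4 * A * (|j| + 2 * C + 1) + 1 / 2 * P w := by rw [← h5]; ring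
  rw [h6] at h4
  have h7 : |j| + 2 * C + 1 ≤ (2 * C + 1) * (|j| + 1) := by nlinarith [abs_nonneg j]
  have h8 : 8 * A * (|j| + 2 * C + 1) ≤ 8 * A * ((2 * C + 1) * (|j| + 1)) := by gcongr
  rw [mul_assoc (8 * A)]
  linarith

/-- `J` is almost even. -/
theorem exists_almost_even (hP : IsPowerPotential P s t) (hK : 0 ≤ K) (hA : 0 < A)
    (hχ : IsCutoff χ) : ∃ β : ℝ, 0 < β ∧ ∀ ℓ : E →L[ℝ] ℝ, IsLowerOrder P s t K ℓ → ∀ w,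
      |energyJ S P ℓ A χ w - energyJ S P ℓ A χ (-w)| ≤ β *
        (|energyJ S P ℓ A χ w| ^ (1 / s) + |energyJ S P ℓ A χ w| ^ (1 / t) + 1) := by
  obtain ⟨C, hC, hb⟩ := hP.exists_le_of_cutoff_ne_zero (S := S) hK hA hχ
  have hs := hP.two_lt_left
  have ht := hP.two_lt_right
  set D := max (C ^ (1 / s)) (C ^ (1 / t)) with hD
  have hD0 : 0 < D := lt_max_of_lt_left (by positivity)
  refine ⟨4 * (K + 1) * D, by positivity, fun ℓ hℓ w => ?_⟩
  set j := energyJ S P ℓ A χ w with hj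
  have hpow : ∀ p : ℝ, 2 < p → C ^ (1 / p) ≤ D → ∀ x : ℝ, 0 ≤ x → x ≤ C * (|j| + 1) →
      x ^ (1 / p) ≤ D * (|j| ^ (1 / p) + 1) := fun p hp hCp x hx hxj => by
    have h1 : (0 : ℝ) ≤ 1 / p := by positivity
    have h2 : 1 / p ≤ 1 := (div_le_one (by linarith)).2 (by linarith)
    calc x ^ (1 / p) ≤ (C * (|j| + 1)) ^ (1 / p) := Real.rpow_le_rpow hx hxj h1
      _ = C ^ (1 / p) * (|j| + 1) ^ (1 / p) := Real.mul_rpow hC.le (by positivity)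
      _ ≤ D * (|j| ^ (1 / p) + 1 ^ (1 / p)) := by
          gcongr
          exact Real.rpow_add_le_add_rpow (abs_nonneg _) zero_le_one h1 h2
      _ = _ := by rw [Real.one_rpow]
  set B := D * (|j| ^ (1 / s) + |j| ^ (1 / t) + 2) with hB
  have hB0 : 0 ≤ B := by positivity
  have hl : ∀ v, v = w ∨ v = -w → |χ (cutoffRatio S P ℓ A v) * ℓ v| ≤ K * B := fun v hv => by
    by_cases h0 : χ (cutoffRatio S P ℓ A v) = 0
    · rw [h0, zero_mul, abs_zero]
      positivity
    -- The potential at v = ±w is bounded through J at w, so that both cut-off terms are estimated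
    -- by |J(w)| alone.
    have hwv : w = v ∨ w = -v := by
      rcases hv with rfl | rfl
      · exact Or.inl rfl
      · exact Or.inr (neg_neg w).symm
    have h1 := hb ℓ hℓ v w hwv h0
    have h2 := hpow s hs (le_max_left _ _) _ (hP.nonneg v) h1
    have h3 := hpow t ht (le_max_right _ _) _ (hP.nonneg v) h1
    have h01 := hχ.mem_Icc (cutoffRatio S P ℓ A v)
    rw [abs_mul, abs_of_nonneg h01.1]
    refine (mul_le_of_le_one_left (abs_nonneg _) h01.2).trans ((hℓ v).trans ?_)
    gcongr
    linarith
  have he : j - energyJ S P ℓ A χ (-w) = χ (cutoffRatio S P ℓ A (-w)) * ℓ (-w) -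
      χ (cutoffRatio S P ℓ A w) * ℓ w := by
    rw [hj, energyJ, energyJ, hP.even, map_neg, inner_neg_neg]
    ring
  rw [he]
  refine (abs_sub _ _).trans ?_
  have h1 := hl w (Or.inl rfl)
  have h2 := hl (-w) (Or.inr rfl)
  have h3 : 0 ≤ |j| ^ (1 / s) := by positivity
  have h4 : 0 ≤ |j| ^ (1 / t) := by positivity
  have h5 : B ≤ 2 * D * (|j| ^ (1 / s) + |j| ^ (1 / t) + 1) := by rw [hB]; nlinarith
  have h6 : K * B ≤ (K + 1) * (2 * D * (|j| ^ (1 / s) + |j| ^ (1 / t) + 1)) := by gcongr; linarith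
  linarith

/-- Large critical values of `J` are critical values of `I`. -/
theorem exists_critical_level (hP : IsPowerPotential P s t)
    (hS : ∀ x y, inner ℝ (S x) y = inner ℝ x (S y)) (hK : 0 ≤ K) (hA : 0 < A) (hχ : IsCutoff χ) :
    ∃ M : ℝ, 0 < M ∧ ∀ ℓ : E →L[ℝ] ℝ, IsLowerOrder P s t K ℓ → IsAdmissible S P ℓ A → ∀ w,
      M ≤ energyJ S P ℓ A χ w → fderiv ℝ (energyJ S P ℓ A χ) w = 0 →
      energyJ S P ℓ A χ w = energyI S P ℓ w ∧ fderiv ℝ (energyI S P ℓ) w = 0 := by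
  have hs := hP.two_lt_left
  have ht := hP.two_lt_right
  obtain ⟨ε, hε0, hε1, hray⟩ := exists_ray_bound hs ht hA
  -- Testing J'(w) = 0 with w gives (1 + T₁)(x - σ) = (T₂ - T₁)σ + (χ + T₁)ℓ(w) for x = (Sw, w) and
  -- σ = P'(w)w. At high levels |ℓ(w)| ≤ δσ, the right side is at most (2 + 5/4)δσ, and 1 + T₁ ≥
  -- 3/4; so |x - σ| ≤ 8δσ = εσ.
  set δ := ε / 8 with hδ
  have hδ0 : 0 < δ := by positivity
  obtain ⟨M₁, hM₁⟩ := exists_corr_le (S := S) hP hK hA hχ hδ0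
  obtain ⟨C, hC, hb⟩ := hP.exists_lowerOrder_bound hK (ε := δ / 2) (by positivity)
  refine ⟨max M₁ (4 * C / δ + 2 * C + 1), lt_max_of_lt_right (by positivity),
    fun ℓ hℓ hadm w hw hcrit => ?_⟩
  obtain ⟨hT₁, hT₂⟩ := hM₁ ℓ hℓ w ((le_max_left _ _).trans hw)
  have hJbig := (le_max_right _ _).trans hw
  have h01 := hχ.mem_Icc (cutoffRatio S P ℓ A w)
  have hder : ∀ z, (1 + corrOne S P ℓ A χ w) * inner ℝ (S w) z -
      (1 + corrTwo S P ℓ A χ w) * fderiv ℝ P w z -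
      (χ (cutoffRatio S P ℓ A w) + corrOne S P ℓ A χ w) * ℓ z = 0 := fun z => by
    rw [← fderiv_energyJ_apply hP hA hχ hS, hcrit]
    rfl
  set T₁ := corrOne S P ℓ A χ w with hT₁d
  set T₂ := corrTwo S P ℓ A χ w with hT₂d
  set c := χ (cutoffRatio S P ℓ A w) with hc
  obtain ⟨a, b, ha, hbn, h1, h2, h3⟩ := hP.ray_one w
  set σ := a + b with hσ
  set x := inner ℝ (S w) w with hx
  have hσ0 : 0 ≤ σ := by positivity
  have hPσ : P w ≤ σ := by
    rw [h1]
    exact add_le_add (div_le_self ha (by linarith)) (div_le_self hbn (by linarith))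
  have hP0 := hP.nonneg w
  have hl : |ℓ w| ≤ δ / 2 * σ + C := (hb ℓ hℓ w).trans (by gcongr)
  have hkey := hder w
  rw [h2, ← hx] at hkey
  have a1 := abs_le.1 hT₁
  have a2 := abs_le.1 hT₂
  have hδ1 : δ ≤ 1 / 16 := by linarith
  have hcT : |(c + T₁) * ℓ w| ≤ 5 / 4 * |ℓ w| := by
    rw [abs_mul]
    refine mul_le_mul_of_nonneg_right ?_ (abs_nonneg _)
    rw [abs_le]
    constructor <;> linarith [h01.1, h01.2]
  have hcl : |c * ℓ w| ≤ |ℓ w| := by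
    rw [abs_mul, abs_of_nonneg h01.1]
    exact mul_le_of_le_one_left (abs_nonneg _) h01.2
  -- a lower bound for `σ`
  have hxle : x ≤ 5 / 3 * (σ + |ℓ w|) := by
    by_contra hcon
    push Not at hcon
    have e1 : 3 / 4 * x ≤ (1 + T₁) * x := by
      have : 0 ≤ x := le_trans (by positivity) hcon.le
      nlinarith
    have e2 : (1 + T₂) * σ ≤ 5 / 4 * σ := by nlinarith
    have e3 := (abs_le.1 hcT).2
    linarith
  have hJ : energyJ S P ℓ A χ w = 1 / 2 * x - P w - c * ℓ w := rfl
  have hσbig : 2 * C / δ < σ := by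
    have e1 := (abs_le.1 hcl).1
    have e2 : 4 * C / δ + 2 * C + 1 ≤ 2 * σ + 2 * C := by
      have e3 : δ / 2 * σ ≤ 1 / 32 * σ := by nlinarith
      linarith
    have e4 : 4 * C / δ = 2 * (2 * C / δ) := by ring
    linarith
  have hσpos : 0 < σ := lt_of_le_of_lt (by positivity) hσbig
  have hlσ : |ℓ w| ≤ δ * σ := by
    rw [div_lt_iff₀ hδ0] at hσbig
    linarith
  have hxσ : |x - σ| ≤ ε * σ := by
    have e1 : (1 + T₁) * (x - σ) = (T₂ - T₁) * σ + (c + T₁) * ℓ w := by linarith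
    have e2 : |(T₂ - T₁) * σ| ≤ 2 * δ * σ := by
      rw [abs_mul, abs_of_pos hσpos]
      refine mul_le_mul_of_nonneg_right ?_ hσ0
      rw [abs_le]
      constructor <;> linarith
    have e3 : |(1 + T₁) * (x - σ)| ≤ 2 * δ * σ + 5 / 4 * (δ * σ) := by
      rw [e1]
      refine (abs_add_le _ _).trans (add_le_add e2 (hcT.trans ?_))
      gcongr
    have e4 : 3 / 4 * |x - σ| ≤ |(1 + T₁) * (x - σ)| := by
      rw [abs_mul]
      refine mul_le_mul_of_nonneg_right ?_ (abs_nonneg _)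
      rw [abs_of_pos (by linarith)]
      linarith
    have e5 : δ * σ = ε * σ / 8 := by rw [hδ]; ring
    have e6 : 0 ≤ ε * σ := by positivity
    linarith
  -- Admissibility is used only at the points τw with I'(τw)τw = 0. The result is P(w) ≤ Q(w), and
  -- there χ = 1 and χ' = 0, the boundary P = Q included, so the corrections vanish and J' = I' at
  -- w.
  have hbound := hray a b x (ℓ w) ha hbn hσpos hxσ (hlσ.trans (by rw [hδ]; gcongr; linarith))
    fun τ hτ hz => by
      have h4 := hadm (τ • w) (by
        rw [fderiv_energyI_apply hP hS, (h3 τ hτ).2, map_smul, map_smul, real_inner_smul_left,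
          real_inner_smul_right, smul_eq_mul]
        linarith)
      rw [energyI, (h3 τ hτ).1, map_smul, map_smul, real_inner_smul_left, real_inner_smul_right,
        smul_eq_mul, ← hx, ← mul_assoc τ τ x, ← sq] at h4
      exact h4
  have hθ : cutoffRatio S P ℓ A w ≤ 1 := by
    rw [cutoffRatio, one_div_mul_eq_div, div_le_one (energyQ_pos hA w), energyQ, energyI, ← hx, h1]
    exact hbound
  have hD : deriv χ (cutoffRatio S P ℓ A w) = 0 := hχ.deriv_eq_zero_of_le hθ
  have hT₁0 : T₁ = 0 := by rw [hT₁d, corrOne, hD]; ring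
  have hT₂0 : T₂ = 0 := by rw [hT₂d, corrTwo, ← hT₁d, hT₁0, hD]; ring
  have hc1 : c = 1 := hχ.eq_one _ hθ
  constructor
  · rw [hJ, hc1, energyI, hx]
    ring
  · ext z
    have := hder z
    rw [hT₁0, hT₂0, hc1] at this
    rw [fderiv_energyI_apply hP hS, zero_apply]
    linarith

end AbstractEstimates

end HamiltonianSystem

namespace HamiltonianSystem

/-! ### The Palais-Smale conditions -/

section AbstractPalaisSmale

variable {E : Type*} [NormedAddCommGroup E] [InnerProductSpace ℝ E]
variable {S : E →L[ℝ] E} {P : E → ℝ} {s t A K : ℝ} {χ : ℝ → ℝ} {ℓ : E →L[ℝ] ℝ}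

theorem norm_symm_involution (hS : ∀ x y, inner ℝ (S x) y = inner ℝ x (S y))
    (hSS : ∀ x, S (S x) = x) (x : E) : ‖S x‖ = ‖x‖ := by
  rw [← sq_eq_sq₀ (norm_nonneg _) (norm_nonneg _), ← real_inner_self_eq_norm_sq,
    ← real_inner_self_eq_norm_sq, hS, hSS]

/-- The a priori bound for Palais-Smale sequences. -/
theorem exists_palaisSmale_bound (hP : IsPowerPotential P s t)
    (hS : ∀ x y, inner ℝ (S x) y = inner ℝ x (S y)) (hSS : ∀ x, S (S x) = x) (hK : 0 ≤ K)
    (hA : 0 < A) (hχ : IsCutoff χ) {δ : ℝ} (hδ0 : 0 < δ) (hδ1 : δ ≤ 1 / 4)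
    (hδ : δ ≤ (min s t - 2) / (4 * (min s t / 2 + 1))) (hℓ : IsLowerOrder P s t K ℓ) (J₀ : ℝ) :
    ∃ R : ℝ, ∀ w, |corrOne S P ℓ A χ w| ≤ δ → |corrTwo S P ℓ A χ w| ≤ δ →
      |energyJ S P ℓ A χ w| ≤ J₀ → |fderiv ℝ (energyJ S P ℓ A χ) w w| ≤ ‖w‖ →
      |fderiv ℝ (energyJ S P ℓ A χ) w (S w)| ≤ ‖w‖ → ‖w‖ ≤ R := by
  set m := min s t with hm
  have hm2 : 2 < m := hP.two_lt_min
  set c₀ := (m - 2) / 4 with hc₀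
  have hc₀0 : 0 < c₀ := by linarith
  obtain ⟨C, hC, hb⟩ := hP.exists_lowerOrder_bound hK (ε := c₀ / 4) (by positivity)
  set D := 2 / c₀ * (2 * C + 5 / 4 * |J₀| + 1) with hD
  have hD0 : 0 < D := by positivity
  -- With this constant and P ≤ D(1 + ‖w‖), the contribution of P to the test with Sw is at most (1
  -- + ‖w‖)/4 times ‖w‖, less than the ¾‖w‖² supplied by (1 + T₁)‖w‖².
  obtain ⟨C', hC', hg⟩ := hP.growth (1 / (5 * D)) (by positivity)
  refine ⟨2 * (5 / 4 + 5 / 4 * (C' + ‖ℓ‖)), fun w hT₁ hT₂ hJ hd₁ hd₂ => ?_⟩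
  have h01 := hχ.mem_Icc (cutoffRatio S P ℓ A w)
  rw [fderiv_energyJ_apply hP hA hχ hS] at hd₁ hd₂
  have hJe : energyJ S P ℓ A χ w = 1 / 2 * inner ℝ (S w) w - P w -
    χ (cutoffRatio S P ℓ A w) * ℓ w := rfl
  set T₁ := corrOne S P ℓ A χ w with hT₁d
  set T₂ := corrTwo S P ℓ A χ w with hT₂d
  set c := χ (cutoffRatio S P ℓ A w) with hc
  set J := energyJ S P ℓ A χ w with hJd
  have a1 := abs_le.1 hT₁
  have a2 := abs_le.1 hT₂
  have hPw := hP.nonneg w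
  have hlw := hb ℓ hℓ w
  -- the bound for the potential
  have hPbound : P w ≤ D * (1 + ‖w‖) := by
    -- The weight 1 + T₁ on J makes the quadratic form cancel against ½J'(w)w. What remains is at
    -- least (m/2 - 1)P - δ(m/2 + 1)P up to ℓ, and the condition on δ leaves c₀P.
    have e1 : (1 + T₁) * J - 1 / 2 * ((1 + T₁) * inner ℝ (S w) w - (1 + T₂) * fderiv ℝ P w w -
        (c + T₁) * ℓ w) = 1 / 2 * (1 + T₂) * fderiv ℝ P w w - (1 + T₁) * P w -
        ((1 + T₁) * c - 1 / 2 * (c + T₁)) * ℓ w := by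
      rw [hJe]; ring
    have e2 : |((1 + T₁) * c - 1 / 2 * (c + T₁)) * ℓ w| ≤ 2 * |ℓ w| := by
      rw [abs_mul]
      refine mul_le_mul_of_nonneg_right ?_ (abs_nonneg _)
      have u1 : 0 ≤ (1 + T₁) * c := mul_nonneg (by linarith) h01.1
      have u2 : (1 + T₁) * c ≤ 5 / 4 * 1 := mul_le_mul (by linarith) h01.2 h01.1 (by norm_num)
      rw [abs_le]
      constructor <;> linarith [h01.1, h01.2]
    have e3 : c₀ * P w ≤ 1 / 2 * (1 + T₂) * fderiv ℝ P w w - (1 + T₁) * P w := by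
      have v1 : 1 / 2 * (1 - δ) * (m * P w) ≤ 1 / 2 * (1 + T₂) * fderiv ℝ P w w :=
        mul_le_mul (by linarith) (hP.min_mul_le w) (by positivity) (by linarith)
      have v2 : (1 + T₁) * P w ≤ (1 + δ) * P w := mul_le_mul_of_nonneg_right (by linarith) hPw
      have v3 : δ * (m / 2 + 1) ≤ c₀ := by
        rw [le_div_iff₀ (by linarith)] at hδ
        linarith
      have v4 := mul_le_mul_of_nonneg_right v3 hPw
      have v5 : c₀ * P w * 4 = (m - 2) * P w := by rw [hc₀]; ring
      linarith
    have e4 : (1 + T₁) * J ≤ 5 / 4 * |J₀| := by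
      refine (le_abs_self _).trans ?_
      rw [abs_mul]
      refine mul_le_mul ?_ (hJ.trans (le_abs_self _)) (abs_nonneg _) (by norm_num)
      rw [abs_le]
      constructor <;> linarith
    have e5 := (abs_le.1 hd₁).1
    have e6 := (abs_le.1 e2).2
    have e7 : c₀ / 2 * P w ≤ 2 * C + 5 / 4 * |J₀| + ‖w‖ := by linarith [norm_nonneg w]
    have e8 : P w ≤ 2 / c₀ * (2 * C + 5 / 4 * |J₀| + ‖w‖) := by
      rw [div_mul_eq_mul_div, le_div_iff₀ hc₀0]
      linarith
    refine e8.trans ?_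
    rw [hD, mul_assoc]
    refine mul_le_mul_of_nonneg_left ?_ (by positivity)
    have : 0 ≤ (2 * C + 5 / 4 * |J₀|) * ‖w‖ := by positivity
    linarith
  -- testing with the reflected element
  rcases (norm_nonneg w).eq_or_lt with h0 | hw0
  · rw [← h0]; positivity
  have hn := norm_symm_involution hS hSS w
  rw [real_inner_self_eq_norm_sq, hn] at hd₂
  have f1 : 3 / 4 * ‖w‖ ^ 2 ≤ (1 + T₁) * ‖w‖ ^ 2 := by gcongr; linarith
  have f2 : (1 + T₂) * fderiv ℝ P w (S w) ≤ 5 / 4 * ((1 / (5 * D) * P w + C') * ‖w‖) := by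
    refine (le_abs_self _).trans ?_
    rw [abs_mul]
    have := hg w (S w)
    rw [hn] at this
    refine mul_le_mul ?_ this (abs_nonneg _) (by norm_num)
    rw [abs_le]
    constructor <;> linarith
  have f3 : (c + T₁) * ℓ (S w) ≤ 5 / 4 * (‖ℓ‖ * ‖w‖) := by
    refine (le_abs_self _).trans ?_
    rw [abs_mul]
    have := ℓ.le_opNorm (S w)
    rw [hn] at this
    refine mul_le_mul ?_ this (abs_nonneg _) (by norm_num)
    rw [abs_le]
    constructor <;> linarith [h01.1, h01.2]
  have f4 := (abs_le.1 hd₂).2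
  have f5 : 3 / 4 * ‖w‖ * ‖w‖ ≤
      (1 + 5 / 4 * (1 / (5 * D) * P w + C') + 5 / 4 * ‖ℓ‖) * ‖w‖ := by linarith
  have f6 := le_of_mul_le_mul_right f5 hw0
  have f7 : 5 / 4 * (1 / (5 * D) * P w) ≤ 1 / 4 * (1 + ‖w‖) := by
    have : 5 / 4 * (1 / (5 * D) * P w) ≤ 5 / 4 * (1 / (5 * D) * (D * (1 + ‖w‖))) := by gcongr
    refine this.trans (le_of_eq ?_)
    field_simp
  linarith

/-- The Palais-Smale condition above a level, for sequences in a family of reflection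
invariant subspaces with dense union. -/
theorem exists_palaisSmale_level [CompleteSpace E] (hP : IsPowerPotential P s t)
    (hS : ∀ x y, inner ℝ (S x) y = inner ℝ x (S y)) (hSS : ∀ x, S (S x) = x) (hK : 0 ≤ K)
    (hA : 0 < A) (hχ : IsCutoff χ) : ∃ M : ℝ, ∀ ℓ : E →L[ℝ] ℝ, IsLowerOrder P s t K ℓ →
      ∀ c : ℝ, M < c → ∀ X : ℕ → Submodule ℝ E, (∀ n, ∀ x ∈ X n, S x ∈ X n) →
      (∀ x, ∃ y : ℕ → E, (∀ n, y n ∈ X n) ∧ Tendsto y atTop (𝓝 x)) →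
      ∀ (w : ℕ → E) (ε : ℕ → ℝ), (∀ n, w n ∈ X n) → Tendsto ε atTop (𝓝 0) →
      Tendsto (fun n => energyJ S P ℓ A χ (w n)) atTop (𝓝 c) →
      (∀ n, ∀ z ∈ X n, |fderiv ℝ (energyJ S P ℓ A χ) (w n) z| ≤ ε n * ‖z‖) →
      ∃ (w₀ : E) (σ : ℕ → ℕ), StrictMono σ ∧ Tendsto (fun n => w (σ n)) atTop (𝓝 w₀) := by
  have hm2 : 2 < min s t := hP.two_lt_min
  set δ := min (1 / 4) ((min s t - 2) / (4 * (min s t / 2 + 1))) with hδ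
  have hδ0 : 0 < δ := lt_min (by norm_num) (div_pos (by linarith) (by linarith))
  have hδ1 : δ ≤ 1 / 4 := min_le_left _ _
  obtain ⟨M, hM⟩ := exists_corr_le (S := S) hP hK hA hχ hδ0
  refine ⟨M, fun ℓ hℓ c hc X hXS hXd w ε hw hε hJ hder => ?_⟩
  obtain ⟨R, hR⟩ := exists_palaisSmale_bound (A := A) hP hS hSS hK hA hχ hδ0 hδ1
    (min_le_right _ _) hℓ (|c| + 1)
  have hev : ∀ᶠ n in atTop, M ≤ energyJ S P ℓ A χ (w n) ∧
      |energyJ S P ℓ A χ (w n)| ≤ |c| + 1 ∧ ε n ≤ 1 :=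
    (hJ.eventually_const_le hc).and
      ((hJ.abs.eventually_le_const (lt_add_one _)).and (hε.eventually_le_const one_pos))
  obtain ⟨n₀, hn₀⟩ := eventually_atTop.1 hev
  have hT : ∀ n, |corrOne S P ℓ A χ (w (n + n₀))| ≤ δ ∧ |corrTwo S P ℓ A χ (w (n + n₀))| ≤ δ :=
    fun n => hM ℓ hℓ _ (hn₀ _ (Nat.le_add_left _ _)).1
  have hbd : ∀ n, ‖w (n + n₀)‖ ≤ R := fun n => by
    obtain ⟨h1, h2, h3⟩ := hn₀ (n + n₀) (Nat.le_add_left _ _)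
    refine hR _ (hT n).1 (hT n).2 h2 ((hder _ _ (hw _)).trans ?_)
      ((hder _ _ (hXS _ _ (hw _))).trans ?_)
    · exact mul_le_of_le_one_left (norm_nonneg _) h3
    · rw [norm_symm_involution hS hSS]
      exact mul_le_of_le_one_left (norm_nonneg _) h3
  obtain ⟨G, σ₁, hσ₁, hG⟩ := hP.compact (fun n => w (n + n₀)) ⟨R, hbd⟩
  -- convergence of the coefficients
  set α : ℕ → ℝ × ℝ := fun n =>
    ((1 + corrTwo S P ℓ A χ (w (σ₁ n + n₀))) / (1 + corrOne S P ℓ A χ (w (σ₁ n + n₀))),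
     (χ (cutoffRatio S P ℓ A (w (σ₁ n + n₀))) + corrOne S P ℓ A χ (w (σ₁ n + n₀))) /
      (1 + corrOne S P ℓ A χ (w (σ₁ n + n₀)))) with hα
  have hαb : ∀ n, α n ∈ Icc (-2 : ℝ) 2 ×ˢ Icc (-2 : ℝ) 2 := fun n => by
    have a1 := abs_le.1 (hT (σ₁ n)).1
    have a2 := abs_le.1 (hT (σ₁ n)).2
    have h01 := hχ.mem_Icc (cutoffRatio S P ℓ A (w (σ₁ n + n₀)))
    have hpos : 0 < 1 + corrOne S P ℓ A χ (w (σ₁ n + n₀)) := by linarith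
    refine ⟨⟨?_, ?_⟩, ⟨?_, ?_⟩⟩
    · rw [hα, le_div_iff₀ hpos]; linarith
    · rw [hα, div_le_iff₀ hpos]; linarith
    · rw [hα, le_div_iff₀ hpos]; linarith [h01.1]
    · rw [hα, div_le_iff₀ hpos]; linarith [h01.2]
  obtain ⟨α₀, -, σ₂, hσ₂, hαlim⟩ := (isCompact_Icc.prod isCompact_Icc).tendsto_subseq hαb
  set τ : ℕ → ℕ := fun n => σ₁ (σ₂ n) + n₀ with hτ
  have hτm : StrictMono τ := fun i j hij => Nat.add_lt_add_right (hσ₁ (hσ₂ hij)) n₀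
  set H : ℕ → E →L[ℝ] ℝ := fun n => (α (σ₂ n)).1 • fderiv ℝ P (w (τ n)) + (α (σ₂ n)).2 • ℓ with hH
  set H₀ : E →L[ℝ] ℝ := α₀.1 • G + α₀.2 • ℓ with hH₀
  have hHlim : Tendsto H atTop (𝓝 H₀) := by
    have h1 : Tendsto (fun n => (α (σ₂ n)).1) atTop (𝓝 α₀.1) :=
      (continuous_fst.tendsto _).comp hαlim
    have h2 : Tendsto (fun n => (α (σ₂ n)).2) atTop (𝓝 α₀.2) :=
      (continuous_snd.tendsto _).comp hαlim
    have h3 : Tendsto (fun n => fderiv ℝ P (w (τ n))) atTop (𝓝 G) := hG.comp hσ₂.tendsto_atTop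
    exact (h1.smul h3).add (h2.smul_const ℓ)
  -- Divided by 1 + T₁, the equation reads (Sw_n, z) = H_n(z) up to a small error for z in X_n. As
  -- H_n → H₀ and S² = 1, the only possible limit is S applied to the Riesz representative of H₀.
  set y : E := S ((InnerProductSpace.toDual ℝ E).symm H₀) with hy
  have hSy : ∀ z, inner ℝ (S y) z = H₀ z := fun z => by
    rw [hy, hSS, InnerProductSpace.toDual_symm_apply]
  -- The limit y need not lie in X_n, so the test element is S(w_n - v_n) with v_n in X_n
  -- approximating y.
  obtain ⟨v, hv, hvlim⟩ := hXd y
  have hvτ : Tendsto (fun n => v (τ n)) atTop (𝓝 y) := hvlim.comp hτm.tendsto_atTop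
  refine ⟨y, τ, hτm, ?_⟩
  have hbound : ∀ n, ‖w (τ n) - v (τ n)‖ ≤ 2 * |ε (τ n)| + ‖H n - H₀‖ + ‖y - v (τ n)‖ := fun n => by
    set d := w (τ n) - v (τ n) with hd
    set T₁ := corrOne S P ℓ A χ (w (τ n)) with hT₁d
    have hdX : S d ∈ X (τ n) := hXS _ _ (sub_mem (hw _) (hv _))
    have hnd : ‖S d‖ = ‖d‖ := norm_symm_involution hS hSS d
    have a1 := abs_le.1 (hT (σ₁ (σ₂ n))).1
    have hpos : 3 / 4 ≤ 1 + T₁ := by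
      have : -δ ≤ T₁ := a1.1
      linarith
    have hpos' : 0 < 1 + T₁ := by linarith
    have e1 : inner ℝ (S (w (τ n))) (S d) =
        fderiv ℝ (energyJ S P ℓ A χ) (w (τ n)) (S d) / (1 + T₁) + H n (S d) := by
      rw [fderiv_energyJ_apply hP hA hχ hS]
      simp only [hH, hα, add_apply, smul_apply, smul_eq_mul]
      rw [← hT₁d]
      change _ = _ + ((1 + corrTwo S P ℓ A χ (w (τ n))) / (1 + T₁) * _ +
        (χ (cutoffRatio S P ℓ A (w (τ n))) + T₁) / (1 + T₁) * _)
      field_simp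
      ring
    have e2 : ‖d‖ ^ 2 = fderiv ℝ (energyJ S P ℓ A χ) (w (τ n)) (S d) / (1 + T₁) +
        (H n - H₀) (S d) + inner ℝ (S (y - v (τ n))) (S d) := by
      have e3 : d = w (τ n) - y + (y - v (τ n)) := by rw [hd]; abel
      have e4 : ‖d‖ ^ 2 = inner ℝ (S d) (S d) := by rw [real_inner_self_eq_norm_sq, hnd]
      rw [e4]
      nth_rewrite 1 [e3]
      rw [map_add, map_sub, inner_add_left, inner_sub_left, e1, hSy, sub_apply]
      ring
    have f1 : fderiv ℝ (energyJ S P ℓ A χ) (w (τ n)) (S d) / (1 + T₁) ≤ 2 * |ε (τ n)| * ‖d‖ := by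
      rw [div_le_iff₀ hpos']
      have g1 := (le_abs_self _).trans (hder (τ n) (S d) hdX)
      rw [hnd] at g1
      have g2 : ε (τ n) * ‖d‖ ≤ |ε (τ n)| * ‖d‖ :=
        mul_le_mul_of_nonneg_right (le_abs_self _) (norm_nonneg _)
      have g3 : 0 ≤ |ε (τ n)| * ‖d‖ := by positivity
      nlinarith
    have f2 : (H n - H₀) (S d) ≤ ‖H n - H₀‖ * ‖d‖ := by
      rw [← hnd]
      exact (le_abs_self _).trans ((H n - H₀).le_opNorm (S d))
    have f3 : inner ℝ (S (y - v (τ n))) (S d) ≤ ‖y - v (τ n)‖ * ‖d‖ := by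
      refine (real_inner_le_norm _ _).trans (le_of_eq ?_)
      rw [hnd, norm_symm_involution hS hSS]
    rcases (norm_nonneg d).eq_or_lt with h0 | h0
    · rw [← h0]; positivity
    · refine le_of_mul_le_mul_right ?_ h0
      rw [← sq, e2, add_mul, add_mul]
      linarith
  have hlim : Tendsto (fun n => 2 * |ε (τ n)| + ‖H n - H₀‖ + ‖y - v (τ n)‖) atTop (𝓝 0) := by
    have h1 := ((hε.comp hτm.tendsto_atTop).abs).const_mul 2
    have h2 := tendsto_iff_norm_sub_tendsto_zero.1 hHlim
    have h3 := (hvτ.const_sub y).norm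
    have := (h1.add h2).add h3
    simpa using this
  have hdiff : Tendsto (fun n => w (τ n) - v (τ n)) atTop (𝓝 0) :=
    squeeze_zero_norm hbound hlim
  simpa using hdiff.add hvτ

end AbstractPalaisSmale

end HamiltonianSystem

namespace HamiltonianSystem

theorem rpow_sub_two_mul_self {x t : ℝ} (hx : 0 ≤ x) (ht : 2 < t) :
    x ^ (t - 2) * x = x ^ (t - 1) := by
  rw [← Real.rpow_add_one' hx (by linarith)]
  congr 1
  ring

/-! ### Powers of L^t norms composed with compact operators as potentials -/

section PowerPotential

variable {X : Type*} [MeasurableSpace X] {μ : Measure X} {s t : ℝ}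
  [Fact (1 ≤ ENNReal.ofReal s)] [Fact (1 ≤ ENNReal.ofReal t)]
  {E : Type*} [NormedAddCommGroup E] [NormedSpace ℝ E]

theorem lpPowDeriv_self (ht : 2 < t) (f : Lp ℝ (ENNReal.ofReal t) μ) :
    lpPowDeriv ht f f = t * ‖f‖ ^ t := by
  rw [lpPowDeriv_apply, ← integral_abs_rpow_eq_norm (by linarith)]
  congr 1
  refine integral_congr_ae (Eventually.of_forall fun x => ?_)
  simp only
  rw [mul_assoc, ← abs_mul_abs_self, ← mul_assoc, rpow_sub_two_mul_self (abs_nonneg _) ht,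
    ← Real.rpow_add_one' (abs_nonneg _) (by linarith)]
  congr 1
  ring

/-- The functional `w ↦ (1/t) ‖J w‖_t^t`. -/
noncomputable def lpPower (J : E →L[ℝ] Lp ℝ (ENNReal.ofReal t) μ) (w : E) : ℝ :=
  1 / t * ‖J w‖ ^ t

/-- The derivative of `lpPower`. -/
noncomputable def lpPowerDeriv (ht : 2 < t) (J : E →L[ℝ] Lp ℝ (ENNReal.ofReal t) μ) (w : E) :
    E →L[ℝ] ℝ :=
  (1 / t) • (lpPowDeriv ht (J w)).comp J

theorem hasFDerivAt_lpPower (ht : 2 < t) (J : E →L[ℝ] Lp ℝ (ENNReal.ofReal t) μ) (w : E) :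
    HasFDerivAt (lpPower J) (lpPowerDeriv ht J w) w := by
  have h := ((hasFDerivAt_lpPow ht (J w)).comp w J.hasFDerivAt).const_mul (1 / t)
  refine h.congr_of_eventuallyEq (Eventually.of_forall fun z => ?_)
  simp only [Function.comp_apply]
  rw [integral_abs_rpow_eq_norm (by linarith), lpPower]

theorem continuous_lpPowerDeriv_of_embedding (ht : 2 < t)
    (J : E →L[ℝ] Lp ℝ (ENNReal.ofReal t) μ) :
    Continuous fun f : Lp ℝ (ENNReal.ofReal t) μ => (1 / t) • (lpPowDeriv ht f).comp J :=
  ((continuous_lpPowDeriv ht).clm_comp continuous_const).const_smul (1 / t)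

theorem continuous_lpPowerDeriv (ht : 2 < t) (J : E →L[ℝ] Lp ℝ (ENNReal.ofReal t) μ) :
    Continuous (lpPowerDeriv ht J) :=
  (continuous_lpPowerDeriv_of_embedding ht J).comp J.continuous

theorem lpPower_nonneg (ht : 2 < t) (J : E →L[ℝ] Lp ℝ (ENNReal.ofReal t) μ) (w : E) :
    0 ≤ lpPower J w :=
  mul_nonneg (one_div_nonneg.2 (by linarith)) (by positivity)

theorem lpPower_neg (J : E →L[ℝ] Lp ℝ (ENNReal.ofReal t) μ) (w : E) :
    lpPower J (-w) = lpPower J w := by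
  rw [lpPower, map_neg, norm_neg, lpPower]

theorem norm_map_smul_rpow (J : E →L[ℝ] Lp ℝ (ENNReal.ofReal t) μ) (w : E) {τ : ℝ} (hτ : 0 < τ) :
    ‖J (τ • w)‖ ^ t = τ ^ t * ‖J w‖ ^ t := by
  rw [map_smul, norm_smul, Real.norm_of_nonneg hτ.le, Real.mul_rpow hτ.le (norm_nonneg _)]

theorem lpPower_smul (J : E →L[ℝ] Lp ℝ (ENNReal.ofReal t) μ) (w : E) {τ : ℝ} (hτ : 0 < τ) :
    lpPower J (τ • w) = τ ^ t * (‖J w‖ ^ t / t) := by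
  rw [lpPower, norm_map_smul_rpow J w hτ]
  ring

theorem lpPowerDeriv_smul (ht : 2 < t) (J : E →L[ℝ] Lp ℝ (ENNReal.ofReal t) μ) (w : E) {τ : ℝ}
    (hτ : 0 < τ) : lpPowerDeriv ht J (τ • w) (τ • w) = τ ^ t * ‖J w‖ ^ t := by
  rw [lpPowerDeriv, smul_apply, ContinuousLinearMap.comp_apply,
    lpPowDeriv_self, norm_map_smul_rpow J w hτ, smul_eq_mul]
  have : t ≠ 0 := by linarith
  field_simp

/-- The derivative is bounded by ‖Jw‖^{t-1}‖J‖‖z‖, and ‖Jw‖^{t-1} is the power (t-1)/t < 1 of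
‖Jw‖^t, hence sublinear in the potential. -/
theorem exists_lpPowerDeriv_le (ht : 2 < t) (J : E →L[ℝ] Lp ℝ (ENNReal.ofReal t) μ) {δ : ℝ}
    (hδ : 0 < δ) : ∃ C : ℝ, 0 ≤ C ∧ ∀ w z,
      |lpPowerDeriv ht J w z| ≤ (δ * lpPower J w + C) * ‖z‖ := by
  have ht0 : 0 < t := by linarith
  obtain ⟨C, hC, hb⟩ := exists_rpow_le_mul_add (θ := (t - 1) / t) (ε := δ / (t * (‖J‖ + 1)))
    (div_nonneg (by linarith) ht0.le) ((div_lt_one ht0).2 (by linarith)) (by positivity)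
  refine ⟨(‖J‖ + 1) * C, by positivity, fun w z => ?_⟩
  have h1 : |lpPowerDeriv ht J w z| ≤ ‖J w‖ ^ (t - 1) * (‖J‖ * ‖z‖) := by
    rw [lpPowerDeriv, smul_apply, ContinuousLinearMap.comp_apply, smul_eq_mul,
      abs_mul, abs_of_nonneg (by positivity : 0 ≤ 1 / t)]
    have h2 := (lpPowDeriv ht (J w)).le_opNorm (J z)
    have h3 := norm_lpPowDeriv_le ht (J w)
    rw [rpow_sub_two_mul_self (norm_nonneg _) ht] at h3
    have h4 : |lpPowDeriv ht (J w) (J z)| ≤ t * ‖J w‖ ^ (t - 1) * (‖J‖ * ‖z‖) :=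
      h2.trans (mul_le_mul h3 (J.le_opNorm z) (norm_nonneg _) (by positivity))
    calc _ ≤ 1 / t * (t * ‖J w‖ ^ (t - 1) * (‖J‖ * ‖z‖)) := by gcongr
      _ = _ := by field_simp
  have h5 := hb (‖J w‖ ^ t) (by positivity)
  rw [← Real.rpow_mul (norm_nonneg _), mul_div_cancel₀ _ ht0.ne'] at h5
  calc _ ≤ ‖J w‖ ^ (t - 1) * (‖J‖ * ‖z‖) := h1
    _ ≤ (δ / (t * (‖J‖ + 1)) * ‖J w‖ ^ t + C) * ((‖J‖ + 1) * ‖z‖) := by gcongr; linarith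
    _ = _ := by rw [lpPower]; field_simp

/-- The derivative depends on w only through Jw, and continuously for the L^t norm; so compactness
of J passes to it. -/
theorem exists_tendsto_lpPowerDeriv (ht : 2 < t) (J : E →L[ℝ] Lp ℝ (ENNReal.ofReal t) μ)
    (hJ : IsCompactOperator J) {w : ℕ → E} {R : ℝ} (hw : ∀ n, ‖w n‖ ≤ R) :
    ∃ (G : E →L[ℝ] ℝ) (σ : ℕ → ℕ), StrictMono σ ∧
      Tendsto (fun n => lpPowerDeriv ht J (w (σ n))) atTop (𝓝 G) := by
  obtain ⟨K, hK, hKJ⟩ := hJ.image_closedBall_subset_compact (f := J.toLinearMap) R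
  obtain ⟨f, -, σ, hσ, hf⟩ := hK.tendsto_subseq (x := fun n => J (w n)) fun n =>
    hKJ (mem_image_of_mem _ (by simpa using hw n))
  exact ⟨_, σ, hσ, ((continuous_lpPowerDeriv_of_embedding ht J).tendsto f).comp hf⟩

theorem isPowerPotential_lpPower_add {E : Type*} [NormedAddCommGroup E] [InnerProductSpace ℝ E]
    (hs : 2 < s) (ht : 2 < t)
    {J₁ : E →L[ℝ] Lp ℝ (ENNReal.ofReal s) μ} {J₂ : E →L[ℝ] Lp ℝ (ENNReal.ofReal t) μ}
    (hJ₁ : IsCompactOperator J₁) (hJ₂ : IsCompactOperator J₂) :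
    IsPowerPotential (fun w => lpPower J₁ w + lpPower J₂ w) s t := by
  have hd : ∀ w, HasFDerivAt (fun w => lpPower J₁ w + lpPower J₂ w)
      (lpPowerDeriv hs J₁ w + lpPowerDeriv ht J₂ w) w := fun w =>
    (hasFDerivAt_lpPower hs J₁ w).add (hasFDerivAt_lpPower ht J₂ w)
  have hf : fderiv ℝ (fun w => lpPower J₁ w + lpPower J₂ w) =
      fun w => lpPowerDeriv hs J₁ w + lpPowerDeriv ht J₂ w := funext fun w => (hd w).fderiv
  refine ⟨?_, hs, ht, fun w => by rw [lpPower_neg, lpPower_neg], fun w => ?_, fun δ hδ => ?_, ?_⟩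
  · rw [contDiff_one_iff_fderiv, hf]
    exact ⟨fun w => (hd w).differentiableAt,
      (continuous_lpPowerDeriv hs J₁).add (continuous_lpPowerDeriv ht J₂)⟩
  · refine ⟨‖J₁ w‖ ^ s, ‖J₂ w‖ ^ t, by positivity, by positivity, fun τ hτ => ⟨?_, ?_⟩⟩
    · rw [lpPower_smul J₁ w hτ, lpPower_smul J₂ w hτ]
    · rw [hf, add_apply, lpPowerDeriv_smul hs J₁ w hτ,
        lpPowerDeriv_smul ht J₂ w hτ]
  · obtain ⟨C₁, hC₁, h₁⟩ := exists_lpPowerDeriv_le hs J₁ hδ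
    obtain ⟨C₂, hC₂, h₂⟩ := exists_lpPowerDeriv_le ht J₂ hδ
    refine ⟨C₁ + C₂, add_nonneg hC₁ hC₂, fun w z => ?_⟩
    rw [hf, add_apply]
    refine (abs_add_le _ _).trans ((add_le_add (h₁ w z) (h₂ w z)).trans (le_of_eq ?_))
    ring
  · rintro w ⟨R, hR⟩
    obtain ⟨G₁, σ, hσ, h₁⟩ := exists_tendsto_lpPowerDeriv hs J₁ hJ₁ hR
    obtain ⟨G₂, ρ, hρ, h₂⟩ := exists_tendsto_lpPowerDeriv ht J₂ hJ₂ fun n => hR (σ n)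
    rw [hf]
    exact ⟨G₁ + G₂, σ ∘ ρ, hσ.comp hρ, (h₁.comp hρ.tendsto_atTop).add h₂⟩

theorem norm_le_mul_lpPower (ht : 2 < t) (J : E →L[ℝ] Lp ℝ (ENNReal.ofReal t) μ) (w : E) :
    ‖J w‖ ≤ t * lpPower J w ^ (1 / t) := by
  have ht0 : 0 < t := by linarith
  have h1 : ‖J w‖ = (t * lpPower J w) ^ (1 / t) := by
    rw [lpPower, ← mul_assoc, mul_one_div_cancel ht0.ne', one_mul, ← Real.rpow_mul (norm_nonneg _),
      mul_one_div_cancel ht0.ne', Real.rpow_one]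
  rw [h1, Real.mul_rpow ht0.le (lpPower_nonneg ht J w)]
  refine mul_le_mul_of_nonneg_right ?_ (Real.rpow_nonneg (lpPower_nonneg ht J w) _)
  conv_rhs => rw [← Real.rpow_one t]
  exact Real.rpow_le_rpow_of_exponent_le (by linarith) ((div_le_one ht0).2 (by linarith))

end PowerPotential

end HamiltonianSystem

/-! ### The Hamiltonian system as an instance of the abstract setting -/

namespace HamiltonianSystem

theorem norm_L2_le_of_ae_eq {X : Type*} [MeasurableSpace X] {μ : Measure X} [IsFiniteMeasure μ]
    {t : ℝ} (ht : 2 < t) {f : Lp ℝ (ENNReal.ofReal t) μ} {g : Lp ℝ 2 μ} (hfg : f =ᵐ[μ] g) :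
    ‖g‖ ≤ (μ univ ^ (1 / 2 - 1 / t)).toReal * ‖f‖ := by
  have ht0 : 0 < t := by linarith
  have h2 : (2 : ENNReal) ≤ ENNReal.ofReal t := by
    simpa using ENNReal.ofReal_le_ofReal ht.le
  have h := eLpNorm_le_eLpNorm_mul_rpow_measure_univ h2 (Lp.aestronglyMeasurable f)
  rw [ENNReal.toReal_ofReal ht0.le, ENNReal.toReal_ofNat] at h
  have hne : μ univ ^ (1 / 2 - 1 / t) ≠ ⊤ :=
    ENNReal.rpow_ne_top_of_nonneg (sub_nonneg.2 (one_div_le_one_div_of_le two_pos ht.le))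
      (measure_ne_top _ _)
  rw [Lp.norm_def, Lp.norm_def, mul_comm, ← ENNReal.toReal_mul, ← eLpNorm_congr_ae hfg]
  exact ENNReal.toReal_mono (ENNReal.mul_ne_top (Lp.eLpNorm_ne_top f) hne) h

variable {N : ℕ} {Ω : Set (Eucl N)} {B : DirichletEigenbasis Ω} {r p q : ℝ}

theorem exists_compact_embedding_compU (hN : 3 ≤ N) [IsFiniteMeasure (vol Ω)] (hΩ : IsOpen Ω)
    (hne : Ω.Nonempty) (hq : 1 < q) (hr₁ : (N : ℝ) * (1 / 2 - 1 / (q + 1)) < r)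
    [Fact (1 ≤ ENNReal.ofReal (q + 1))] :
    ∃ J : Er B r →L[ℝ] Lp ℝ (ENNReal.ofReal (q + 1)) (vol Ω),
      (∀ w, J w =ᵐ[vol Ω] compU w) ∧ IsCompactOperator J := by
  obtain ⟨j, hj, hc⟩ := exists_compact_embedding hN hΩ hne B (by linarith : 2 ≤ q + 1) hr₁
  exact ⟨j.comp (WithLp.fstL 2 ℝ _ _), fun w => hj w.fst, hc.comp_clm (WithLp.fstL 2 ℝ _ _)⟩

theorem exists_compact_embedding_compV (hN : 3 ≤ N) [IsFiniteMeasure (vol Ω)] (hΩ : IsOpen Ω)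
    (hne : Ω.Nonempty) (hp : 1 < p) (hr₂ : r < 2 - (N : ℝ) * (1 / 2 - 1 / (p + 1)))
    [Fact (1 ≤ ENNReal.ofReal (p + 1))] :
    ∃ J : Er B r →L[ℝ] Lp ℝ (ENNReal.ofReal (p + 1)) (vol Ω),
      (∀ w, J w =ᵐ[vol Ω] compV w) ∧ IsCompactOperator J := by
  obtain ⟨j, hj, hc⟩ := exists_compact_embedding hN hΩ hne B (by linarith : 2 ≤ p + 1)
    (by linarith : (N : ℝ) * (1 / 2 - 1 / (p + 1)) < 2 - r)
  exact ⟨j.comp (WithLp.sndL 2 ℝ _ _), fun w => hj w.snd, hc.comp_clm (WithLp.sndL 2 ℝ _ _)⟩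

section Embeddings

variable [Fact (1 ≤ ENNReal.ofReal (q + 1))] [Fact (1 ≤ ENNReal.ofReal (p + 1))]
  {J₁ : Er B r →L[ℝ] Lp ℝ (ENNReal.ofReal (q + 1)) (vol Ω)}
  {J₂ : Er B r →L[ℝ] Lp ℝ (ENNReal.ofReal (p + 1)) (vol Ω)}

theorem powerTerm_eq_lpPower_add (hp : 1 < p) (hq : 1 < q) (hJ₁ : ∀ w, J₁ w =ᵐ[vol Ω] compU w)
    (hJ₂ : ∀ w, J₂ w =ᵐ[vol Ω] compV w) :
    (powerTerm p q : Er B r → ℝ) = fun w => lpPower J₁ w + lpPower J₂ w := by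
  funext w
  rw [powerTerm, lpPower, lpPower, ← integral_abs_rpow_eq_norm (by linarith),
    ← integral_abs_rpow_eq_norm (by linarith)]
  congr 2 <;> refine integral_congr_ae ?_
  · filter_upwards [hJ₁ w] with x hx
    rw [hx]
  · filter_upwards [hJ₂ w] with x hx
    rw [hx]

theorem pertTerm_eq_inner (h k : L2 Ω) (w : Er B r) :
    pertTerm h k w = inner ℝ k (compU w) + inner ℝ h (compV w) := by
  rw [pertTerm, L2.inner_def, L2.inner_def]
  simp only [RCLike.inner_apply, conj_trivial, mul_comm]

/-- On a set of finite measure the L² norm is bounded by the L^{q+1} and L^{p+1} norms, which are at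
most multiples of P^{1/(q+1)} and P^{1/(p+1)}. `D` is fixed before h and k, so they enter the bound
through their norms only. -/
theorem exists_pertTerm_clm [IsFiniteMeasure (vol Ω)] (hp : 1 < p) (hq : 1 < q)
    (hJ₁ : ∀ w, J₁ w =ᵐ[vol Ω] compU w) (hJ₂ : ∀ w, J₂ w =ᵐ[vol Ω] compV w) :
    ∃ D : ℝ, 0 ≤ D ∧ ∀ h k : L2 Ω, ∃ ℓ : Er B r →L[ℝ] ℝ, (∀ w, ℓ w = pertTerm h k w) ∧
      IsLowerOrder (powerTerm p q) (q + 1) (p + 1) (D * (‖h‖ + ‖k‖)) ℓ := by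
  have hU := fun w => norm_L2_le_of_ae_eq (by linarith : 2 < q + 1) (hJ₁ w)
  have hV := fun w => norm_L2_le_of_ae_eq (by linarith : 2 < p + 1) (hJ₂ w)
  set C₁ := ((vol Ω) univ ^ (1 / 2 - 1 / (q + 1))).toReal
  set C₂ := ((vol Ω) univ ^ (1 / 2 - 1 / (p + 1))).toReal
  have hC₁ : 0 ≤ C₁ := ENNReal.toReal_nonneg
  have hC₂ : 0 ≤ C₂ := ENNReal.toReal_nonneg
  have hbound : ∀ (h k : L2 Ω) (w : Er B r),
      |pertTerm h k w| ≤ ‖k‖ * (C₁ * ‖J₁ w‖) + ‖h‖ * (C₂ * ‖J₂ w‖) := fun h k w => by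
    rw [pertTerm_eq_inner]
    refine (abs_add_le _ _).trans (add_le_add ?_ ?_)
    · exact (abs_real_inner_le_norm _ _).trans (mul_le_mul_of_nonneg_left (hU w) (norm_nonneg _))
    · exact (abs_real_inner_le_norm _ _).trans (mul_le_mul_of_nonneg_left (hV w) (norm_nonneg _))
  refine ⟨C₁ * (q + 1) + C₂ * (p + 1), by positivity, fun h k => ?_⟩
  let L : Er B r →ₗ[ℝ] ℝ :=
    { toFun := pertTerm h k
      map_add' := fun w z => by
        simp only [pertTerm_eq_inner, compU, compV, WithLp.add_fst, WithLp.add_snd, map_add,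
          inner_add_right]
        ring
      map_smul' := fun c w => by
        simp only [pertTerm_eq_inner, compU, compV, WithLp.smul_fst, WithLp.smul_snd, map_smul,
          inner_smul_right, RingHom.id_apply, smul_eq_mul]
        ring }
  refine ⟨L.mkContinuous (‖k‖ * (C₁ * ‖J₁‖) + ‖h‖ * (C₂ * ‖J₂‖)) fun w => ?_, fun w => rfl,
    fun w => ?_⟩
  · refine (hbound h k w).trans ?_
    calc _ ≤ ‖k‖ * (C₁ * (‖J₁‖ * ‖w‖)) + ‖h‖ * (C₂ * (‖J₂‖ * ‖w‖)) := by
          gcongr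
          · exact J₁.le_opNorm w
          · exact J₂.le_opNorm w
      _ = _ := by ring
  · refine (hbound h k w).trans ?_
    have n₁ := lpPower_nonneg (by linarith) J₁ w
    have n₂ := lpPower_nonneg (by linarith) J₂ w
    have h₁ := norm_le_mul_lpPower (by linarith) J₁ w
    have h₂ := norm_le_mul_lpPower (by linarith) J₂ w
    rw [powerTerm_eq_lpPower_add hp hq hJ₁ hJ₂]
    set P := lpPower J₁ w + lpPower J₂ w with hP
    have h₁' : ‖J₁ w‖ ≤ (q + 1) * P ^ (1 / (q + 1)) := h₁.trans <| by
      gcongr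
      linarith
    have h₂' : ‖J₂ w‖ ≤ (p + 1) * P ^ (1 / (p + 1)) := h₂.trans <| by
      gcongr
      linarith
    have hP0 : 0 ≤ P := add_nonneg n₁ n₂
    have p₁ : 0 ≤ P ^ (1 / (q + 1)) := by positivity
    have p₂ : 0 ≤ P ^ (1 / (p + 1)) := by positivity
    have e₁ : ‖k‖ * (C₁ * ‖J₁ w‖) ≤
        (C₁ * (q + 1) + C₂ * (p + 1)) * (‖h‖ + ‖k‖) * P ^ (1 / (q + 1)) := by
      calc _ ≤ ‖k‖ * (C₁ * ((q + 1) * P ^ (1 / (q + 1)))) := by gcongr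
        _ = C₁ * (q + 1) * ‖k‖ * P ^ (1 / (q + 1)) := by ring
        _ ≤ _ := by
          gcongr
          · exact le_add_of_nonneg_right (by positivity)
          · exact le_add_of_nonneg_left (norm_nonneg _)
    have e₂ : ‖h‖ * (C₂ * ‖J₂ w‖) ≤
        (C₁ * (q + 1) + C₂ * (p + 1)) * (‖h‖ + ‖k‖) * P ^ (1 / (p + 1)) := by
      calc _ ≤ ‖h‖ * (C₂ * ((p + 1) * P ^ (1 / (p + 1)))) := by gcongr
        _ = C₂ * (p + 1) * ‖h‖ * P ^ (1 / (p + 1)) := by ring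
        _ ≤ _ := by
          gcongr
          · exact le_add_of_nonneg_left (by positivity)
          · exact le_add_of_nonneg_right (norm_nonneg _)
    linarith

theorem powerTerm_pos [IsFiniteMeasure (vol Ω)] (hp : 1 < p) (hq : 1 < q)
    (hJ₁ : ∀ w, J₁ w =ᵐ[vol Ω] compU w) (hJ₂ : ∀ w, J₂ w =ᵐ[vol Ω] compV w) {w : Er B r}
    (hw : compU w ≠ 0) : 0 < powerTerm p q w := by
  rw [powerTerm_eq_lpPower_add hp hq hJ₁ hJ₂]
  have h1 : 0 < ‖J₁ w‖ := by
    refine (norm_nonneg _).lt_of_ne fun h0 => hw ?_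
    have h := norm_L2_le_of_ae_eq (by linarith : 2 < q + 1) (hJ₁ w)
    rw [← h0, mul_zero] at h
    exact norm_le_zero_iff.1 h
  refine add_pos_of_pos_of_nonneg ?_ (lpPower_nonneg (by linarith) J₂ w)
  exact mul_pos (one_div_pos.2 (by linarith)) (by positivity)

end Embeddings

section Reflection

variable {ℓ : Er B r →L[ℝ] ℝ} {h k : L2 Ω} (hr : 0 ≤ r) (hr' : 0 ≤ 2 - r)

theorem functionalI_eq_energyI (hℓ : ∀ w, ℓ w = pertTerm h k w) :
    (functionalI p q h k : Er B r → ℝ) = energyI (reflection B hr hr') (powerTerm p q) ℓ := by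
  funext w
  rw [functionalI, energyI, hℓ, quadForm_eq_inner_reflection hr hr']

theorem functionalJ_eq_energyJ (hℓ : ∀ w, ℓ w = pertTerm h k w) (A : ℝ) (χ : ℝ → ℝ) :
    (functionalJ p q h k A χ : Er B r → ℝ) =
      energyJ (reflection B hr hr') (powerTerm p q) ℓ A χ := by
  funext w
  rw [functionalJ, energyJ, cutoffFactor, cutoffRatio, functionalQ, energyQ,
    functionalI_eq_energyI hr hr' hℓ, hℓ, quadForm_eq_inner_reflection hr hr']

theorem isCutoffConstant_iff_isAdmissible (hℓ : ∀ w, ℓ w = pertTerm h k w) (A : ℝ) :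
    IsCutoffConstant B r p q h k A ↔
      IsAdmissible (reflection B hr hr') (powerTerm p q) ℓ A := by
  rw [IsCutoffConstant, IsAdmissible, functionalI_eq_energyI hr hr' hℓ]

/-- The point (φ_0, φ_0), with quadratic form λ_0 > 0, starts the ray in `IsAdmissible.pos`. -/
theorem exists_inner_reflection_pos (hr : 0 ≤ r) (hr' : 0 ≤ 2 - r) :
    ∃ w : Er B r, 0 < inner ℝ (reflection B hr hr' w) w ∧ compU w ≠ 0 := by
  set x : Er B r := WithLp.toLp 2 (Theta.eigenfunction B r 0,
    Theta.eigenfunction B (2 - r) 0) with hx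
  refine ⟨x, ?_, fun h0 => B.φ.orthonormal.ne_zero 0 h0⟩
  have h := quadForm_eq_inner_reflection hr hr' x
  have h1 : quadForm x = B.ev 0 := by
    rw [quadForm, tsum_eq_single 0]
    · simp [hx, coeff_eigenfunction]
    · intro k hk
      simp [hx, coeff_eigenfunction, hk]
  have h2 := B.ev_pos 0
  linarith

end Reflection

theorem norm_fderiv_restrict_apply_le {E : Type*} [NormedAddCommGroup E] [NormedSpace ℝ E]
    {F : E → ℝ} (X : Submodule ℝ E) {w : X} (hF : DifferentiableAt ℝ F w) {z : E} (hz : z ∈ X) :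
    |fderiv ℝ F w z| ≤ ‖fderiv ℝ (fun y : X => F y) w‖ * ‖z‖ := by
  have h : HasFDerivAt (fun y : X => F y) ((fderiv ℝ F w).comp X.subtypeL) w :=
    hF.hasFDerivAt.comp w X.subtypeL.hasFDerivAt
  rw [h.fderiv]
  exact ((fderiv ℝ F w).comp X.subtypeL).le_opNorm ⟨z, hz⟩

end HamiltonianSystem

theorem proposition4p2 (N : ℕ) (hN : 3 ≤ N) (Ω : Set (Eucl N)) (hΩ : IsSmoothBoundedDomain Ω)
    (B : DirichletEigenbasis Ω) (p q r : ℝ) (hp : 1 < p) (hq : 1 < q)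
    (hr₁ : (N : ℝ) * (1 / 2 - 1 / (q + 1)) < r)
    (hr₂ : r < 2 - (N : ℝ) * (1 / 2 - 1 / (p + 1)))
    (χ : ℝ → ℝ) (hχ : IsCutoff χ) (a b : ℝ) :
    -- the functional `I` is well defined and of class `C¹`
    (∀ w : Er B r, Integrable (fun x => |compU w x| ^ (q + 1)) (vol Ω) ∧
      Integrable (fun x => |compV w x| ^ (p + 1)) (vol Ω)) ∧
    (∀ h k : L2 Ω, ContDiff ℝ 1 (functionalI p q h k : Er B r → ℝ)) ∧
    -- constants `A` as used in the definition of `J` exist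
    (∃ A : ℝ, 0 < A ∧ ∀ h k : L2 Ω, ‖h‖ = a → ‖k‖ = b → IsCutoffConstant B r p q h k A) ∧
    -- for every such constant, `J` is of class `C¹` and has the three properties
    (∀ A : ℝ, ∃ β M₀ M₁ : ℝ, 0 < β ∧ 0 < M₀ ∧ M₀ ≤ M₁ ∧
      ∀ h k : L2 Ω, ‖h‖ = a → ‖k‖ = b → IsCutoffConstant B r p q h k A →
        ContDiff ℝ 1 (functionalJ p q h k A χ : Er B r → ℝ) ∧
        (∀ w : Er B r,
          |functionalJ p q h k A χ w - functionalJ p q h k A χ (-w)| ≤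
            β * (|functionalJ p q h k A χ w| ^ (1 / (q + 1)) +
              |functionalJ p q h k A χ w| ^ (1 / (p + 1)) + 1)) ∧
        (∀ w : Er B r, M₀ ≤ functionalJ p q h k A χ w →
          fderiv ℝ (functionalJ p q h k A χ) w = 0 →
          functionalJ p q h k A χ w = functionalI p q h k w ∧
            fderiv ℝ (functionalI p q h k) w = 0) ∧
        (∀ c : ℝ, M₁ < c →
          PalaisSmale (functionalJ p q h k A χ : Er B r → ℝ) c ∧
            GalerkinPalaisSmale (galerkinSpace B r) (functionalJ p q h k A χ) c)) := by
  have hN0 : (0 : ℝ) ≤ N := Nat.cast_nonneg N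
  have hr : 0 ≤ r := by
    have : 1 / (q + 1) ≤ 1 / 2 := one_div_le_one_div_of_le two_pos (by linarith)
    linarith [mul_nonneg hN0 (sub_nonneg.2 this)]
  have hr' : 0 ≤ 2 - r := by
    have : 1 / (p + 1) ≤ 1 / 2 := one_div_le_one_div_of_le two_pos (by linarith)
    linarith [mul_nonneg hN0 (sub_nonneg.2 this)]
  have : IsFiniteMeasure (vol Ω) := isFiniteMeasure_restrict.2 hΩ.isBounded.measure_lt_top.ne
  have : Fact (1 ≤ ENNReal.ofReal (q + 1)) := ⟨by
    simpa using ENNReal.ofReal_le_ofReal (by linarith : (1 : ℝ) ≤ q + 1)⟩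
  have : Fact (1 ≤ ENNReal.ofReal (p + 1)) := ⟨by
    simpa using ENNReal.ofReal_le_ofReal (by linarith : (1 : ℝ) ≤ p + 1)⟩
  have : CompleteSpace (Theta B r) := completeSpace_theta B hr
  have : CompleteSpace (Theta B (2 - r)) := completeSpace_theta B hr'
  have hne := hΩ.isConnected.nonempty
  obtain ⟨J₁, hJ₁, hc₁⟩ := exists_compact_embedding_compU (B := B) hN hΩ.isOpen hne hq hr₁
  obtain ⟨J₂, hJ₂, hc₂⟩ := exists_compact_embedding_compV (B := B) hN hΩ.isOpen hne hp hr₂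
  have hP : IsPowerPotential (powerTerm p q : Er B r → ℝ) (q + 1) (p + 1) := by
    rw [powerTerm_eq_lpPower_add hp hq hJ₁ hJ₂]
    exact isPowerPotential_lpPower_add (by linarith) (by linarith) hc₁ hc₂
  obtain ⟨D, hD, hpert⟩ := exists_pertTerm_clm hp hq hJ₁ hJ₂
  -- `a` and `b` are arbitrary reals; the absolute values keep the constant nonnegative when no h, k
  -- have these norms.
  have hK : 0 ≤ D * (|a| + |b|) := by positivity
  have hpert' : ∀ h k : L2 Ω, ‖h‖ = a → ‖k‖ = b → ∃ ℓ : Er B r →L[ℝ] ℝ,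
      (∀ w, ℓ w = pertTerm h k w) ∧
        IsLowerOrder (powerTerm p q) (q + 1) (p + 1) (D * (|a| + |b|)) ℓ := by
    intro h k ha hb
    have := hpert h k
    rwa [← abs_norm h, ← abs_norm k, ha, hb] at this
  have hS := inner_reflection_left (B := B) hr hr'
  have hSS := reflection_reflection (B := B) hr hr'
  refine ⟨fun w => ⟨?_, ?_⟩, fun h k => ?_, ?_, fun A => ?_⟩
  · refine (integrable_abs_rpow (by linarith) (J₁ w)).congr ?_
    filter_upwards [hJ₁ w] with x hx
    rw [hx]
  · refine (integrable_abs_rpow (by linarith) (J₂ w)).congr ?_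
    filter_upwards [hJ₂ w] with x hx
    rw [hx]
  · obtain ⟨ℓ, hℓ, -⟩ := hpert h k
    rw [functionalI_eq_energyI hr hr' hℓ]
    exact contDiff_energyI hP
  · obtain ⟨A, hA, h⟩ := exists_isAdmissible hP hS hK
    refine ⟨A, hA, fun f g hf hg => ?_⟩
    obtain ⟨ℓ, hℓ, hlow⟩ := hpert' f g hf hg
    exact (isCutoffConstant_iff_isAdmissible hr hr' hℓ A).2 (h ℓ hlow)
  -- No pair (h, k) admits a constant A ≤ 0, by `IsAdmissible.pos`, so in that case any β, M₀, M₁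
  -- will do.
  rcases le_or_gt A 0 with hA | hA
  · refine ⟨1, 1, 1, one_pos, one_pos, le_rfl, fun h k _ _ hadm => ?_⟩
    obtain ⟨ℓ, hℓ, -⟩ := hpert h k
    obtain ⟨w, hw, hUw⟩ := exists_inner_reflection_pos (B := B) hr hr'
    rw [isCutoffConstant_iff_isAdmissible hr hr' hℓ] at hadm
    exact absurd (hadm.pos hP hS hw (powerTerm_pos hp hq hJ₁ hJ₂ hUw)) hA.not_gt
  obtain ⟨β, hβ, heven⟩ := exists_almost_even (S := reflection B hr hr') hP hK hA hχ
  obtain ⟨M₀, hM₀, hcrit⟩ := exists_critical_level hP hS hK hA hχ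
  obtain ⟨M, hPS⟩ := exists_palaisSmale_level hP hS hSS hK hA hχ
  refine ⟨β, M₀, max M₀ M, hβ, hM₀, le_max_left _ _, fun h k ha hb hadm => ?_⟩
  obtain ⟨ℓ, hℓ, hlow⟩ := hpert' h k ha hb
  rw [isCutoffConstant_iff_isAdmissible hr hr' hℓ] at hadm
  have hJ : ContDiff ℝ 1 (energyJ (reflection B hr hr') (powerTerm p q) ℓ A χ) :=
    contDiff_energyJ hP hA hχ
  rw [functionalJ_eq_energyJ hr hr' hℓ, functionalI_eq_energyI hr hr' hℓ]
  refine ⟨hJ, heven ℓ hlow, hcrit ℓ hlow hadm, fun c hc => ⟨fun w hw hw' => ?_, fun w hw hw' => ?_⟩⟩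
  -- The condition (PS)_c is the case of the constant family X_n = ⊤, with ε_n the norm of the
  -- derivative.
  · exact hPS ℓ hlow c ((le_max_right _ _).trans_lt hc) (fun _ => ⊤) (fun _ _ _ => trivial)
      (fun x => ⟨fun _ => x, fun _ => trivial, tendsto_const_nhds⟩) w _ (fun _ => trivial) hw' hw
      fun n z _ => (fderiv ℝ (energyJ (reflection B hr hr') (powerTerm p q) ℓ A χ) (w n)).le_opNorm z
  · exact hPS ℓ hlow c ((le_max_right _ _).trans_lt hc) (galerkinSpace B r)
      (fun n x hx => reflection_mem_galerkinSpace hr hr' hx)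
      (exists_tendsto_galerkinSpace hr hr') (fun n => (w n : Er B r)) _ (fun n => (w n).2) hw' hw
      fun n z hz => norm_fderiv_restrict_apply_le _ ((hJ.differentiable one_ne_zero) _) hz
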